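/- Let $M$ be a smooth supermanifold and $E\to M$ a super vector bundle of rank $k|l$ with $k+l>0$. Write $C^\infty(M)$ and $C^\infty(M,E)$ for the $\mathbb Z_2$-graded algebra of functions and module of sections; a tilde denotes parity. Let $\Pi E$ be the parity-reversed bundle, with base coordinates $x^a$ and fibre coordinates $\xi^i$ (of parity $\tilde\xi^i=\tilde e_i+1$ for a local frame $e_i$ of $E$). Weight means degree in the $\xi^i$, so that $\partial/\partial\xi^i$ has weight $-1$. For a homogeneous section $u=u^i(x)e_i$ put $\iota(u)=(-1)^{\tilde u}u^i(x)\,\partial/\partial\xi^i$; this extends to an odd isomorphism $\iota$ from sections of $E$ onto vector fields of weight $-1$ on $\Pi E$. A formal vector field on $\Pi E$ is a formal sum of vector fields of weights $-1,0,1,2,\dots$, acting on formal power series in the $\xi^i$. **Definition.** An $L_\infty$-algebroid structure on $E$ consists of $\mathbb R$-multilinear brackets $[-,\dots,-]\colon C^\infty(M,E)^n\to C^\infty(M,E)$ and of anchors $a_n$ ($n=0,1,2,\dots$), where $a_n$ assigns to $n$ sections a vector field on $M$, such that: 1. the $n$-bracket has parity $n \bmod 2$ and is graded antisymmetric (exchanging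 neighbours $u_k,u_{k+1}$ gives the sign $-(-1)^{\tilde u_k\tilde u_{k+1}}$), and for all $n\ge 0$ and all homogeneous sections $$\sum_{r+s=n}(-1)^{rs}\sum_{(r,s)\text{-shuffles }\sigma}(-1)^{\alpha}\,\mathrm{sign}\,\sigma\;[[u_{\sigma(1)},\dots,u_{\sigma(r)}],u_{\sigma(r+1)},\dots,u_{\sigma(n)}]=0,$$ where $(-1)^\alpha$ is the Koszul sign of $\sigma$ for the parities $\tilde u_1,\dots,\tilde u_n$; 2. $a_n$ has parity $n-1 \bmod 2$, is graded antisymmetric, and is multilinear over functions: $a_n(u_1,\dots,fu_k,\dots,u_n)=(-1)^{\tilde f(n-1+\tilde u_1+\dots+\tilde u_{k-1})}f\,a_n(u_1,\dots,u_n)$; 3. $[u_1,\dots,u_n,fv]=a_n(u_1,\dots,u_n)(f)\,v+(-1)^{\tilde f(n+1+\tilde u_1+\dots+\tilde u_n)}f\,[u_1,\dots,u_n,v]$ for all homogeneous $f\in C^\infty(M)$ and all sections $v$. **Theorem.** Let $Q$ be an odd formal vector field on $\Pi E$. There is exactly one sequence of $\mathbb R$-multilinear brackets and anchors such that, for all $n\ge0$,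 homogeneous sections $u_1,\dots,u_n$ and $f\in C^\infty(M)$, $$\iota\bigl([u_1,\dots,u_n]\bigr)=(-1)^{\varepsilon}\,[\dots[[Q,\iota(u_1)],\iota(u_2)],\dots,\iota(u_n)]_{-1},$$ $$a_n(u_1,\dots,u_n)(f)=(-1)^{\varepsilon+n+1}\,[\dots[[Q,\iota(u_1)],\iota(u_2)],\dots,\iota(u_n)]_{0}(f),$$ where the brackets on the right are supercommutators, the subscripts $-1$ and $0$ denote projections to the components of these weights, and $\varepsilon=\sum_{k=1}^n\tilde u_k(n-k)$. These operations form an $L_\infty$-algebroid structure on $E$ if and only if $Q^2=0$. -/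

import Mathlib

open scoped Manifold ContDiff TensorProduct
open TopologicalSpace

set_option linter.unusedSectionVars false
set_option linter.checkUnivs false

namespace SuperGeom

/-! ### Signs and parities -/

/-- `(-1)^e` for a parity `e`. -/
def psgn (e : ZMod 2) : ℤ := if e = 0 then 1 else -1

theorem psgn_zero : psgn 0 = 1 := by decide

theorem psgn_add (a b : ZMod 2) : psgn (a + b) = psgn a * psgn b := by
  revert a b; decide

theorem psgn_mul_self (a : ZMod 2) : psgn a * psgn a = 1 := by
  revert a; decide

/-- A `ZMod 2`-graded algebra is supercommutative: `ab = (-1)^{ãb̃} ba`. -/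
class IsSupercommutative {A : Type*} [Ring A] [Algebra ℝ A] (𝒜 : ZMod 2 → Submodule ℝ A) :
    Prop where
  comm : ∀ (i j : ZMod 2) (a b : A), a ∈ 𝒜 i → b ∈ 𝒜 j → a * b = psgn (i * j) • (b * a)

/-! ### Supermanifolds and super vector bundles -/

/-- Smooth real functions on an open subset of `ℝ^p`. -/
abbrev SmoothFun (p : ℕ) (W : Opens (EuclideanSpace ℝ (Fin p))) : Type :=
  C^∞⟮𝓘(ℝ, EuclideanSpace ℝ (Fin p)), W; 𝓘(ℝ, ℝ), ℝ⟯

/-- The superfunctions on an open subset of the superspace `ℝ^{p|q}`: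
`C^∞(W) ⊗ Λ(θ¹, …, θ^q)`. -/
abbrev ModelFun (p q : ℕ) (W : Opens (EuclideanSpace ℝ (Fin p))) : Type :=
  SmoothFun p W ⊗[ℝ] ExteriorAlgebra ℝ (Fin q → ℝ)

/-- The image of an open set under an open embedding. -/
def imageOpen {Y X : Type*} [TopologicalSpace Y] [TopologicalSpace X] {ψ : Y → X}
    (h : Topology.IsOpenEmbedding ψ) (W : Opens Y) : Opens X :=
  ⟨ψ '' W, h.isOpenMap _ W.isOpen⟩

theorem imageOpen_mono {Y X : Type*} [TopologicalSpace Y] [TopologicalSpace X] {ψ : Y → X}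
    (h : Topology.IsOpenEmbedding ψ) {W' W : Opens Y} (hW : W' ≤ W) :
    imageOpen h W' ≤ imageOpen h W :=
  Set.image_mono hW

universe u v w

/-- A smooth supermanifold of dimension `p|q`: a Hausdorff second countable space with a sheaf of
supercommutative real algebras which is locally isomorphic to the superspace `ℝ^{p|q}`. -/
structure Supermanifold (p q : ℕ) where
  carrier : Type u
  [top : TopologicalSpace carrier]
  [t2 : T2Space carrier]
  [sc : SecondCountableTopology carrier]
  /-- functions on an open set -/
  O : Opens carrier → Type v
  [ring : ∀ U, Ring (O U)]
  [alg : ∀ U, Algebra ℝ (O U)]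
  /-- even and odd functions -/
  par : ∀ U, ZMod 2 → Submodule ℝ (O U)
  [graded : ∀ U, GradedAlgebra (par U)]
  [supercomm : ∀ U, IsSupercommutative (par U)]
  res : ∀ {V U : Opens carrier}, V ≤ U → O U →ₐ[ℝ] O V
  res_id : ∀ (U : Opens carrier) (f : O U), res (le_refl U) f = f
  res_res : ∀ {W V U : Opens carrier} (hWV : W ≤ V) (hVU : V ≤ U) (f : O U),
    res hWV (res hVU f) = res (hWV.trans hVU) f
  res_par : ∀ {V U : Opens carrier} (h : V ≤ U) (i : ZMod 2) (f : O U),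
    f ∈ par U i → res h f ∈ par V i
  glue : ∀ {ι : Type u} (U : ι → Opens carrier) (f : ∀ i, O (U i)),
    (∀ i j, res (inf_le_left : U i ⊓ U j ≤ U i) (f i) =
      res (inf_le_right : U i ⊓ U j ≤ U j) (f j)) →
    ∃! g : O (iSup U), ∀ i, res (le_iSup U i) g = f i
  /-- around every point there is an open embedding `ψ` of `ℝ^p`, together with an isomorphism of
  sheaves of superalgebras between `W ↦ C^∞(W) ⊗ Λ(θ¹, …, θ^q)` and the restriction of `O` -/
  chart : ∀ x : carrier, ∃ (ψ : EuclideanSpace ℝ (Fin p) → carrier)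
    (h : Topology.IsOpenEmbedding ψ)
    (Φ : ∀ W : Opens (EuclideanSpace ℝ (Fin p)), ModelFun p q W ≃ₐ[ℝ] O (imageOpen h W)),
    x ∈ Set.range ψ ∧
    (∀ (W : Opens (EuclideanSpace ℝ (Fin p))) (i : ZMod 2) (f : SmoothFun p W)
      (η : ExteriorAlgebra ℝ (Fin q → ℝ)),
      η ∈ CliffordAlgebra.evenOdd (0 : QuadraticForm ℝ (Fin q → ℝ)) i →
      Φ W (f ⊗ₜ η) ∈ par (imageOpen h W) i) ∧
    (∀ (W' W : Opens (EuclideanSpace ℝ (Fin p))) (hW : W' ≤ W) (f : SmoothFun p W)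
      (η : ExteriorAlgebra ℝ (Fin q → ℝ)),
      res (imageOpen_mono h hW) (Φ W (f ⊗ₜ η)) =
        Φ W' (ContMDiffMap.restrictRingHom 𝓘(ℝ, EuclideanSpace ℝ (Fin p)) 𝓘(ℝ, ℝ) ℝ hW f ⊗ₜ η))

attribute [instance] Supermanifold.top Supermanifold.t2 Supermanifold.sc Supermanifold.ring
  Supermanifold.alg Supermanifold.graded Supermanifold.supercomm

/-- A super vector bundle of rank `r|s` over a supermanifold, given by its sheaf of sections:
a locally free sheaf of `ZMod 2`-graded modules over the sheaf of functions. -/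
structure SuperVectorBundle {p q : ℕ} (M : Supermanifold.{u, v} p q) (r s : ℕ) where
  /-- sections over an open set -/
  sec : Opens M.carrier → Type w
  [addCommGroup : ∀ U, AddCommGroup (sec U)]
  [module : ∀ U, Module (M.O U) (sec U)]
  [moduleReal : ∀ U, Module ℝ (sec U)]
  [tower : ∀ U, IsScalarTower ℝ (M.O U) (sec U)]
  /-- even and odd sections -/
  par : ∀ U, ZMod 2 → Submodule ℝ (sec U)
  [decomp : ∀ U, DirectSum.Decomposition (par U)]
  smul_par : ∀ (U : Opens M.carrier) (i j : ZMod 2) (f : M.O U) (σ : sec U),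
    f ∈ M.par U i → σ ∈ par U j → f • σ ∈ par U (i + j)
  res : ∀ {V U : Opens M.carrier}, V ≤ U → sec U →ₗ[ℝ] sec V
  res_id : ∀ (U : Opens M.carrier) (σ : sec U), res (le_refl U) σ = σ
  res_res : ∀ {W V U : Opens M.carrier} (hWV : W ≤ V) (hVU : V ≤ U) (σ : sec U),
    res hWV (res hVU σ) = res (hWV.trans hVU) σ
  res_par : ∀ {V U : Opens M.carrier} (h : V ≤ U) (i : ZMod 2) (σ : sec U),
    σ ∈ par U i → res h σ ∈ par V i
  res_smul : ∀ {V U : Opens M.carrier} (h : V ≤ U) (f : M.O U) (σ : sec U),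
    res h (f • σ) = M.res h f • res h σ
  glue : ∀ {ι : Type u} (U : ι → Opens M.carrier) (σ : ∀ i, sec (U i)),
    (∀ i j, res (inf_le_left : U i ⊓ U j ≤ U i) (σ i) =
      res (inf_le_right : U i ⊓ U j ≤ U j) (σ j)) →
    ∃! τ : sec (iSup U), ∀ i, res (le_iSup U i) τ = σ i
  /-- local frames of `r` even and `s` odd sections -/
  frame : ∀ x : M.carrier, ∃ (U : Opens M.carrier) (e : Fin r ⊕ Fin s → sec U), x ∈ U ∧
    (∀ i, e (Sum.inl i) ∈ par U 0) ∧ (∀ j, e (Sum.inr j) ∈ par U 1) ∧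
    ∀ (V : Opens M.carrier) (h : V ≤ U) (σ : sec V),
      ∃! c : Fin r ⊕ Fin s → M.O V, σ = ∑ i, c i • res h (e i)

attribute [instance] SuperVectorBundle.addCommGroup SuperVectorBundle.module
  SuperVectorBundle.moduleReal SuperVectorBundle.tower SuperVectorBundle.decomp

/-! ### Formal functions and formal vector fields on `ΠE`

In this part `A` is the superalgebra of functions on the base and `L` the `A`-module of sections
of `E`; they are specialized to a supermanifold and a super vector bundle further below. -/

section Algebra

variable {A L : Type*} [Ring A] [Algebra ℝ A] (𝒜 : ZMod 2 → Submodule ℝ A) [GradedAlgebra 𝒜]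
  [AddCommGroup L] [Module A L] [Module ℝ L] (ℒ : ZMod 2 → Submodule ℝ L)

/-- A homogeneous section, with its parity. -/
structure HSec where
  par : ZMod 2
  val : L
  mem : val ∈ ℒ par

variable {ℒ}

/-- The parity of the vector field `ι(u_1) ⋯ ι(u_n)`: each `ι(u)` has parity `ũ + 1`. -/
def shiftedPar (l : List (HSec ℒ)) : ZMod 2 := (l.map fun u => u.par + 1).sum

/-- Formal functions on the supermanifold `ΠE`, that is, formal power series along the fibres of
`ΠE → M` with coefficients in functions on `M`. Such a function `F` is given by its Taylor
coefficients at the zero section,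
`F [u₁, …, u_n] = (ι(u_n) ⋯ ι(u₁) F)|_M ∈ A`,
with `ι(u) = (-1)^ũ uⁱ ∂/∂ξⁱ` the (vertical, fibrewise constant) vector field of the section `u`.
The part of `F` on lists of length `n` is the part of weight `n`, a fibrewise homogeneous
polynomial of degree `n` in the `ξⁱ`. The Taylor coefficients are exactly the additive
functions that are graded symmetric, since the `ι(u)` supercommute and have parity `ũ + 1`, and
tensorial, since `ι(fu) = (-1)^f̃ f ι(u)`. -/
structure IsFormalFun (𝒜 : ZMod 2 → Submodule ℝ A) (F : List (HSec ℒ) → A) : Prop where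
  add : ∀ (l₁ l₂ : List (HSec ℒ)) (a b c : HSec ℒ), a.par = c.par → b.par = c.par →
    c.val = a.val + b.val → F (l₁ ++ c :: l₂) = F (l₁ ++ a :: l₂) + F (l₁ ++ b :: l₂)
  smul : ∀ (l₁ l₂ : List (HSec ℒ)) (d : ZMod 2) (f : A) (a b : HSec ℒ), f ∈ 𝒜 d →
    b.par = d + a.par → b.val = f • a.val →
    F (l₁ ++ b :: l₂) = psgn (d * (1 + shiftedPar l₂)) • (f * F (l₁ ++ a :: l₂))
  symm : ∀ (l₁ l₂ : List (HSec ℒ)) (a b : HSec ℒ),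
    F (l₁ ++ a :: b :: l₂) = psgn ((a.par + 1) * (b.par + 1)) • F (l₁ ++ b :: a :: l₂)

variable (ℒ)

/-- The space of formal functions on `ΠE`. -/
def FormalFun : Submodule ℝ (List (HSec ℒ) → A) where
  carrier := {F | IsFormalFun 𝒜 F}
  add_mem' := by
    intro F G hF hG
    refine ⟨?_, ?_, ?_⟩
    · intro l₁ l₂ a b c h1 h2 h3
      simp only [Pi.add_apply, hF.add l₁ l₂ a b c h1 h2 h3, hG.add l₁ l₂ a b c h1 h2 h3]
      abel
    · intro l₁ l₂ d f a b h1 h2 h3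
      simp only [Pi.add_apply, hF.smul l₁ l₂ d f a b h1 h2 h3, hG.smul l₁ l₂ d f a b h1 h2 h3,
        mul_add, smul_add]
    · intro l₁ l₂ a b
      simp only [Pi.add_apply, hF.symm l₁ l₂ a b, hG.symm l₁ l₂ a b, smul_add]
  zero_mem' := by
    refine ⟨?_, ?_, ?_⟩ <;> intros <;> simp
  smul_mem' := by
    intro t F hF
    refine ⟨?_, ?_, ?_⟩
    · intro l₁ l₂ a b c h1 h2 h3
      simp only [Pi.smul_apply, hF.add l₁ l₂ a b c h1 h2 h3, smul_add]
    · intro l₁ l₂ d f a b h1 h2 h3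
      simp only [Pi.smul_apply, hF.smul l₁ l₂ d f a b h1 h2 h3, mul_smul_comm]
      rw [smul_comm]
    · intro l₁ l₂ a b
      simp only [Pi.smul_apply, hF.symm l₁ l₂ a b]
      rw [smul_comm]

variable {ℒ}

/-- The operator `a ↦ (-1)^{c ã} a` on functions on the base. -/
def twist (c : ZMod 2) : A →ₗ[ℝ] A :=
  ∑ i : ZMod 2, psgn (c * i) • GradedAlgebra.proj 𝒜 i

theorem twist_of_mem {c i : ZMod 2} {a : A} (ha : a ∈ 𝒜 i) :
    twist 𝒜 c a = psgn (c * i) • a := by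
  unfold twist
  rw [LinearMap.sum_apply, Finset.sum_eq_single i]
  · simp only [LinearMap.smul_apply, GradedAlgebra.proj_apply]
    rw [DirectSum.decompose_of_mem_same 𝒜 ha]
  · intro j _ hj
    simp only [LinearMap.smul_apply, GradedAlgebra.proj_apply]
    rw [DirectSum.decompose_of_mem_ne 𝒜 ha (Ne.symm hj), smul_zero]
  · simp

/-- The operator `F ↦ (-1)^{c F̃} F` on formal functions; note that `F l` has parity
`F̃ + shiftedPar l`. -/
def twistFun (c : ZMod 2) (F : List (HSec ℒ) → A) : List (HSec ℒ) → A :=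
  fun l => psgn (c * shiftedPar l) • twist 𝒜 c (F l)

/-- The product of formal functions, determined by `(FG)|_M = F|_M G|_M` and by the Leibniz rule
`ι(u)(FG) = (ι(u)F) G + (-1)^{(ũ+1)F̃} F (ι(u)G)`. -/
def mulFun : List (HSec ℒ) → (List (HSec ℒ) → A) → (List (HSec ℒ) → A) → A
  | [], F, G => F [] * G []
  | u :: l, F, G => mulFun l (fun m => F (u :: m)) G +
      mulFun l (twistFun 𝒜 (u.par + 1) F) (fun m => G (u :: m))

/-! Closure of formal functions under the operations used below. -/

@[simp] theorem shiftedPar_nil : shiftedPar ([] : List (HSec ℒ)) = 0 := rfl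

@[simp] theorem shiftedPar_cons (u : HSec ℒ) (l : List (HSec ℒ)) :
    shiftedPar (u :: l) = (u.par + 1) + shiftedPar l := by
  simp [shiftedPar]

@[simp] theorem shiftedPar_append (l₁ l₂ : List (HSec ℒ)) :
    shiftedPar (l₁ ++ l₂) = shiftedPar l₁ + shiftedPar l₂ := by
  simp [shiftedPar]

theorem twist_twist (c d : ZMod 2) (a : A) : twist 𝒜 c (twist 𝒜 d a) = twist 𝒜 (c + d) a := by
  induction a using DirectSum.Decomposition.inductionOn 𝒜 with
  | zero => simp
  | homogeneous m =>
    rename_i i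
    rw [twist_of_mem 𝒜 m.2, map_zsmul, twist_of_mem 𝒜 m.2, twist_of_mem 𝒜 m.2, smul_smul,
      ← psgn_add]
    congr 2; ring
  | add a b ha hb => simp only [map_add, ha, hb]

theorem twist_mul {c d : ZMod 2} {f : A} (hf : f ∈ 𝒜 d) (a : A) :
    twist 𝒜 c (f * a) = psgn (c * d) • (f * twist 𝒜 c a) := by
  induction a using DirectSum.Decomposition.inductionOn 𝒜 with
  | zero => simp
  | homogeneous m =>
    rename_i i
    rw [twist_of_mem 𝒜 m.2, twist_of_mem 𝒜 (SetLike.mul_mem_graded hf m.2), mul_smul_comm,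
      smul_smul, ← psgn_add]
    congr 2; ring
  | add a b ha hb => simp only [map_add, mul_add, smul_add, ha, hb]

theorem mul_eq_twist [IsSupercommutative 𝒜] {d : ZMod 2} {f : A} (hf : f ∈ 𝒜 d) (a : A) :
    a * f = f * twist 𝒜 d a := by
  induction a using DirectSum.Decomposition.inductionOn 𝒜 with
  | zero => simp
  | homogeneous m =>
    rename_i i
    rw [twist_of_mem 𝒜 m.2, mul_smul_comm, IsSupercommutative.comm i d _ _ m.2 hf, mul_comm i d]
  | add a b ha hb => simp only [map_add, mul_add, add_mul, ha, hb]

theorem twistFun_twistFun (c d : ZMod 2) (F : List (HSec ℒ) → A) :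
    twistFun 𝒜 c (twistFun 𝒜 d F) = twistFun 𝒜 (c + d) F := by
  funext l
  simp only [twistFun, map_zsmul, twist_twist, smul_smul, ← psgn_add]
  congr 2; ring

theorem twistFun_cons (c : ZMod 2) (F : List (HSec ℒ) → A) (u : HSec ℒ) :
    (fun m => twistFun 𝒜 c F (u :: m)) =
      psgn (c * (u.par + 1)) • twistFun 𝒜 c (fun m => F (u :: m)) := by
  funext l
  simp only [twistFun, shiftedPar_cons, Pi.smul_apply, smul_smul, ← psgn_add, mul_add]

theorem twistFun_add (c : ZMod 2) (F G : List (HSec ℒ) → A) :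
    twistFun 𝒜 c (F + G) = twistFun 𝒜 c F + twistFun 𝒜 c G := by
  funext l; simp [twistFun]

theorem twistFun_zsmul (c : ZMod 2) (z : ℤ) (F : List (HSec ℒ) → A) :
    twistFun 𝒜 c (z • F) = z • twistFun 𝒜 c F := by
  funext l
  simp only [twistFun, Pi.smul_apply, map_zsmul]
  rw [smul_comm]

theorem mulFun_add_left (l : List (HSec ℒ)) : ∀ F F' G : List (HSec ℒ) → A,
    mulFun 𝒜 l (F + F') G = mulFun 𝒜 l F G + mulFun 𝒜 l F' G := by
  induction l with
  | nil => intro F F' G; simp [mulFun, add_mul]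
  | cons u l ih =>
    intro F F' G
    have h : (fun m => (F + F') (u :: m)) = (fun m => F (u :: m)) + fun m => F' (u :: m) := rfl
    simp only [mulFun, h, ih, twistFun_add]
    abel

theorem mulFun_add_right (l : List (HSec ℒ)) : ∀ F G G' : List (HSec ℒ) → A,
    mulFun 𝒜 l F (G + G') = mulFun 𝒜 l F G + mulFun 𝒜 l F G' := by
  induction l with
  | nil => intro F G G'; simp [mulFun, mul_add]
  | cons u l ih =>
    intro F G G'
    have h : (fun m => (G + G') (u :: m)) = (fun m => G (u :: m)) + fun m => G' (u :: m) := rfl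
    simp only [mulFun, h, ih]
    abel

theorem mulFun_zsmul_left (z : ℤ) (l : List (HSec ℒ)) : ∀ F G : List (HSec ℒ) → A,
    mulFun 𝒜 l (z • F) G = z • mulFun 𝒜 l F G := by
  induction l with
  | nil => intro F G; simp only [mulFun, Pi.smul_apply, smul_mul_assoc]
  | cons u l ih =>
    intro F G
    have h : (fun m => (z • F) (u :: m)) = z • fun m => F (u :: m) := rfl
    simp only [mulFun, h, ih, twistFun_zsmul, smul_add]

theorem mulFun_zsmul_right (z : ℤ) (l : List (HSec ℒ)) : ∀ F G : List (HSec ℒ) → A,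
    mulFun 𝒜 l F (z • G) = z • mulFun 𝒜 l F G := by
  induction l with
  | nil => intro F G; simp only [mulFun, Pi.smul_apply, mul_smul_comm]
  | cons u l ih =>
    intro F G
    have h : (fun m => (z • G) (u :: m)) = z • fun m => G (u :: m) := rfl
    simp only [mulFun, h, ih, smul_add]

/-- The product of a function on the base of parity `d` and a formal function. -/
def baseMul (d : ZMod 2) (f : A) (F : List (HSec ℒ) → A) : List (HSec ℒ) → A :=
  fun l => psgn (d * shiftedPar l) • (f * F l)

theorem baseMul_cons (d : ZMod 2) (f : A) (F : List (HSec ℒ) → A) (u : HSec ℒ) :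
    (fun m => baseMul d f F (u :: m)) =
      psgn (d * (u.par + 1)) • baseMul d f (fun m => F (u :: m)) := by
  funext l
  simp only [baseMul, shiftedPar_cons, Pi.smul_apply, smul_smul, ← psgn_add, mul_add]

theorem twistFun_baseMul (c : ZMod 2) {d : ZMod 2} {f : A} (hf : f ∈ 𝒜 d)
    (F : List (HSec ℒ) → A) :
    twistFun 𝒜 c (baseMul d f F) = psgn (c * d) • baseMul d f (twistFun 𝒜 c F) := by
  funext l
  simp only [twistFun, baseMul, map_zsmul, twist_mul 𝒜 hf, Pi.smul_apply, mul_smul_comm, smul_smul,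
    ← psgn_add]
  congr 2; ring

theorem mulFun_baseMul_left {d : ZMod 2} {f : A} (hf : f ∈ 𝒜 d) (l : List (HSec ℒ)) :
    ∀ F G : List (HSec ℒ) → A,
    mulFun 𝒜 l (baseMul d f F) G = psgn (d * shiftedPar l) • (f * mulFun 𝒜 l F G) := by
  induction l with
  | nil => intro F G; simp [mulFun, baseMul, psgn_zero, mul_assoc]
  | cons u l ih =>
    intro F G
    simp only [mulFun, baseMul_cons, twistFun_baseMul 𝒜 _ hf, mulFun_zsmul_left, ih,
      shiftedPar_cons, smul_smul, ← psgn_add, mul_add, smul_add]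
    congr 3; ring

theorem mulFun_baseMul_right [IsSupercommutative 𝒜] {d : ZMod 2} {f : A} (hf : f ∈ 𝒜 d)
    (l : List (HSec ℒ)) : ∀ F G : List (HSec ℒ) → A,
    mulFun 𝒜 l F (baseMul d f G) =
      psgn (d * shiftedPar l) • (f * mulFun 𝒜 l (twistFun 𝒜 d F) G) := by
  induction l with
  | nil =>
    intro F G
    simp only [mulFun, baseMul, twistFun, shiftedPar_nil, mul_zero, psgn_zero, one_smul]
    rw [← mul_assoc, mul_eq_twist 𝒜 hf, mul_assoc]
  | cons u l ih =>
    intro F G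
    simp only [mulFun, baseMul_cons, twistFun_cons, mulFun_zsmul_left, mulFun_zsmul_right, ih,
      shiftedPar_cons, twistFun_twistFun, mul_add, smul_add, mul_smul_comm, smul_smul, ← psgn_add,
      add_comm d (u.par + 1)]
    generalize shiftedPar l = t
    generalize u.par = e
    congr 2
    clear hf ih
    revert d e t; decide

theorem IsFormalFun.cons {F : List (HSec ℒ) → A} (hF : IsFormalFun 𝒜 F) (u : HSec ℒ) :
    IsFormalFun 𝒜 (fun m => F (u :: m)) where
  add l₁ l₂ := hF.add (u :: l₁) l₂
  smul l₁ l₂ := hF.smul (u :: l₁) l₂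
  symm l₁ l₂ := hF.symm (u :: l₁) l₂

theorem IsFormalFun.twistFun {F : List (HSec ℒ) → A} (hF : IsFormalFun 𝒜 F) (c : ZMod 2) :
    IsFormalFun 𝒜 (twistFun 𝒜 c F) where
  add l₁ l₂ a b e h1 h2 h3 := by
    simp only [SuperGeom.twistFun, hF.add l₁ l₂ a b e h1 h2 h3, shiftedPar_append,
      shiftedPar_cons, h1, h2, map_add, smul_add]
  smul l₁ l₂ d f a b hf h1 h2 := by
    simp only [SuperGeom.twistFun, hF.smul l₁ l₂ d f a b hf h1 h2, shiftedPar_append,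
      shiftedPar_cons, h1, map_zsmul, twist_mul 𝒜 hf, mul_smul_comm, smul_smul, ← psgn_add]
    congr 1
    generalize shiftedPar l₁ = t
    generalize shiftedPar l₂ = t'
    generalize a.par = e
    clear hf h1
    revert c d e t t'; decide
  symm l₁ l₂ a b := by
    simp only [SuperGeom.twistFun, hF.symm l₁ l₂ a b, shiftedPar_append,
      shiftedPar_cons, map_zsmul, smul_smul, ← psgn_add]
    congr 2; ring

theorem IsFormalFun.mulFun [IsSupercommutative 𝒜] {F G : List (HSec ℒ) → A}
    (hF : IsFormalFun 𝒜 F) (hG : IsFormalFun 𝒜 G) :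
    IsFormalFun 𝒜 (fun l => mulFun 𝒜 l F G) where
  add l₁ l₂ a b c h1 h2 h3 := by
    induction l₁ generalizing F G with
    | nil =>
      have h : ∀ {H : List (HSec ℒ) → A}, IsFormalFun 𝒜 H →
          (fun m => H (c :: m)) = (fun m => H (a :: m)) + fun m => H (b :: m) :=
        fun hH => funext fun m => hH.add [] m a b c h1 h2 h3
      simp only [List.nil_append, SuperGeom.mulFun, h hF, h hG, h1, h2, mulFun_add_left,
        mulFun_add_right]
      abel
    | cons u l ih =>
      simp only [List.cons_append, SuperGeom.mulFun] at ih ⊢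
      rw [ih (hF.cons 𝒜 u) hG, ih (hF.twistFun 𝒜 _) (hG.cons 𝒜 u)]
      abel
  smul l₁ l₂ d f a b hf h1 h2 := by
    induction l₁ generalizing F G with
    | nil =>
      have h : ∀ {H : List (HSec ℒ) → A}, IsFormalFun 𝒜 H →
          (fun m => H (b :: m)) = psgn d • baseMul d f (fun m => H (a :: m)) := by
        intro H hH
        funext m
        have := hH.smul [] m d f a b hf h1 h2
        simp only [List.nil_append] at this
        rw [this]
        simp only [baseMul, Pi.smul_apply, smul_smul, ← psgn_add]
        congr 2; ring
      simp only [List.nil_append, SuperGeom.mulFun, h hF, h hG, h1, mulFun_zsmul_left,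
        mulFun_zsmul_right, mulFun_baseMul_left 𝒜 hf, mulFun_baseMul_right 𝒜 hf,
        twistFun_twistFun, mul_add, smul_add, smul_smul, ← psgn_add]
      have e : d + (d + a.par + 1) = a.par + 1 := by
        generalize a.par = x
        clear hf h1 h
        revert d x; decide
      rw [e]
      congr 3 <;> ring
    | cons u l ih =>
      simp only [List.cons_append, SuperGeom.mulFun] at ih ⊢
      rw [ih (hF.cons 𝒜 u) hG, ih (hF.twistFun 𝒜 _) (hG.cons 𝒜 u), mul_add f, smul_add]
  symm l₁ l₂ a b := by
    induction l₁ generalizing F G with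
    | nil =>
      have h : ∀ {H : List (HSec ℒ) → A}, IsFormalFun 𝒜 H →
          (fun m => H (a :: b :: m)) =
            psgn ((a.par + 1) * (b.par + 1)) • fun m => H (b :: a :: m) :=
        fun hH => funext fun m => hH.symm [] m a b
      simp only [List.nil_append, SuperGeom.mulFun, h hF, h hG, twistFun_cons, twistFun_twistFun,
        mulFun_zsmul_left, mulFun_zsmul_right, smul_add, smul_smul, ← psgn_add]
      have e : ∀ x y : ZMod 2, psgn (x * y + x * y) = 1 := by decide
      rw [add_comm (b.par + 1) (a.par + 1), mul_comm (b.par + 1) (a.par + 1), e, one_smul]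
      abel
    | cons u l ih =>
      simp only [List.cons_append, SuperGeom.mulFun] at ih ⊢
      rw [ih (hF.cons 𝒜 u) hG, ih (hF.twistFun 𝒜 _) (hG.cons 𝒜 u), smul_add]

namespace FormalFun

/-- The product of two formal functions. -/
def mul [IsSupercommutative 𝒜] (F G : FormalFun 𝒜 ℒ) : FormalFun 𝒜 ℒ :=
  ⟨fun l => mulFun 𝒜 l F.1 G.1, IsFormalFun.mulFun 𝒜 F.2 G.2⟩

variable {𝒜}

/-- A formal function is homogeneous of parity `d`. -/
def HasParity (d : ZMod 2) (F : FormalFun 𝒜 ℒ) : Prop :=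
  ∀ l, F.1 l ∈ 𝒜 (d + shiftedPar l)

/-- A function on the base, as a formal function on `ΠE` of weight zero. -/
def ofBase (f : A) : FormalFun 𝒜 ℒ :=
  ⟨fun l => if l = [] then f else 0, by
    refine ⟨?_, ?_, ?_⟩ <;> intros <;> simp⟩

/-- The component of weight `k` of a formal function. -/
def weightComp (k : ℤ) : FormalFun 𝒜 ℒ →ₗ[ℝ] FormalFun 𝒜 ℒ where
  toFun F := ⟨fun l => if (l.length : ℤ) = k then F.1 l else 0, by
    refine ⟨?_, ?_, ?_⟩
    · intro l₁ l₂ a b c h1 h2 h3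
      by_cases h : ((l₁.length + (l₂.length + 1) : ℕ) : ℤ) = k
      · simpa [h] using F.2.add l₁ l₂ a b c h1 h2 h3
      · simp only [List.length_append, List.length_cons, h, if_false, add_zero]
    · intro l₁ l₂ d f a b h1 h2 h3
      by_cases h : ((l₁.length + (l₂.length + 1) : ℕ) : ℤ) = k
      · simp only [List.length_append, List.length_cons, h, if_true]
        exact F.2.smul l₁ l₂ d f a b h1 h2 h3
      · simp only [List.length_append, List.length_cons, h, if_false, mul_zero, smul_zero]
    · intro l₁ l₂ a b
      by_cases h : ((l₁.length + (l₂.length + 1 + 1) : ℕ) : ℤ) = k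
      · simp only [List.length_append, List.length_cons, h, if_true]
        exact F.2.symm l₁ l₂ a b
      · simp only [List.length_append, List.length_cons, h, if_false, smul_zero]⟩
  map_add' F G := by
    ext l
    by_cases h : (l.length : ℤ) = k <;> simp [h]
  map_smul' t F := by
    ext l
    by_cases h : (l.length : ℤ) = k <;> simp [h]

end FormalFun

variable {𝒜}

/-- The vector field `ι(u)` on `ΠE` of a homogeneous section `u`, as an operator on formal
functions. -/
def contract (u : HSec ℒ) : FormalFun 𝒜 ℒ →ₗ[ℝ] FormalFun 𝒜 ℒ where
  toFun F := ⟨fun l => F.1 (u :: l), IsFormalFun.cons 𝒜 F.2 u⟩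
  map_add' _ _ := rfl
  map_smul' _ _ := rfl

/-- The vector field `ι(σ)` on `ΠE` of an arbitrary section `σ`, the sum of those of the even and
of the odd part of `σ`. -/
def iota [DirectSum.Decomposition ℒ] (σ : L) : FormalFun 𝒜 ℒ →ₗ[ℝ] FormalFun 𝒜 ℒ :=
  ∑ i : ZMod 2, contract ⟨i, DirectSum.decompose ℒ σ i, (DirectSum.decompose ℒ σ i).2⟩

/-- A formal vector field on `ΠE` of parity `ε`: a derivation of parity `ε` of the algebra of
formal functions, which is a formal sum of components of weights `-1, 0, 1, 2, …` (it maps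
functions that vanish to order `N` at the zero section to functions that vanish to order
`N - 1`). -/
structure IsFormalVectorField [IsSupercommutative 𝒜] (ε : ZMod 2)
    (X : FormalFun 𝒜 ℒ →ₗ[ℝ] FormalFun 𝒜 ℒ) : Prop where
  parity : ∀ (d : ZMod 2) (F : FormalFun 𝒜 ℒ), FormalFun.HasParity d F →
    FormalFun.HasParity (ε + d) (X F)
  leibniz : ∀ (d : ZMod 2) (F G : FormalFun 𝒜 ℒ), FormalFun.HasParity d F →
    X (FormalFun.mul 𝒜 F G) =
      FormalFun.mul 𝒜 (X F) G + psgn (ε * d) • FormalFun.mul 𝒜 F (X G)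
  formal : ∀ (N : ℕ) (F : FormalFun 𝒜 ℒ), (∀ l, l.length < N → F.1 l = 0) →
    ∀ l, l.length + 1 < N → (X F).1 l = 0

/-- The projection of a formal vector field to weight `m`: it sends a function of weight `k` to the
component of weight `k + m` of its image. -/
def weightPart (m : ℤ) (X : FormalFun 𝒜 ℒ →ₗ[ℝ] FormalFun 𝒜 ℒ) :
    FormalFun 𝒜 ℒ →ₗ[ℝ] FormalFun 𝒜 ℒ where
  toFun F := ⟨fun l => (X (FormalFun.weightComp ((l.length : ℤ) - m) F)).1 l, by
    refine ⟨?_, ?_, ?_⟩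
    · intro l₁ l₂ a b c h1 h2 h3
      simp only [List.length_append, List.length_cons]
      exact (X _).2.add l₁ l₂ a b c h1 h2 h3
    · intro l₁ l₂ d f a b h1 h2 h3
      simp only [List.length_append, List.length_cons]
      exact (X _).2.smul l₁ l₂ d f a b h1 h2 h3
    · intro l₁ l₂ a b
      simp only [List.length_append, List.length_cons]
      exact (X _).2.symm l₁ l₂ a b⟩
  map_add' F G := by ext l; simp
  map_smul' t F := by ext l; simp

/-- The supercommutator `[X, Y] = XY - (-1)^{X̃Ỹ} YX` of operators of parities `a` and `b`. -/
def superComm (a b : ZMod 2) (X Y : FormalFun 𝒜 ℒ →ₗ[ℝ] FormalFun 𝒜 ℒ) :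
    FormalFun 𝒜 ℒ →ₗ[ℝ] FormalFun 𝒜 ℒ :=
  X ∘ₗ Y - psgn (a * b) • (Y ∘ₗ X)

/-- The iterated commutator `[…[[X, ι(u₁)], ι(u₂)], …, ι(u_n)]` for `X` of parity `a`. -/
def nestedComm [DirectSum.Decomposition ℒ] :
    ZMod 2 → (FormalFun 𝒜 ℒ →ₗ[ℝ] FormalFun 𝒜 ℒ) → List (HSec ℒ) →
      (FormalFun 𝒜 ℒ →ₗ[ℝ] FormalFun 𝒜 ℒ)
  | _, X, [] => X
  | a, X, u :: l => nestedComm (a + (u.par + 1)) (superComm a (u.par + 1) X (iota u.val)) l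

/-! ### `L_∞`-algebroids -/

variable (A L)

/-- A sequence of `n`-ary brackets of sections and of `n`-ary anchors, `n = 0, 1, 2, …`. The anchor
of `n` sections is an operator on functions on the base. -/
@[ext]
structure HigherOps where
  bracket : ∀ n : ℕ, MultilinearMap ℝ (fun _ : Fin n => L) L
  anchor : ∀ n : ℕ, MultilinearMap ℝ (fun _ : Fin n => L) (A →ₗ[ℝ] A)

variable {A L}

/-- The exponent `rs + α + |σ|` of the sign `(-1)^{rs} (-1)^α sign σ` in the generalized Jacobi
identity. An `(r,s)`-shuffle `σ` is given by the set `I = {σ(1), …, σ(r)}`; it inverts the pairs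
`j < i` with `i ∈ I`, `j ∉ I`, and `(-1)^α` is the Koszul sign. -/
def shuffleExp {n : ℕ} (I : Finset (Fin n)) (u : Fin n → HSec ℒ) : ZMod 2 :=
  (I.card : ZMod 2) * (Iᶜ.card : ZMod 2) +
    ∑ i ∈ I, ∑ j ∈ Iᶜ, if j < i then 1 + (u i).par * (u j).par else 0

/-- The left-hand side of the generalized Jacobi identity,
`∑_{r+s=n} (-1)^{rs} ∑_{(r,s)-shuffles} (-1)^α sign σ
  [[u_{σ(1)}, …, u_{σ(r)}], u_{σ(r+1)}, …, u_{σ(r+s)}]`. -/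
def jacobiator (br : ∀ n : ℕ, MultilinearMap ℝ (fun _ : Fin n => L) L) {n : ℕ}
    (u : Fin n → HSec ℒ) : L :=
  ∑ I : Finset (Fin n), psgn (shuffleExp I u) •
    br (Iᶜ.card + 1) (Fin.cons (α := fun _ => L)
      (br I.card fun k => (u (I.orderEmbOfFin rfl k)).val)
      fun k => (u (Iᶜ.orderEmbOfFin rfl k)).val)

variable (𝒜 ℒ)

/-- The brackets make the space of sections an `L_∞`-algebra in the antisymmetric version: the
`n`-bracket has parity `n`, is graded antisymmetric, and the generalized Jacobi identities hold. -/
structure IsLInfAlgebra (br : ∀ n : ℕ, MultilinearMap ℝ (fun _ : Fin n => L) L) : Prop where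
  parity : ∀ (n : ℕ) (u : Fin n → HSec ℒ),
    br n (fun i => (u i).val) ∈ ℒ ((n : ZMod 2) + ∑ i, (u i).par)
  antisymm : ∀ (n : ℕ) (u : Fin n → HSec ℒ) (i j : Fin n), (i : ℕ) + 1 = j →
    br n (fun k => (u (Equiv.swap i j k)).val) =
      -(psgn ((u i).par * (u j).par) • br n fun k => (u k).val)
  jacobi : ∀ (n : ℕ) (u : Fin n → HSec ℒ), jacobiator br u = 0

/-- The brackets and anchors form an `L_∞`-algebroid structure. -/
structure IsLInfAlgebroid (ops : HigherOps A L) : Prop where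
  brackets : IsLInfAlgebra ℒ ops.bracket
  /-- `a_n(u₁, …, u_n)` is a vector field on the base; the `n`-anchor has parity `n - 1` -/
  anchor_parity : ∀ (n : ℕ) (u : Fin n → HSec ℒ) (d : ZMod 2) (f : A), f ∈ 𝒜 d →
    ops.anchor n (fun i => (u i).val) f ∈ 𝒜 ((n : ZMod 2) - 1 + ∑ i, (u i).par + d)
  anchor_derivation : ∀ (n : ℕ) (u : Fin n → HSec ℒ) (d : ZMod 2) (f g : A), f ∈ 𝒜 d →
    ops.anchor n (fun i => (u i).val) (f * g) = ops.anchor n (fun i => (u i).val) f * g +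
      psgn (((n : ZMod 2) - 1 + ∑ i, (u i).par) * d) •
        (f * ops.anchor n (fun i => (u i).val) g)
  /-- the anchors come from fibrewise multilinear maps: they are multilinear over functions -/
  anchor_smul : ∀ (n : ℕ) (u : Fin n → HSec ℒ) (k : Fin n) (d : ZMod 2) (f g : A), f ∈ 𝒜 d →
    ops.anchor n (Function.update (fun i => (u i).val) k (f • (u k).val)) g =
      psgn (d * ((n : ZMod 2) - 1 + ∑ i ∈ Finset.Iio k, (u i).par)) •
        (f * ops.anchor n (fun i => (u i).val) g)
  anchor_antisymm : ∀ (n : ℕ) (u : Fin n → HSec ℒ) (i j : Fin n), (i : ℕ) + 1 = j →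
    ops.anchor n (fun k => (u (Equiv.swap i j k)).val) =
      -(psgn ((u i).par * (u j).par) • ops.anchor n fun k => (u k).val)
  /-- `[u₁, …, u_n, f v] = a_n(u₁, …, u_n)(f) v + (-1)^{f̃(n+1+ũ₁+…+ũ_n)} f [u₁, …, u_n, v]` -/
  leibniz : ∀ (n : ℕ) (u : Fin n → HSec ℒ) (d : ZMod 2) (f : A) (v : L), f ∈ 𝒜 d →
    ops.bracket (n + 1) (Fin.snoc (α := fun _ => L) (fun i => (u i).val) (f • v)) =
      ops.anchor n (fun i => (u i).val) f • v +
        psgn (d * ((n : ZMod 2) + 1 + ∑ i, (u i).par)) •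
          f • ops.bracket (n + 1) (Fin.snoc (α := fun _ => L) (fun i => (u i).val) v)

variable {𝒜 ℒ}

/-- The exponent `∑ₖ ũₖ (n - k)`, `k = 1, …, n`. -/
def derivedExp {n : ℕ} (u : Fin n → HSec ℒ) : ZMod 2 :=
  ∑ k : Fin n, (u k).par * ((n - 1 - (k : ℕ) : ℕ) : ZMod 2)

/-- The operations are the higher derived brackets and anchors of the odd formal vector field `Q`:
`ι([u₁, …, u_n]) = (-1)^ε [… [Q, ι(u₁)], …, ι(u_n)]_{-1}` and
`a_n(u₁, …, u_n)(f) = (-1)^{ε+n+1} [… [Q, ι(u₁)], …, ι(u_n)]_0 (f)`, with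
`ε = ∑ₖ ũₖ (n - k)`. -/
structure IsDerivedFrom [DirectSum.Decomposition ℒ]
    (Q : FormalFun 𝒜 ℒ →ₗ[ℝ] FormalFun 𝒜 ℒ) (ops : HigherOps A L) : Prop where
  bracket : ∀ (n : ℕ) (u : Fin n → HSec ℒ),
    iota (𝒜 := 𝒜) (ops.bracket n fun i => (u i).val) =
      psgn (derivedExp u) • weightPart (-1) (nestedComm 1 Q (List.ofFn u))
  anchor : ∀ (n : ℕ) (u : Fin n → HSec ℒ) (f : A),
    FormalFun.ofBase (𝒜 := 𝒜) (ℒ := ℒ) (ops.anchor n (fun i => (u i).val) f) =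
      psgn (derivedExp u + (n : ZMod 2) + 1) •
        weightPart 0 (nestedComm 1 Q (List.ofFn u)) (FormalFun.ofBase f)

end Algebra

/-! ### Specialization to a super vector bundle -/

section Bundle

variable {p q r s : ℕ} {M : Supermanifold.{u, v} p q}

/-- Formal functions on the supermanifold `ΠE`. -/
abbrev SuperVectorBundle.PiFun (E : SuperVectorBundle.{u, v, w} M r s) :=
  FormalFun (M.par ⊤) (E.par ⊤)

/-- Sequences of brackets of global sections of `E` and of anchors. -/
abbrev SuperVectorBundle.Ops (E : SuperVectorBundle.{u, v, w} M r s) :=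
  HigherOps (M.O ⊤) (E.sec ⊤)

end Bundle

end SuperGeom

open SuperGeom

namespace SuperGeom

universe u v w

/-! ### Signs, products and orders of vanishing of formal functions -/

section FormalFunctions

variable {A L : Type*} [Ring A] [Algebra ℝ A] {𝒜 : ZMod 2 → Submodule ℝ A} [GradedAlgebra 𝒜]
  [AddCommGroup L] [Module A L] [Module ℝ L] {ℒ : ZMod 2 → Submodule ℝ L}

/-! A derivation of the formal functions on ΠE is determined by its values on functions on M and on
fibre coordinates, and iterated commutators with the fields ι(u) read off the Taylor coefficients of
these values: on functions on M they give the anchors, on coordinates the brackets. Every odd Q thus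
yields operations, and all axioms except Jacobi hold without any condition on Q: the fields ι(u)
supercommute (`nestedComm_swap`), ι(fu) = ± f ι(u) (`iota_fsmul`), and supercommutators of
derivations are derivations.

Write Q_I for the iterated commutator of Q with the ι(u_i), i ∈ I, and s_I for the section with
ι(s_I) equal to its component of weight -1. Such a section exists because the values of a derivation
Y on coordinates, restricted to M, glue to a section s (`exists_eps_eq`), and Y - ι(s) then
preserves the order of vanishing at the zero section. This follows from Hadamard's lemma
(`hadamard`), a consequence of Euler's identity. Since ι is injective and multilinear maps are
determined on homogeneous sections, the operations are unique.

For Jacobi, the iterated commutators of Q² expand into ∑ ± Q_I Q_J with J the complement of I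
(`nestedComm_comp`). On a coordinate ξ, restricted to M, one has Q_I Q_J ξ = ι(s_I) Q_J ξ + Q_I
ι(s_J) ξ: the field Q_I - ι(s_I) sends functions vanishing on M to such functions, and ι(s_J) ξ is
the restriction of Q_J ξ to M. Contributions of complementary subsets combine to [Q_J, ι(s_I)] ξ, a
bracket with a bracket inserted. Up to a common sign, the Jacobiators of Q are therefore the derived
brackets of Q² (`derivedSec_comp_self`, `jacobiator_eq`), so Q² = 0 implies Jacobi. Conversely, the
vanishing of all derived brackets of Q² forces Q² = 0 (`eq_zero_of_derivedSec`): by the Leibniz rule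
its anchors multiply every section to zero, hence vanish since the rank is positive; so Q² kills
functions on M, then the coordinates, then everything.

Geometry enters only through `LocalBases`: bump functions turn local frames into global sections and
global linear forms. -/

theorem psgn_one_add (a : ZMod 2) : psgn (1 + a) = -psgn a := by
  revert a; decide

theorem psgn_smul_psgn_smul {V : Type*} [AddCommGroup V] (a : ZMod 2) (v : V) :
    psgn a • psgn a • v = v := by
  rw [smul_smul, psgn_mul_self, one_smul]

theorem psgn_smul_eq_iff {V : Type*} [AddCommGroup V] {a : ZMod 2} {v w : V} :
    psgn a • v = w ↔ v = psgn a • w := by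
  constructor
  · rintro rfl; rw [psgn_smul_psgn_smul]
  · rintro rfl; rw [psgn_smul_psgn_smul]

theorem psgn_smul_eq_zero {V : Type*} [AddCommGroup V] {a : ZMod 2} {v : V} :
    psgn a • v = 0 ↔ v = 0 := by
  rw [psgn_smul_eq_iff, smul_zero]

theorem eq_zero_of_mem_of_mem {V : Type*} [AddCommGroup V] [Module ℝ V]
    (𝒱 : ZMod 2 → Submodule ℝ V) [DirectSum.Decomposition 𝒱] {i j : ZMod 2} (hij : i ≠ j) {v : V}
    (hi : v ∈ 𝒱 i) (hj : v ∈ 𝒱 j) : v = 0 := by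
  have h := DirectSum.decompose_of_mem_ne 𝒱 hi hij
  rwa [DirectSum.decompose_of_mem_same 𝒱 hj] at h

/-! ### The algebra of formal functions -/

@[ext]
theorem HSec.ext' {u v : HSec ℒ} (hp : u.par = v.par) (hv : u.val = v.val) : u = v := by
  cases u; cases v; cases hp; cases hv; rfl

/-- A homogeneous section multiplied by a homogeneous function. -/
def HSec.fsmul (h𝒜 : ∀ {i j : ZMod 2} {f : A} {σ : L}, f ∈ 𝒜 i → σ ∈ ℒ j → f • σ ∈ ℒ (i + j))
    {d : ZMod 2} {f : A} (hf : f ∈ 𝒜 d) (u : HSec ℒ) : HSec ℒ :=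
  ⟨d + u.par, f • u.val, h𝒜 hf u.mem⟩

namespace FormalFun

theorem ext_apply {F G : FormalFun 𝒜 ℒ} (h : ∀ l, F.1 l = G.1 l) : F = G :=
  Subtype.ext (funext h)

@[simp] theorem val_add (F G : FormalFun 𝒜 ℒ) (l : List (HSec ℒ)) :
    (F + G).1 l = F.1 l + G.1 l := rfl

@[simp] theorem val_sub (F G : FormalFun 𝒜 ℒ) (l : List (HSec ℒ)) :
    (F - G).1 l = F.1 l - G.1 l := rfl

@[simp] theorem val_neg (F : FormalFun 𝒜 ℒ) (l : List (HSec ℒ)) :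
    (-F).1 l = -F.1 l := rfl

@[simp] theorem val_zero (l : List (HSec ℒ)) : (0 : FormalFun 𝒜 ℒ).1 l = 0 := rfl

@[simp] theorem val_zsmul (z : ℤ) (F : FormalFun 𝒜 ℒ) (l : List (HSec ℒ)) :
    (z • F).1 l = z • F.1 l := rfl

@[simp] theorem val_smul (t : ℝ) (F : FormalFun 𝒜 ℒ) (l : List (HSec ℒ)) :
    (t • F).1 l = t • F.1 l := rfl

/-- The Taylor coefficient of a formal function on a list of sections. -/
def coeff (l : List (HSec ℒ)) : FormalFun 𝒜 ℒ →ₗ[ℝ] A where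
  toFun F := F.1 l
  map_add' _ _ := rfl
  map_smul' _ _ := rfl

theorem val_sum {ι : Type*} (s : Finset ι) (F : ι → FormalFun 𝒜 ℒ) (l : List (HSec ℒ)) :
    (∑ i ∈ s, F i).1 l = ∑ i ∈ s, (F i).1 l :=
  map_sum (coeff l) F s

@[simp] theorem ofBase_nil (f : A) : (ofBase f : FormalFun 𝒜 ℒ).1 [] = f := rfl

@[simp] theorem ofBase_cons (f : A) (u : HSec ℒ) (l : List (HSec ℒ)) :
    (ofBase f : FormalFun 𝒜 ℒ).1 (u :: l) = 0 := rfl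

theorem ofBase_add (f g : A) :
    (ofBase (f + g) : FormalFun 𝒜 ℒ) = ofBase f + ofBase g := by
  refine ext_apply fun l => ?_
  cases l <;> simp

theorem ofBase_smul (t : ℝ) (f : A) :
    (ofBase (t • f) : FormalFun 𝒜 ℒ) = t • ofBase f := by
  refine ext_apply fun l => ?_
  cases l <;> simp

theorem ofBase_zsmul (t : ℤ) (f : A) :
    (ofBase (t • f) : FormalFun 𝒜 ℒ) = t • ofBase f := by
  refine ext_apply fun l => ?_
  cases l <;> simp

theorem ofBase_zero : (ofBase (0 : A) : FormalFun 𝒜 ℒ) = 0 := by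
  refine ext_apply fun l => ?_
  cases l <;> simp

theorem ofBase_injective : Function.Injective (ofBase : A → FormalFun 𝒜 ℒ) := by
  intro f g h
  have := congrArg (fun F : FormalFun 𝒜 ℒ => F.1 []) h
  simpa using this

theorem hasParity_ofBase {d : ZMod 2} {f : A} (hf : f ∈ 𝒜 d) :
    HasParity d (ofBase f : FormalFun 𝒜 ℒ) := by
  intro l
  cases l with
  | nil => simpa using hf
  | cons u l => simp

theorem HasParity.twistFun {d : ZMod 2} {F : FormalFun 𝒜 ℒ} (hF : HasParity d F) (c : ZMod 2) :
    twistFun 𝒜 c F.1 = psgn (c * d) • F.1 := by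
  funext l
  simp only [SuperGeom.twistFun, twist_of_mem 𝒜 (hF l), smul_smul, ← psgn_add, Pi.smul_apply]
  congr 2
  generalize shiftedPar l = t
  clear hF
  revert c d t; decide

theorem HasParity.add {d : ZMod 2} {F G : FormalFun 𝒜 ℒ} (hF : HasParity d F)
    (hG : HasParity d G) : HasParity d (F + G) :=
  fun l => add_mem (hF l) (hG l)

theorem HasParity.zsmul {d : ZMod 2} {F : FormalFun 𝒜 ℒ} (hF : HasParity d F) (z : ℤ) :
    HasParity d (z • F) :=
  fun l => zsmul_mem (hF l) z

theorem HasParity.sub {d : ZMod 2} {F G : FormalFun 𝒜 ℒ} (hF : HasParity d F)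
    (hG : HasParity d G) : HasParity d (F - G) :=
  fun l => sub_mem (hF l) (hG l)

/-- `F` vanishes to order `N` at the zero section. -/
def VanishesTo (N : ℕ) (F : FormalFun 𝒜 ℒ) : Prop := ∀ l, l.length < N → F.1 l = 0

theorem VanishesTo.add {N : ℕ} {F G : FormalFun 𝒜 ℒ} (hF : VanishesTo N F)
    (hG : VanishesTo N G) : VanishesTo N (F + G) :=
  fun l hl => by simp [hF l hl, hG l hl]

theorem VanishesTo.sub {N : ℕ} {F G : FormalFun 𝒜 ℒ} (hF : VanishesTo N F)
    (hG : VanishesTo N G) : VanishesTo N (F - G) :=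
  fun l hl => by simp [hF l hl, hG l hl]

theorem VanishesTo.zsmul {N : ℕ} {F : FormalFun 𝒜 ℒ} (hF : VanishesTo N F) (z : ℤ) :
    VanishesTo N (z • F) :=
  fun l hl => by simp [hF l hl]

theorem VanishesTo.sum {ι : Type*} {s : Finset ι} {N : ℕ} {F : ι → FormalFun 𝒜 ℒ}
    (hF : ∀ i ∈ s, VanishesTo N (F i)) : VanishesTo N (∑ i ∈ s, F i) := by
  intro l hl
  rw [val_sum]
  exact Finset.sum_eq_zero fun i hi => hF i hi l hl

theorem vanishesTo_one_iff {F : FormalFun 𝒜 ℒ} : VanishesTo 1 F ↔ F.1 [] = 0 := by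
  refine ⟨fun h => h [] (by simp), fun h l hl => ?_⟩
  have : l = [] := List.length_eq_zero_iff.mp (by omega)
  rw [this, h]

theorem twistFun_eq_zero {c : ZMod 2} {F : List (HSec ℒ) → A} {l : List (HSec ℒ)}
    (h : F l = 0) : twistFun 𝒜 c F l = 0 := by
  simp [twistFun, h]

theorem mulFun_eq_zero (l : List (HSec ℒ)) : ∀ (m n : ℕ) (F G : List (HSec ℒ) → A),
    (∀ k, k.length < m → F k = 0) → (∀ k, k.length < n → G k = 0) → l.length < m + n →
    mulFun 𝒜 l F G = 0 := by
  induction l with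
  | nil =>
    intro m n F G hF hG h
    rcases Nat.eq_zero_or_pos m with rfl | hm
    · rw [mulFun, hG [] (by simpa using h), mul_zero]
    · rw [mulFun, hF [] (by simpa using hm), zero_mul]
  | cons u l ih =>
    intro m n F G hF hG h
    simp only [List.length_cons] at h
    -- The argument `u` differentiates one factor and lowers its order by one. Truncated subtraction
    -- is harmless: vanishing to order 0 is an empty condition, and the bound on the length of `l`
    -- still holds.
    rw [mulFun, ih (m - 1) n _ _ (fun k hk => hF _ (by simp; omega)) hG (by omega),
      ih m (n - 1) _ _ (fun k hk => twistFun_eq_zero (hF k hk))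
        (fun k hk => hG _ (by simp; omega)) (by omega), add_zero]

theorem mulFun_zero_left (l : List (HSec ℒ)) (G : List (HSec ℒ) → A) : mulFun 𝒜 l 0 G = 0 := by
  have := mulFun_zsmul_left 𝒜 0 l 0 G
  simpa using this

variable [IsSupercommutative 𝒜]

theorem mul_apply (F G : FormalFun 𝒜 ℒ) (l : List (HSec ℒ)) :
    (mul 𝒜 F G).1 l = mulFun 𝒜 l F.1 G.1 := rfl

@[simp] theorem mul_nil (F G : FormalFun 𝒜 ℒ) : (mul 𝒜 F G).1 [] = F.1 [] * G.1 [] := rfl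

theorem VanishesTo.mul {m n : ℕ} {F G : FormalFun 𝒜 ℒ} (hF : VanishesTo m F)
    (hG : VanishesTo n G) : VanishesTo (m + n) (FormalFun.mul 𝒜 F G) :=
  fun l hl => mulFun_eq_zero l m n F.1 G.1 hF hG hl

theorem vanishesTo_zero (F : FormalFun 𝒜 ℒ) : VanishesTo 0 F := fun l hl => by simp at hl

theorem mul_add' (F G H : FormalFun 𝒜 ℒ) : mul 𝒜 F (G + H) = mul 𝒜 F G + mul 𝒜 F H :=
  ext_apply fun l => mulFun_add_right 𝒜 l F.1 G.1 H.1

theorem add_mul' (F G H : FormalFun 𝒜 ℒ) : mul 𝒜 (F + G) H = mul 𝒜 F H + mul 𝒜 G H :=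
  ext_apply fun l => mulFun_add_left 𝒜 l F.1 G.1 H.1

theorem mul_zsmul_right (z : ℤ) (F G : FormalFun 𝒜 ℒ) : mul 𝒜 F (z • G) = z • mul 𝒜 F G :=
  ext_apply fun l => mulFun_zsmul_right 𝒜 z l F.1 G.1

theorem mul_zsmul_left (z : ℤ) (F G : FormalFun 𝒜 ℒ) : mul 𝒜 (z • F) G = z • mul 𝒜 F G :=
  ext_apply fun l => mulFun_zsmul_left 𝒜 z l F.1 G.1

theorem mul_neg' (F G : FormalFun 𝒜 ℒ) : mul 𝒜 F (-G) = -mul 𝒜 F G := by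
  simpa using mul_zsmul_right (-1) F G

theorem neg_mul' (F G : FormalFun 𝒜 ℒ) : mul 𝒜 (-F) G = -mul 𝒜 F G := by
  simpa using mul_zsmul_left (-1) F G

theorem mul_sub' (F G H : FormalFun 𝒜 ℒ) : mul 𝒜 F (G - H) = mul 𝒜 F G - mul 𝒜 F H := by
  rw [sub_eq_add_neg, mul_add', mul_neg', ← sub_eq_add_neg]

theorem sub_mul' (F G H : FormalFun 𝒜 ℒ) : mul 𝒜 (F - G) H = mul 𝒜 F H - mul 𝒜 G H := by
  rw [sub_eq_add_neg, add_mul', neg_mul', ← sub_eq_add_neg]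

theorem zero_mul' (F : FormalFun 𝒜 ℒ) : mul 𝒜 0 F = 0 :=
  ext_apply fun l => mulFun_zero_left l F.1

theorem mulFun_one_left (l : List (HSec ℒ)) : ∀ G : List (HSec ℒ) → A,
    mulFun 𝒜 l (ofBase (1 : A) : FormalFun 𝒜 ℒ).1 G = G l := by
  induction l with
  | nil => intro G; simp [mulFun]
  | cons u l ih =>
    intro G
    have h0 : (fun m => (ofBase (1 : A) : FormalFun 𝒜 ℒ).1 (u :: m)) = 0 := rfl
    have h1 : HasParity 0 (ofBase (1 : A) : FormalFun 𝒜 ℒ) :=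
      hasParity_ofBase SetLike.GradedOne.one_mem
    rw [mulFun, h0, mulFun_zero_left, h1.twistFun, mul_zero, psgn_zero, one_smul, ih, zero_add]

theorem ofBase_mul_apply {d : ZMod 2} {f : A} (hf : f ∈ 𝒜 d) (G : FormalFun 𝒜 ℒ)
    (l : List (HSec ℒ)) :
    (mul 𝒜 (ofBase f) G).1 l = psgn (d * shiftedPar l) • (f * G.1 l) := by
  -- Writing f as f · 1 reduces the claim to linearity of the product over the base and to the unit
  -- law.
  have h : (ofBase f : FormalFun 𝒜 ℒ).1 = baseMul d f (ofBase (1 : A) : FormalFun 𝒜 ℒ).1 := by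
    funext l
    cases l <;> simp [baseMul, psgn_zero]
  rw [mul_apply, h, mulFun_baseMul_left 𝒜 hf, mulFun_one_left]

theorem ofBase_even_mul_apply {f : A} (hf : f ∈ 𝒜 0) (G : FormalFun 𝒜 ℒ)
    (l : List (HSec ℒ)) : (mul 𝒜 (ofBase f) G).1 l = f * G.1 l := by
  rw [ofBase_mul_apply hf, zero_mul, psgn_zero, one_smul]

theorem ofBase_mul (f g : A) :
    mul 𝒜 (ofBase f) (ofBase g : FormalFun 𝒜 ℒ) = ofBase (f * g) := by
  induction f using DirectSum.Decomposition.inductionOn 𝒜 with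
  | zero => rw [zero_mul, ofBase_zero, zero_mul']
  | homogeneous m =>
    refine ext_apply fun l => ?_
    rw [ofBase_mul_apply m.2]
    cases l <;> simp [psgn_zero]
  | add a b ha hb => rw [add_mul, ofBase_add, ofBase_add, add_mul', ha, hb]

/-- Rescaling of the component of weight `k` by `1 / k`. -/
noncomputable def divWeight (F : FormalFun 𝒜 ℒ) : FormalFun 𝒜 ℒ :=
  ⟨fun l => ((l.length : ℝ)⁻¹) • F.1 l, by
    refine ⟨?_, ?_, ?_⟩
    · intro l₁ l₂ a b c h1 h2 h3
      simp only [List.length_append, List.length_cons, F.2.add l₁ l₂ a b c h1 h2 h3, smul_add]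
    · intro l₁ l₂ d f a b h1 h2 h3
      simp only [List.length_append, List.length_cons, F.2.smul l₁ l₂ d f a b h1 h2 h3,
        mul_smul_comm]
      rw [smul_comm]
    · intro l₁ l₂ a b
      simp only [List.length_append, List.length_cons, F.2.symm l₁ l₂ a b]
      rw [smul_comm]⟩

theorem divWeight_apply (F : FormalFun 𝒜 ℒ) (l : List (HSec ℒ)) :
    (divWeight F).1 l = ((l.length : ℝ)⁻¹) • F.1 l := rfl

/-- The formal function of weight one of a linear form on sections. -/
def linear (φ : L →ₗ[A] A) : FormalFun 𝒜 ℒ :=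
  ⟨fun l => match l with
    -- The sign is the factor (-1)^ũ in the definition of ι(u).
    | [u] => psgn u.par • φ u.val
    | _ => 0, by
    refine ⟨?_, ?_, ?_⟩
    · intro l₁ l₂ a b c h1 h2 h3
      rcases l₁ with _ | ⟨u, _ | ⟨v, l₁⟩⟩ <;> rcases l₂ with _ | ⟨w, l₂⟩ <;> simp [h1, h2, h3]
    · intro l₁ l₂ d f a b h1 h2 h3
      rcases l₁ with _ | ⟨u, _ | ⟨v, l₁⟩⟩ <;> rcases l₂ with _ | ⟨w, l₂⟩ <;>
        simp [-zsmul_eq_mul, h2, h3, psgn_add, mul_smul]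
    · intro l₁ l₂ a b
      rcases l₁ with _ | ⟨u, _ | ⟨v, l₁⟩⟩ <;> rcases l₂ with _ | ⟨w, l₂⟩ <;> simp⟩

@[simp] theorem linear_nil (φ : L →ₗ[A] A) : (linear φ : FormalFun 𝒜 ℒ).1 [] = 0 := rfl

@[simp] theorem linear_singleton (φ : L →ₗ[A] A) (u : HSec ℒ) :
    (linear φ : FormalFun 𝒜 ℒ).1 [u] = psgn u.par • φ u.val := rfl

@[simp] theorem linear_cons_cons (φ : L →ₗ[A] A) (u v : HSec ℒ) (l : List (HSec ℒ)) :
    (linear φ : FormalFun 𝒜 ℒ).1 (u :: v :: l) = 0 := rfl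

theorem hasParity_linear {φ : L →ₗ[A] A} {e : ZMod 2}
    (hφ : ∀ u : HSec ℒ, φ u.val ∈ 𝒜 (u.par + e)) :
    HasParity (e + 1) (linear φ : FormalFun 𝒜 ℒ) := by
  intro l
  rcases l with _ | ⟨u, _ | ⟨v, l⟩⟩
  · simp
  · have h : e + 1 + shiftedPar [u] = u.par + e := by
      simp only [shiftedPar_cons, shiftedPar_nil]
      generalize u.par = x
      clear hφ
      revert e x; decide
    rw [linear_singleton, h]
    exact zsmul_mem (hφ u) _
  · simp

end FormalFun

end FormalFunctions

section Derivations

variable {A L : Type*} [Ring A] [Algebra ℝ A] {𝒜 : ZMod 2 → Submodule ℝ A} [GradedAlgebra 𝒜]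
  [AddCommGroup L] [Module A L] [Module ℝ L] {ℒ : ZMod 2 → Submodule ℝ L}

open FormalFun

/-! ### Superderivations of the algebra of formal functions -/

/-- A superderivation of parity `ε` of the algebra of formal functions. -/
structure IsSuperDer [IsSupercommutative 𝒜] (ε : ZMod 2)
    (X : FormalFun 𝒜 ℒ →ₗ[ℝ] FormalFun 𝒜 ℒ) : Prop where
  parity : ∀ (d : ZMod 2) (F : FormalFun 𝒜 ℒ), HasParity d F → HasParity (ε + d) (X F)
  leibniz : ∀ (d : ZMod 2) (F G : FormalFun 𝒜 ℒ), HasParity d F →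
    X (mul 𝒜 F G) = mul 𝒜 (X F) G + psgn (ε * d) • mul 𝒜 F (X G)

theorem IsFormalVectorField.isSuperDer [IsSupercommutative 𝒜] {ε : ZMod 2}
    {X : FormalFun 𝒜 ℒ →ₗ[ℝ] FormalFun 𝒜 ℒ} (hX : IsFormalVectorField ε X) : IsSuperDer ε X :=
  ⟨hX.parity, hX.leibniz⟩

theorem superComm_apply (a b : ZMod 2) (X Y : FormalFun 𝒜 ℒ →ₗ[ℝ] FormalFun 𝒜 ℒ)
    (F : FormalFun 𝒜 ℒ) : superComm a b X Y F = X (Y F) - psgn (a * b) • Y (X F) := rfl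

section
variable [IsSupercommutative 𝒜]

theorem IsSuperDer.add {a : ZMod 2} {X Y : FormalFun 𝒜 ℒ →ₗ[ℝ] FormalFun 𝒜 ℒ}
    (hX : IsSuperDer a X) (hY : IsSuperDer a Y) : IsSuperDer a (X + Y) where
  parity d F hF := (hX.parity d F hF).add (hY.parity d F hF)
  leibniz d F G hF := by
    simp only [LinearMap.add_apply, hX.leibniz d F G hF, hY.leibniz d F G hF, add_mul', mul_add',
      smul_add]
    abel

theorem IsSuperDer.zsmul {a : ZMod 2} {X : FormalFun 𝒜 ℒ →ₗ[ℝ] FormalFun 𝒜 ℒ}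
    (hX : IsSuperDer a X) (z : ℤ) : IsSuperDer a (z • X) where
  parity d F hF := (hX.parity d F hF).zsmul z
  leibniz d F G hF := by
    simp only [LinearMap.smul_apply, hX.leibniz d F G hF, mul_zsmul_left, mul_zsmul_right, smul_add]
    rw [smul_comm]

theorem IsSuperDer.sub {a : ZMod 2} {X Y : FormalFun 𝒜 ℒ →ₗ[ℝ] FormalFun 𝒜 ℒ}
    (hX : IsSuperDer a X) (hY : IsSuperDer a Y) : IsSuperDer a (X - Y) := by
  have e : X - Y = X + (-1 : ℤ) • Y := by module
  rw [e]
  exact hX.add (hY.zsmul (-1))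

theorem IsSuperDer.superComm {a b : ZMod 2} {X Y : FormalFun 𝒜 ℒ →ₗ[ℝ] FormalFun 𝒜 ℒ}
    (hX : IsSuperDer a X) (hY : IsSuperDer b Y) : IsSuperDer (a + b) (superComm a b X Y) where
  parity d F hF := by
    have h1 := hX.parity _ _ (hY.parity d F hF)
    have h2 := (hY.parity _ _ (hX.parity d F hF)).zsmul (psgn (a * b))
    rw [← add_assoc] at h1 h2
    rw [add_comm b a] at h2
    exact h1.sub h2
  leibniz d F G hF := by
    simp only [superComm_apply, hX.leibniz d F G hF, hY.leibniz d F G hF, map_add, map_zsmul,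
      hX.leibniz _ _ G (hY.parity d F hF), hY.leibniz _ _ G (hX.parity d F hF),
      hX.leibniz d F _ hF, hY.leibniz d F _ hF, sub_mul', mul_sub', mul_zsmul_left, mul_zsmul_right,
      smul_add, smul_sub]
    clear hX hY hF
    -- Both sides are combinations of the same products with coefficients ±1; equality of the signs
    -- is a finite check on parities.
    match_scalars <;> (revert a b d; decide)

/-- The Leibniz rule is the recursive clause of `mulFun`, where the twist of a homogeneous factor is
a mere sign. -/
theorem isSuperDer_contract (u : HSec ℒ) :
    IsSuperDer (u.par + 1) (contract (𝒜 := 𝒜) u) where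
  parity d F hF l := by
    have h := hF (u :: l)
    have e : d + shiftedPar (u :: l) = u.par + 1 + d + shiftedPar l := by
      rw [shiftedPar_cons]; ring
    rwa [e] at h
  leibniz d F G hF := by
    refine ext_apply fun l => ?_
    change mulFun 𝒜 (u :: l) F.1 G.1 = _
    rw [mulFun, hF.twistFun, mulFun_zsmul_left]
    rfl

end

@[simp] theorem contract_apply (u : HSec ℒ) (F : FormalFun 𝒜 ℒ) (l : List (HSec ℒ)) :
    (contract u F).1 l = F.1 (u :: l) := rfl

theorem contract_ofBase (u : HSec ℒ) (f : A) : contract u (ofBase f : FormalFun 𝒜 ℒ) = 0 :=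
  ext_apply fun _ => rfl

theorem contract_add {a b c : HSec ℒ} (h1 : a.par = c.par) (h2 : b.par = c.par)
    (h3 : c.val = a.val + b.val) :
    contract (𝒜 := 𝒜) c = contract a + contract b :=
  LinearMap.ext fun F => ext_apply fun l => F.2.add [] l a b c h1 h2 h3

theorem contract_zero {a : HSec ℒ} (h : a.val = 0) : contract (𝒜 := 𝒜) a = 0 := by
  have := contract_add (𝒜 := 𝒜) (a := a) (b := a) (c := a) rfl rfl (by simp [h])
  refine LinearMap.ext fun F => ?_
  exact left_eq_add.mp (LinearMap.congr_fun this F)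

theorem contract_comm (u v : HSec ℒ) :
    contract (𝒜 := 𝒜) u ∘ₗ contract v =
      psgn ((u.par + 1) * (v.par + 1)) • (contract v ∘ₗ contract u) := by
  refine LinearMap.ext fun F => ext_apply fun l => ?_
  have := F.2.symm [] l v u
  rw [mul_comm] at this
  exact this

variable [DirectSum.Decomposition ℒ]

/-- The homogeneous component of a section. -/
def HSec.proj (ℒ : ZMod 2 → Submodule ℝ L) [DirectSum.Decomposition ℒ] (i : ZMod 2) (σ : L) :
    HSec ℒ :=
  ⟨i, DirectSum.decompose ℒ σ i, (DirectSum.decompose ℒ σ i).2⟩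

theorem HSec.proj_par_val (u : HSec ℒ) : HSec.proj ℒ u.par u.val = u :=
  HSec.ext' rfl (DirectSum.decompose_of_mem_same ℒ u.mem)

theorem HSec.proj_val_of_ne {u : HSec ℒ} {i : ZMod 2} (h : i ≠ u.par) :
    (HSec.proj ℒ i u.val).val = 0 :=
  DirectSum.decompose_of_mem_ne ℒ u.mem h.symm

theorem HSec.sum_proj (σ : L) : ∑ i, (HSec.proj ℒ i σ).val = σ := by
  classical
  conv_rhs => rw [← DirectSum.sum_support_decompose ℒ σ]
  refine (Finset.sum_subset (Finset.subset_univ _) fun i _ hi => ?_).symm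
  simpa [DFinsupp.notMem_support_iff, HSec.proj] using hi

theorem iota_eq_sum (σ : L) : iota (𝒜 := 𝒜) (ℒ := ℒ) σ = ∑ i, contract (HSec.proj ℒ i σ) := rfl

theorem iota_val (u : HSec ℒ) : iota (𝒜 := 𝒜) (ℒ := ℒ) u.val = contract u := by
  rw [iota_eq_sum, Finset.sum_eq_single u.par, HSec.proj_par_val]
  · intro i _ hi
    exact contract_zero (HSec.proj_val_of_ne hi)
  · simp

theorem iota_add (σ τ : L) :
    iota (𝒜 := 𝒜) (ℒ := ℒ) (σ + τ) = iota σ + iota τ := by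
  simp only [iota_eq_sum, ← Finset.sum_add_distrib]
  refine Finset.sum_congr rfl fun i _ => contract_add rfl rfl ?_
  simp [HSec.proj]

/-- The coefficients of `ι(σ) F`, as additive functions of `σ`. -/
def iotaCoeff (F : FormalFun 𝒜 ℒ) (l : List (HSec ℒ)) : L →+ A :=
  AddMonoidHom.mk' (fun σ => (iota σ F).1 l) fun σ τ => by
    rw [iota_add, LinearMap.add_apply, val_add]

theorem iota_zsmul (z : ℤ) (σ : L) :
    iota (𝒜 := 𝒜) (ℒ := ℒ) (z • σ) = z • iota σ :=
  LinearMap.ext fun F => ext_apply fun l => map_zsmul (iotaCoeff F l) z σ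

theorem iota_zero : iota (𝒜 := 𝒜) (ℒ := ℒ) (0 : L) = 0 :=
  LinearMap.ext fun F => ext_apply fun l => map_zero (iotaCoeff F l)

theorem iota_ofBase (σ : L) (f : A) : iota σ (ofBase f : FormalFun 𝒜 ℒ) = 0 := by
  rw [iota_eq_sum, LinearMap.sum_apply]
  exact Finset.sum_eq_zero fun i _ => contract_ofBase _ _

theorem iota_linear (u : HSec ℒ) (φ : L →ₗ[A] A) :
    iota u.val (linear φ : FormalFun 𝒜 ℒ) = ofBase (psgn u.par • φ u.val) := by
  rw [iota_val]
  refine ext_apply fun l => ?_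
  cases l <;> rfl

theorem iota_apply_nil (u : HSec ℒ) (F : FormalFun 𝒜 ℒ) :
    (iota u.val F).1 [] = F.1 [u] := by
  rw [iota_val]; rfl

theorem isSuperDer_iota [IsSupercommutative 𝒜] (u : HSec ℒ) :
    IsSuperDer (u.par + 1) (iota (𝒜 := 𝒜) (ℒ := ℒ) u.val) := by
  rw [iota_val]; exact isSuperDer_contract u

/-- `ι(fu) = (-1)^f̃ f ι(u)`. -/
theorem iota_fsmul [IsSupercommutative 𝒜]
    (h𝒜 : ∀ {i j : ZMod 2} {f : A} {σ : L}, f ∈ 𝒜 i → σ ∈ ℒ j → f • σ ∈ ℒ (i + j))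
    {d : ZMod 2} {f : A} (hf : f ∈ 𝒜 d) (u : HSec ℒ)
    (F : FormalFun 𝒜 ℒ) :
    iota (f • u.val) F = psgn d • mul 𝒜 (ofBase f) (iota u.val F) := by
  change iota (u.fsmul h𝒜 hf).val F = _
  rw [iota_val, iota_val]
  refine ext_apply fun l => ?_
  have := F.2.smul [] l d f u (u.fsmul h𝒜 hf) hf rfl rfl
  simp only [List.nil_append] at this
  rw [contract_apply, this, val_zsmul, ofBase_mul_apply hf, contract_apply, smul_smul, ← psgn_add]
  congr 2
  ring

/-! ### Iterated commutators -/

theorem superComm_add_left (a b : ZMod 2) (X X' Y : FormalFun 𝒜 ℒ →ₗ[ℝ] FormalFun 𝒜 ℒ) :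
    superComm a b (X + X') Y = superComm a b X Y + superComm a b X' Y := by
  refine LinearMap.ext fun F => ?_
  simp only [superComm_apply, LinearMap.add_apply, map_add, smul_add]
  abel

theorem superComm_zsmul_left (a b : ZMod 2) (z : ℤ) (X Y : FormalFun 𝒜 ℒ →ₗ[ℝ] FormalFun 𝒜 ℒ) :
    superComm a b (z • X) Y = z • superComm a b X Y := by
  refine LinearMap.ext fun F => ?_
  simp only [superComm_apply, LinearMap.smul_apply, map_zsmul, smul_sub]
  rw [smul_comm z]

theorem superComm_zsmul_right (a b : ZMod 2) (z : ℤ) (X Y : FormalFun 𝒜 ℒ →ₗ[ℝ] FormalFun 𝒜 ℒ) :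
    superComm a b X (z • Y) = z • superComm a b X Y := by
  refine LinearMap.ext fun F => ?_
  simp only [superComm_apply, LinearMap.smul_apply, map_zsmul, smul_sub]
  rw [smul_comm z]

theorem superComm_add_right (a b : ZMod 2) (X Y Y' : FormalFun 𝒜 ℒ →ₗ[ℝ] FormalFun 𝒜 ℒ) :
    superComm a b X (Y + Y') = superComm a b X Y + superComm a b X Y' := by
  refine LinearMap.ext fun F => ?_
  simp only [superComm_apply, LinearMap.add_apply, map_add, smul_add]
  abel

theorem nestedComm_add (l : List (HSec ℒ)) :
    ∀ (a : ZMod 2) (X Y : FormalFun 𝒜 ℒ →ₗ[ℝ] FormalFun 𝒜 ℒ),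
    nestedComm a (X + Y) l = nestedComm a X l + nestedComm a Y l := by
  induction l with
  | nil => intros; rfl
  | cons u l ih => intro a X Y; simp only [nestedComm, superComm_add_left, ih]

theorem nestedComm_zsmul (l : List (HSec ℒ)) :
    ∀ (a : ZMod 2) (z : ℤ) (X : FormalFun 𝒜 ℒ →ₗ[ℝ] FormalFun 𝒜 ℒ),
    nestedComm a (z • X) l = z • nestedComm a X l := by
  induction l with
  | nil => intros; rfl
  | cons u l ih => intro a z X; simp only [nestedComm, superComm_zsmul_left, ih]

theorem nestedComm_zero (l : List (HSec ℒ)) (a : ZMod 2) :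
    nestedComm a (0 : FormalFun 𝒜 ℒ →ₗ[ℝ] FormalFun 𝒜 ℒ) l = 0 := by
  simpa using nestedComm_zsmul (𝒜 := 𝒜) l a 0 0

theorem nestedComm_append (l₁ l₂ : List (HSec ℒ)) :
    ∀ (a : ZMod 2) (X : FormalFun 𝒜 ℒ →ₗ[ℝ] FormalFun 𝒜 ℒ),
    nestedComm a X (l₁ ++ l₂) = nestedComm (a + shiftedPar l₁) (nestedComm a X l₁) l₂ := by
  induction l₁ with
  | nil => intro a X; simp [nestedComm]
  | cons u l ih =>
    intro a X
    simp only [List.cons_append, nestedComm, ih, shiftedPar_cons, add_assoc]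

theorem nestedComm_concat (l : List (HSec ℒ)) (u : HSec ℒ) (a : ZMod 2)
    (X : FormalFun 𝒜 ℒ →ₗ[ℝ] FormalFun 𝒜 ℒ) :
    nestedComm a X (l ++ [u]) =
      superComm (a + shiftedPar l) (u.par + 1) (nestedComm a X l) (iota u.val) := by
  rw [nestedComm_append]; rfl

/-- This is the graded Jacobi identity for commutators, in which the term with [ι(u), ι(v)] drops
out because these fields supercommute. -/
theorem superComm_superComm_swap (a : ZMod 2) (X : FormalFun 𝒜 ℒ →ₗ[ℝ] FormalFun 𝒜 ℒ)
    (u v : HSec ℒ) :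
    superComm (a + (u.par + 1)) (v.par + 1) (superComm a (u.par + 1) X (iota u.val)) (iota v.val) =
      psgn ((u.par + 1) * (v.par + 1)) •
        superComm (a + (v.par + 1)) (u.par + 1) (superComm a (v.par + 1) X (iota v.val))
          (iota u.val) := by
  refine LinearMap.ext fun F => ?_
  have h : ∀ G : FormalFun 𝒜 ℒ, contract u (contract v G) =
      psgn ((u.par + 1) * (v.par + 1)) • contract v (contract u G) :=
    fun G => LinearMap.congr_fun (contract_comm u v) G
  simp only [iota_val, superComm_apply, LinearMap.smul_apply, map_sub, map_zsmul, smul_sub, h]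
  clear h
  generalize u.par = x
  generalize v.par = y
  match_scalars <;> (revert a x y; decide)

theorem nestedComm_swap (l₁ l₂ : List (HSec ℒ)) (u v : HSec ℒ) (a : ZMod 2)
    (X : FormalFun 𝒜 ℒ →ₗ[ℝ] FormalFun 𝒜 ℒ) :
    nestedComm a X (l₁ ++ u :: v :: l₂) =
      psgn ((u.par + 1) * (v.par + 1)) • nestedComm a X (l₁ ++ v :: u :: l₂) := by
  rw [nestedComm_append, nestedComm_append, nestedComm, nestedComm, superComm_superComm_swap,
    nestedComm_zsmul, nestedComm, nestedComm]
  congr 2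
  ring

/-- The commutators of a composition produce the inner bracket as last argument, whereas the
Jacobiator has it as first; this relates the two positions. -/
theorem nestedComm_cons_eq_concat (w : HSec ℒ) (l : List (HSec ℒ)) :
    ∀ (a : ZMod 2) (X : FormalFun 𝒜 ℒ →ₗ[ℝ] FormalFun 𝒜 ℒ),
    nestedComm a X (w :: l) = psgn ((w.par + 1) * shiftedPar l) • nestedComm a X (l ++ [w]) := by
  induction l with
  | nil => intro a X; simp [psgn_zero]
  | cons u l ih =>
    intro a X
    have h := nestedComm_swap [] l w u a X
    simp only [List.nil_append] at h
    rw [h, nestedComm, ih, List.cons_append, nestedComm, shiftedPar_cons, smul_smul, ← psgn_add]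
    congr 2
    ring

theorem IsSuperDer.nestedComm [IsSupercommutative 𝒜] (l : List (HSec ℒ)) :
    ∀ {a : ZMod 2} {X : FormalFun 𝒜 ℒ →ₗ[ℝ] FormalFun 𝒜 ℒ}, IsSuperDer a X →
    IsSuperDer (a + shiftedPar l) (nestedComm a X l) := by
  induction l with
  | nil => intro a X hX; simpa [SuperGeom.nestedComm] using hX
  | cons u l ih =>
    intro a X hX
    rw [shiftedPar_cons, ← add_assoc]
    exact ih (hX.superComm (isSuperDer_iota u))

/-- Additivity of iterated commutators in each slot. -/
theorem nestedComm_slot_add (l₁ l₂ : List (HSec ℒ)) {u v w : HSec ℒ} (h1 : u.par = w.par)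
    (h2 : v.par = w.par) (h3 : w.val = u.val + v.val) (a : ZMod 2)
    (X : FormalFun 𝒜 ℒ →ₗ[ℝ] FormalFun 𝒜 ℒ) :
    nestedComm a X (l₁ ++ w :: l₂) =
      nestedComm a X (l₁ ++ u :: l₂) + nestedComm a X (l₁ ++ v :: l₂) := by
  rw [nestedComm_append, nestedComm_append, nestedComm_append, nestedComm, nestedComm, nestedComm,
    h1, h2, h3, iota_add, superComm_add_right, nestedComm_add]

/-- The coefficients of `X f` in terms of iterated commutators. -/
def baseExp : ZMod 2 → List (HSec ℒ) → ZMod 2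
  | _, [] => 0
  | a, u :: l => 1 + a * (u.par + 1) + baseExp (a + (u.par + 1)) l

/-- Fields ι(u) kill functions on the base, so only the term of each commutator with ι(u) on the
left survives. The iterated commutators on f are thus the Taylor coefficients of X f, which makes
anchors tensorial. -/
theorem nestedComm_ofBase_nil (f : A) (l : List (HSec ℒ)) :
    ∀ (a : ZMod 2) (X : FormalFun 𝒜 ℒ →ₗ[ℝ] FormalFun 𝒜 ℒ),
    (nestedComm a X l (ofBase f)).1 [] = psgn (baseExp a l) • (X (ofBase f)).1 l := by
  induction l with
  | nil => intro a X; simp [nestedComm, baseExp, psgn_zero]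
  | cons u l ih =>
    intro a X
    rw [nestedComm, ih, superComm_apply, iota_ofBase, map_zero, zero_sub, val_neg, val_zsmul,
      iota_val, contract_apply, baseExp, add_assoc, psgn_one_add, psgn_add, neg_smul, smul_neg,
      mul_smul, smul_comm]

/-- For F affine along the fibres, ι(u) F is a base function and is killed by X, so [X, ι(u)] F = ±
ι(u) X F. Commutators hence compute the Taylor coefficients of X F, and [X, ι(u)] kills the base
again, which carries the induction. -/
theorem apply_eq_zero_of_nestedComm {F : FormalFun 𝒜 ℒ}
    (hF : ∀ u : HSec ℒ, ∃ f : A, iota u.val F = ofBase f) (l : List (HSec ℒ)) :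
    ∀ (a : ZMod 2) (X : FormalFun 𝒜 ℒ →ₗ[ℝ] FormalFun 𝒜 ℒ),
    (∀ f, X (ofBase f) = 0) → (∀ k, (nestedComm a X k F).1 [] = 0) → (X F).1 l = 0 := by
  induction l with
  | nil => intro a X _ h; exact h []
  | cons u l ih =>
    intro a X hX h
    have h1 := ih (a + (u.par + 1)) (superComm a (u.par + 1) X (iota u.val))
      (fun f => by rw [superComm_apply, iota_ofBase, hX, map_zero, map_zero, smul_zero, sub_zero])
      (fun k => h (u :: k))
    obtain ⟨f, hf⟩ := hF u
    rw [superComm_apply, hf, hX, zero_sub, val_neg, val_zsmul, neg_eq_zero,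
      psgn_smul_eq_zero, iota_val] at h1
    exact h1

end Derivations

/-! ### Local bases, Hadamard's lemma and the weight -1 part of a derivation -/

section LocalBases

open FormalFun

/-- Functions `ρ_x` on the base, together with finite systems of sections and of linear forms on
sections which are dual bases after localization at `ρ_x`. This is the algebraic content of the
local triviality of a super vector bundle. -/
structure LocalBases {A L : Type*} [Ring A] [Algebra ℝ A] (𝒜 : ZMod 2 → Submodule ℝ A)
    [AddCommGroup L] [Module A L] [Module ℝ L] (ℒ : ZMod 2 → Submodule ℝ L)
    (X ι : Type*) [Fintype ι] where
  rho : X → A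
  rho_mem : ∀ x, rho x ∈ 𝒜 0
  e : X → ι → HSec ℒ
  eps : X → ι → L →ₗ[A] A
  eps_mem : ∀ x i (u : HSec ℒ), eps x i u.val ∈ 𝒜 (u.par + (e x i).par)
  expand : ∀ x σ, rho x • σ = ∑ i, eps x i σ • (e x i).val
  eq_zero : ∀ a : A, (∀ x, rho x * a = 0) → a = 0
  sec_eq_zero : ∀ σ : L, (∀ x, rho x • σ = 0) → σ = 0
  glue : ∀ s : X → L, (∀ x y, rho y • s x = rho x • s y) → ∃ σ, ∀ x, rho x • σ = s x
  smul_mem : ∀ {i j : ZMod 2} {f : A} {σ : L}, f ∈ 𝒜 i → σ ∈ ℒ j → f • σ ∈ ℒ (i + j)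

namespace LocalBases

variable {A L : Type*} [Ring A] [Algebra ℝ A] {𝒜 : ZMod 2 → Submodule ℝ A} [GradedAlgebra 𝒜]
  [IsSupercommutative 𝒜] [AddCommGroup L] [Module A L] [Module ℝ L] {ℒ : ZMod 2 → Submodule ℝ L}
  [DirectSum.Decomposition ℒ] {X ι : Type*} [Fintype ι] (B : LocalBases 𝒜 ℒ X ι)

/-- The fibre coordinates, as formal functions of weight one. -/
def coord (x : X) (i : ι) : FormalFun 𝒜 ℒ := linear (B.eps x i)

theorem hasParity_coord (x : X) (i : ι) : HasParity ((B.e x i).par + 1) (B.coord x i) :=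
  hasParity_linear (B.eps_mem x i)

theorem vanishesTo_coord (x : X) (i : ι) : VanishesTo 1 (B.coord x i) :=
  vanishesTo_one_iff.mpr rfl

/-- The Euler vector field of the fibres, multiplied by `ρ_x`. -/
def euler (x : X) (F : FormalFun 𝒜 ℒ) : FormalFun 𝒜 ℒ :=
  ∑ i, psgn (B.e x i).par • mul 𝒜 (B.coord x i) (iota (B.e x i).val F)

theorem iota_comm (u v : HSec ℒ) (F : FormalFun 𝒜 ℒ) :
    iota u.val (iota v.val F) =
      psgn ((u.par + 1) * (v.par + 1)) • iota v.val (iota u.val F) := by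
  rw [iota_val, iota_val]
  exact LinearMap.congr_fun (contract_comm u v) F

/-- By the Leibniz rule, the terms where ι(u) hits a coordinate add up to ρ_x ι(u) F through the
expansion of ρ_x u in the local basis; the others form the Euler field applied to ι(u) F. -/
theorem iota_euler (x : X) (u : HSec ℒ) (F : FormalFun 𝒜 ℒ) :
    iota u.val (B.euler x F) =
      mul 𝒜 (ofBase (B.rho x)) (iota u.val F) + B.euler x (iota u.val F) := by
  have h1 : ∀ i, iota u.val
      (psgn (B.e x i).par • mul 𝒜 (B.coord x i) (iota (B.e x i).val F)) =
      iota (B.eps x i u.val • (B.e x i).val) F +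
        psgn (B.e x i).par • mul 𝒜 (B.coord x i) (iota (B.e x i).val (iota u.val F)) := by
    intro i
    rw [map_zsmul, (isSuperDer_iota u).leibniz _ _ _ (B.hasParity_coord x i), coord, iota_linear,
      iota_comm u, ofBase_zsmul, mul_zsmul_left, mul_zsmul_right,
      iota_fsmul B.smul_mem (B.eps_mem x i u)]
    generalize u.par = a
    generalize (B.e x i).par = b
    match_scalars <;> (revert a b; decide)
  have h2 : ∑ i, iota (B.eps x i u.val • (B.e x i).val) F =
      mul 𝒜 (ofBase (B.rho x)) (iota u.val F) := by
    refine ext_apply fun l => ?_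
    rw [val_sum]
    have h := map_sum (iotaCoeff F l) (fun i => B.eps x i u.val • (B.e x i).val) Finset.univ
    rw [← B.expand] at h
    refine h.symm.trans ?_
    change (iota (B.rho x • u.val) F).1 l = _
    rw [iota_fsmul B.smul_mem (B.rho_mem x), psgn_zero, one_smul]
  rw [euler, map_sum, Finset.sum_congr rfl fun i _ => h1 i, Finset.sum_add_distrib, h2]
  rfl

/-- Euler's identity: each argument moved through the Euler field by `iota_euler` contributes one
summand ρ_x F. -/
theorem euler_apply (x : X) (l : List (HSec ℒ)) : ∀ F : FormalFun 𝒜 ℒ,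
    (B.euler x F).1 l = l.length • (B.rho x * F.1 l) := by
  induction l with
  | nil =>
    intro F
    rw [euler, val_sum, List.length_nil, zero_smul]
    refine Finset.sum_eq_zero fun i _ => ?_
    rw [val_zsmul, mul_nil, coord, linear_nil, zero_mul, smul_zero]
  | cons u l ih =>
    intro F
    have h := congrArg (fun G : FormalFun 𝒜 ℒ => G.1 l) (B.iota_euler x u F)
    simp only [val_add, ih, ofBase_even_mul_apply (B.rho_mem x)] at h
    rw [iota_val] at h
    simp only [contract_apply] at h
    rw [h, List.length_cons, succ_nsmul']

/-- Hadamard's lemma: a formal function which vanishes at the zero section is, after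
multiplication by `ρ_x`, in the ideal of the fibre coordinates. -/
theorem hadamard (x : X) {F : FormalFun 𝒜 ℒ} (hF : F.1 [] = 0) :
    mul 𝒜 (ofBase (B.rho x)) F =
      ∑ i, mul 𝒜 (B.coord x i) (psgn (B.e x i).par • iota (B.e x i).val (divWeight F)) := by
  have h : mul 𝒜 (ofBase (B.rho x)) F = B.euler x (divWeight F) := by
    refine ext_apply fun l => ?_
    rw [ofBase_even_mul_apply (B.rho_mem x), B.euler_apply, divWeight_apply]
    -- In weight zero, where `divWeight` inverts 0, both sides vanish because F vanishes on the zero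
    -- section; in positive weight k the factors k and 1/k cancel.
    cases l with
    | nil => simp [hF]
    | cons u l =>
      rw [mul_smul_comm, ← Nat.cast_smul_eq_nsmul ℝ, smul_smul, mul_inv_cancel₀, one_smul]
      simp only [List.length_cons]
      positivity
  rw [h, euler]
  exact Finset.sum_congr rfl fun i _ => (mul_zsmul_right _ _ _).symm

theorem vanishesTo_iota {N : ℕ} {F : FormalFun 𝒜 ℒ} (hF : VanishesTo (N + 1) F) (u : HSec ℒ) :
    VanishesTo N (iota u.val F) := by
  intro l hl
  rw [iota_val]
  exact hF (u :: l) (by simpa using hl)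

theorem vanishesTo_divWeight {N : ℕ} {F : FormalFun 𝒜 ℒ} (hF : VanishesTo N F) :
    VanishesTo N (divWeight F) := by
  intro l hl
  rw [divWeight_apply, hF l hl, smul_zero]

theorem vanishesTo_of_rho_mul {N : ℕ} {F : FormalFun 𝒜 ℒ}
    (h : ∀ x, VanishesTo N (mul 𝒜 (ofBase (B.rho x)) F)) : VanishesTo N F := by
  intro l hl
  refine B.eq_zero _ fun x => ?_
  rw [← ofBase_even_mul_apply (B.rho_mem x)]
  exact h x l hl

/-- Hadamard's lemma only describes ρ_x F, so the factor ρ_x has to be moved inside Y. -/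
theorem rho_leibniz {a : ZMod 2} {Y : FormalFun 𝒜 ℒ →ₗ[ℝ] FormalFun 𝒜 ℒ} (hY : IsSuperDer a Y)
    (x : X) (F : FormalFun 𝒜 ℒ) :
    mul 𝒜 (ofBase (B.rho x)) (Y F) =
      Y (mul 𝒜 (ofBase (B.rho x)) F) - mul 𝒜 (Y (ofBase (B.rho x))) F := by
  rw [hY.leibniz _ _ _ (hasParity_ofBase (B.rho_mem x)), mul_zero, psgn_zero, one_smul,
    add_sub_cancel_left]

/-- A superderivation whose values on the fibre coordinates vanish at the zero section preserves
the order of vanishing at the zero section. -/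
theorem vanishesTo_apply {a : ZMod 2} {Y : FormalFun 𝒜 ℒ →ₗ[ℝ] FormalFun 𝒜 ℒ}
    (hY : IsSuperDer a Y) (h : ∀ x i, (Y (B.coord x i)).1 [] = 0) (N : ℕ) :
    ∀ F, VanishesTo N F → VanishesTo N (Y F) := by
  induction N with
  | zero => intro F _; exact vanishesTo_zero _
  | succ N ih =>
    intro F hF
    refine B.vanishesTo_of_rho_mul fun x => ?_
    rw [B.rho_leibniz hY]
    refine VanishesTo.sub ?_ ?_
    -- In Y(ξG) = Y(ξ)G ± ξY(G), the function G vanishes to order N after one derivative of F, both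
    -- ξ and Y(ξ) vanish to order one, and Y(G) vanishes to order N by induction.
    · rw [B.hadamard x (hF [] (by simp)), map_sum]
      refine VanishesTo.sum fun i _ => ?_
      rw [hY.leibniz _ _ _ (B.hasParity_coord x i), add_comm N]
      have hG : VanishesTo N (psgn (B.e x i).par • iota (B.e x i).val (divWeight F)) :=
        (vanishesTo_iota (vanishesTo_divWeight hF) _).zsmul _
      exact ((vanishesTo_one_iff.mpr (h x i)).mul hG).add
        (((B.vanishesTo_coord x i).mul (ih _ hG)).zsmul _)
    · simpa using (vanishesTo_zero (Y (ofBase (B.rho x)))).mul hF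

/-- A superderivation which vanishes on the base and on the fibre coordinates is zero. -/
theorem eq_zero_of_coord {a : ZMod 2} {Y : FormalFun 𝒜 ℒ →ₗ[ℝ] FormalFun 𝒜 ℒ}
    (hY : IsSuperDer a Y) (h0 : ∀ f, Y (ofBase f) = 0) (h1 : ∀ x i, Y (B.coord x i) = 0) :
    Y = 0 := by
  -- Every YF vanishes to every order: removing the value of F on the zero section does not change
  -- YF, and the coordinate factor from Hadamard's lemma gains one order over the induction
  -- hypothesis.
  have key : ∀ (N : ℕ) (F), VanishesTo N (Y F) := by
    intro N
    induction N with
    | zero => intro F; exact vanishesTo_zero _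
    | succ N ih =>
      intro F
      have hF : Y F = Y (F - ofBase (F.1 [])) := by rw [map_sub, h0, sub_zero]
      rw [hF]
      refine B.vanishesTo_of_rho_mul fun x => ?_
      rw [B.rho_leibniz hY, h0, zero_mul', sub_zero, B.hadamard x (by simp), map_sum]
      refine VanishesTo.sum fun i _ => ?_
      rw [hY.leibniz _ _ _ (B.hasParity_coord x i), h1, zero_mul', zero_add, add_comm N]
      exact ((B.vanishesTo_coord x i).mul (ih _)).zsmul _
  refine LinearMap.ext fun F => ext_apply fun l => ?_
  exact key (l.length + 1) F l (Nat.lt_succ_self _)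

/-! ### The section of a vector field at the zero section -/

theorem divWeight_linear (φ : L →ₗ[A] A) : divWeight (linear φ : FormalFun 𝒜 ℒ) = linear φ := by
  refine ext_apply fun l => ?_
  rcases l with _ | ⟨u, _ | ⟨v, l⟩⟩ <;> simp [divWeight_apply]

/-- Hadamard's lemma for a linear form φ expresses ρ_x φ in the coordinates at x with coefficients
φ(e_i). For φ a coordinate at another point this is the transition rule needed for gluing. -/
theorem rho_mul_apply_linear {a : ZMod 2} {Y : FormalFun 𝒜 ℒ →ₗ[ℝ] FormalFun 𝒜 ℒ}
    (hY : IsSuperDer a Y) (x : X) (φ : L →ₗ[A] A) :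
    B.rho x * (Y (linear φ)).1 [] = ∑ i, (Y (B.coord x i)).1 [] * φ (B.e x i).val := by
  have h := congrArg (fun F : FormalFun 𝒜 ℒ => F.1 []) (B.rho_leibniz hY x (linear φ))
  simp only [val_sub, mul_nil, ofBase_nil, linear_nil, mul_zero, sub_zero] at h
  rw [h, B.hadamard x (linear_nil φ), map_sum, val_sum]
  refine Finset.sum_congr rfl fun i _ => ?_
  rw [hY.leibniz _ _ _ (B.hasParity_coord x i), divWeight_linear, iota_linear, ofBase_zsmul,
    psgn_smul_psgn_smul, val_add, val_zsmul, mul_nil, mul_nil, ofBase_nil, coord, linear_nil,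
    zero_mul, smul_zero, add_zero]

theorem eq_zero_of_eps {σ : L} (h : ∀ x i, B.eps x i σ = 0) : σ = 0 := by
  refine B.sec_eq_zero σ fun x => ?_
  rw [B.expand]
  exact Finset.sum_eq_zero fun i _ => by rw [h, zero_smul]

/-- The sign in ι differs on the even and the odd part of a section, so these parts must be
separated first: their contributions to the value on a coordinate have opposite parities and cannot
cancel. -/
theorem eq_of_iota_coord {σ τ : L}
    (h : ∀ x i, (iota σ (B.coord x i)).1 [] = (iota τ (B.coord x i)).1 []) : σ = τ := by
  have h0 : ∀ x i, (iota (σ - τ) (B.coord x i)).1 [] = 0 := fun x i =>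
    (map_sub (iotaCoeff (B.coord x i) []) σ τ).trans (sub_eq_zero.mpr (h x i))
  rw [← sub_eq_zero]
  clear h
  generalize σ - τ = ν at h0
  have h1 : ∀ (p : ZMod 2), (HSec.proj ℒ p ν).val = 0 := by
    intro p
    refine B.eq_zero_of_eps fun x i => ?_
    have h := h0 x i
    rw [iota_eq_sum, LinearMap.sum_apply, val_sum] at h
    simp only [contract_apply, coord, linear_singleton] at h
    have hp : ∀ q : ZMod 2, psgn q • B.eps x i (HSec.proj ℒ q ν).val ∈ 𝒜 (q + (B.e x i).par) :=
      fun q => zsmul_mem (B.eps_mem x i (HSec.proj ℒ q ν)) _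
    have hs : ∀ q : ZMod 2, (HSec.proj ℒ q ν).par = q := fun q => rfl
    simp only [hs] at h
    have h2 : psgn p • B.eps x i (HSec.proj ℒ p ν).val =
        -(psgn (p + 1) • B.eps x i (HSec.proj ℒ (p + 1) ν).val) := by
      rw [eq_neg_iff_add_eq_zero, ← h]
      clear hp h hs
      rw [show (Finset.univ : Finset (ZMod 2)) = {p, p + 1} by revert p; decide,
        Finset.sum_pair (by revert p; decide)]
    have h3 := eq_zero_of_mem_of_mem 𝒜 (i := p + (B.e x i).par) (j := p + 1 + (B.e x i).par)
      (by generalize (B.e x i).par = b; clear hp h hs h2; revert p b; decide) (hp p)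
      (by rw [h2]; exact neg_mem (hp (p + 1)))
    exact psgn_smul_eq_zero.mp h3
  rw [← HSec.sum_proj (ℒ := ℒ) ν]
  exact Finset.sum_eq_zero fun p _ => h1 p

theorem iota_injective (B : LocalBases 𝒜 ℒ X ι) : Function.Injective (iota (𝒜 := 𝒜) (ℒ := ℒ)) :=
  fun _ _ h => B.eq_of_iota_coord fun x i => congrArg (fun Y => (Y (B.coord x i)).1 []) h

/-- The values of Y on the coordinates, restricted to the zero section, transform like the
coefficients of a section of E. -/
theorem exists_eps_eq {a : ZMod 2} {Y : FormalFun 𝒜 ℒ →ₗ[ℝ] FormalFun 𝒜 ℒ}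
    (hY : IsSuperDer a Y) :
    ∃ s : HSec ℒ, s.par = a + 1 ∧
      ∀ x i, B.eps x i s.val = psgn (a + 1) • (Y (B.coord x i)).1 [] := by
  -- The candidate for ρ_x σ; its sign cancels the one in the definition of `linear`.
  let s : X → L := fun x => psgn (a + 1) • ∑ i, (Y (B.coord x i)).1 [] • (B.e x i).val
  have hs : ∀ x, s x ∈ ℒ (a + 1) := by
    intro x
    refine zsmul_mem (sum_mem fun i _ => ?_) _
    have h1 := hY.parity _ _ (B.hasParity_coord x i) []
    have h2 := B.smul_mem h1 (B.e x i).mem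
    have e : a + ((B.e x i).par + 1) + shiftedPar ([] : List (HSec ℒ)) + (B.e x i).par = a + 1 := by
      rw [shiftedPar_nil]
      generalize (B.e x i).par = b
      clear h1 h2 hY s
      revert a b; decide
    rwa [e] at h2
  have heps : ∀ x y j, B.eps y j (s x) = psgn (a + 1) • (B.rho x * (Y (B.coord y j)).1 []) := by
    intro x y j
    rw [coord, B.rho_mul_apply_linear hY x]
    simp only [s, map_zsmul, map_sum, map_smul, smul_eq_mul]
  -- Expanding ρ_y s_x in the basis at y, with the coefficients from `heps`, gives ρ_x s_y.
  obtain ⟨σ, hσ⟩ := B.glue s fun x y => by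
    rw [B.expand, Finset.sum_congr rfl fun j _ => by rw [heps x y j]]
    simp only [s, smul_assoc, mul_smul, Finset.smul_sum]
    exact Finset.sum_congr rfl fun j _ => by rw [smul_comm]
  -- Each s_x is homogeneous and ρ_x is even, so the component of σ of the wrong parity is
  -- annihilated by every ρ_x.
  have hmem : σ ∈ ℒ (a + 1) := by
    have h1 : (HSec.proj ℒ a σ).val = 0 := by
      refine B.sec_eq_zero _ fun x => ?_
      have h2 := hσ x
      rw [← HSec.sum_proj (ℒ := ℒ) σ, show (Finset.univ : Finset (ZMod 2)) = {a, a + 1} by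
        clear hs hσ heps h2 hY s; revert a; decide,
        Finset.sum_pair (by clear hs hσ heps h2 hY s; revert a; decide), smul_add] at h2
      have h3 : ∀ p, B.rho x • (HSec.proj ℒ p σ).val ∈ ℒ p := by
        intro p
        have := B.smul_mem (B.rho_mem x) (HSec.proj ℒ p σ).mem
        rwa [zero_add] at this
      refine eq_zero_of_mem_of_mem ℒ (i := a) (j := a + 1)
        (by clear hs hσ heps h2 hY h3 s; revert a; decide) (h3 a) ?_
      rw [eq_sub_of_add_eq h2]
      exact sub_mem (hs x) (h3 (a + 1))
    rw [← HSec.sum_proj (ℒ := ℒ) σ, show (Finset.univ : Finset (ZMod 2)) = {a, a + 1} by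
        clear hs hσ heps h1 hY s; revert a; decide,
        Finset.sum_pair (by clear hs hσ heps h1 hY s; revert a; decide), h1, zero_add]
    exact (HSec.proj ℒ (a + 1) σ).mem
  refine ⟨⟨a + 1, σ, hmem⟩, rfl, fun y j => ?_⟩
  rw [← sub_eq_zero]
  refine B.eq_zero _ fun x => ?_
  rw [mul_sub, sub_eq_zero, ← smul_eq_mul, ← map_smul, hσ, heps, mul_smul_comm]

/-- The derivation Y - ι(s) sends the coordinates to functions vanishing on the zero section, so
`vanishesTo_apply` applies to it. It then lowers no order of vanishing, which identifies ι(s) as the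
weight -1 part of Y. -/
theorem exists_symb (B : LocalBases 𝒜 ℒ X ι) {a : ZMod 2} {Y : FormalFun 𝒜 ℒ →ₗ[ℝ] FormalFun 𝒜 ℒ}
    (hY : IsSuperDer a Y) :
    ∃ s : HSec ℒ, s.par = a + 1 ∧
      ∀ (N : ℕ) (F), VanishesTo N F → VanishesTo N (Y F - iota s.val F) := by
  obtain ⟨s, hs, h⟩ := B.exists_eps_eq hY
  refine ⟨s, hs, fun N F hF => ?_⟩
  have hs' := isSuperDer_iota (𝒜 := 𝒜) s
  have e : s.par + 1 = a := by
    rw [hs]; clear hs h hY hs'; revert a; decide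
  rw [e] at hs'
  refine B.vanishesTo_apply (hY.sub hs') (fun x i => ?_) N F hF
  rw [LinearMap.sub_apply, val_sub, iota_apply_nil, coord, linear_singleton, h, hs,
    psgn_smul_psgn_smul]
  exact sub_self _

/-- The section of `E` given by the restriction of a vector field to the zero section, that is,
by its component of weight `-1`. -/
noncomputable def symb {a : ZMod 2} {Y : FormalFun 𝒜 ℒ →ₗ[ℝ] FormalFun 𝒜 ℒ}
    (hY : IsSuperDer a Y) : HSec ℒ := (B.exists_symb hY).choose

section
variable {a : ZMod 2} {Y : FormalFun 𝒜 ℒ →ₗ[ℝ] FormalFun 𝒜 ℒ} (hY : IsSuperDer a Y)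

theorem symb_par : (B.symb hY).par = a + 1 := (B.exists_symb hY).choose_spec.1

theorem vanishesTo_sub_symb {N : ℕ} {F : FormalFun 𝒜 ℒ} (hF : VanishesTo N F) :
    VanishesTo N (Y F - iota (B.symb hY).val F) :=
  (B.exists_symb hY).choose_spec.2 N F hF

theorem apply_nil_eq_symb {F : FormalFun 𝒜 ℒ} (hF : F.1 [] = 0) :
    (Y F).1 [] = (iota (B.symb hY).val F).1 [] := by
  have := B.vanishesTo_sub_symb hY (vanishesTo_one_iff.mpr hF) [] (by simp)
  rwa [val_sub, sub_eq_zero] at this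

theorem iota_symb : iota (B.symb hY).val = weightPart (-1) Y := by
  refine LinearMap.ext fun F => ext_apply fun l => ?_
  change _ = (Y (weightComp ((l.length : ℤ) - (-1)) F)).1 l
  -- The component has the single weight `l.length + 1`, hence vanishes to that order; so Y and ι(s)
  -- agree on it in weight `l.length`.
  have hF : VanishesTo (l.length + 1) (weightComp ((l.length : ℤ) - (-1)) F) := by
    intro k hk
    exact if_neg (by omega)
  have := B.vanishesTo_sub_symb hY hF l (Nat.lt_succ_self _)
  rw [val_sub, sub_eq_zero] at this
  rw [this, iota_val]
  simp [weightComp]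

/-- The weight `-1` component of a vector field is detected on the fibre coordinates, at the
zero section. -/
theorem eq_symb_of_coord {σ : L}
    (h : ∀ x i, (iota σ (B.coord x i)).1 [] = (Y (B.coord x i)).1 []) : σ = (B.symb hY).val :=
  B.eq_of_iota_coord fun x i => by rw [h, B.apply_nil_eq_symb hY (B.vanishesTo_coord x i [] (by simp))]

end

end LocalBases

end LocalBases

/-! ### Subsets of `Fin (n + 1)` -/

section Subsets

/-- A subset of `Fin n`, shifted to a subset of `Fin (n + 1)` without `0`. -/
def shiftSet {n : ℕ} (J : Finset (Fin n)) : Finset (Fin (n + 1)) := J.map (Fin.succEmb n)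

@[simp] theorem succ_mem_shiftSet {n : ℕ} {J : Finset (Fin n)} {i : Fin n} :
    i.succ ∈ shiftSet J ↔ i ∈ J := by
  simp [shiftSet]

@[simp] theorem zero_notMem_shiftSet {n : ℕ} {J : Finset (Fin n)} : (0 : Fin (n + 1)) ∉ shiftSet J := by
  simp [shiftSet]

theorem compl_shiftSet {n : ℕ} (J : Finset (Fin n)) :
    (shiftSet J)ᶜ = insert 0 (shiftSet Jᶜ) := by
  ext i
  cases i using Fin.cases <;> simp

theorem compl_insert_shiftSet {n : ℕ} (J : Finset (Fin n)) :
    (insert 0 (shiftSet J))ᶜ = shiftSet Jᶜ := by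
  ext i
  cases i using Fin.cases <;> simp

theorem card_shiftSet {n : ℕ} (J : Finset (Fin n)) : (shiftSet J).card = J.card := by
  simp [shiftSet]

theorem card_insert_shiftSet {n : ℕ} (J : Finset (Fin n)) :
    (insert 0 (shiftSet J)).card = J.card + 1 := by
  rw [Finset.card_insert_of_notMem zero_notMem_shiftSet, card_shiftSet]

theorem sum_shiftSet {V : Type*} [AddCommMonoid V] {n : ℕ} (J : Finset (Fin n))
    (f : Fin (n + 1) → V) : ∑ i ∈ shiftSet J, f i = ∑ i ∈ J, f i.succ := by
  simp [shiftSet]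

theorem sum_insert_shiftSet {V : Type*} [AddCommMonoid V] {n : ℕ} (J : Finset (Fin n))
    (f : Fin (n + 1) → V) :
    ∑ i ∈ insert 0 (shiftSet J), f i = f 0 + ∑ i ∈ J, f i.succ := by
  rw [Finset.sum_insert zero_notMem_shiftSet, sum_shiftSet]

/-- Subsets of `Fin (n + 1)` without and with `0`. -/
def subsetsSuccEquiv (n : ℕ) : Finset (Fin n) ⊕ Finset (Fin n) ≃ Finset (Fin (n + 1)) where
  toFun := Sum.elim shiftSet fun J => insert 0 (shiftSet J)
  invFun I := if 0 ∈ I then Sum.inr (Finset.univ.filter fun i => i.succ ∈ I) else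
    Sum.inl (Finset.univ.filter fun i => i.succ ∈ I)
  left_inv J := by
    rcases J with J | J <;> simp
  right_inv I := by
    by_cases h : 0 ∈ I <;> simp only [h, if_true, if_false, Sum.elim_inl, Sum.elim_inr] <;>
      (ext i; cases i using Fin.cases <;> simp [h])

theorem sum_subsets_succ {V : Type*} [AddCommMonoid V] {n : ℕ} (f : Finset (Fin (n + 1)) → V) :
    ∑ I, f I = ∑ J, f (shiftSet J) + ∑ J, f (insert 0 (shiftSet J)) := by
  rw [← (subsetsSuccEquiv n).sum_comp, Fintype.sum_sum_type]
  rfl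

theorem subset_succ_cases {n : ℕ} (I : Finset (Fin (n + 1))) :
    ∃ J, I = shiftSet J ∨ I = insert 0 (shiftSet J) := by
  obtain ⟨J | J, rfl⟩ := (subsetsSuccEquiv n).surjective I
  · exact ⟨J, Or.inl rfl⟩
  · exact ⟨J, Or.inr rfl⟩

/-- The values of a family on a subset, in increasing order. -/
def subList {α : Type*} {n : ℕ} (u : Fin n → α) (I : Finset (Fin n)) : List α :=
  List.ofFn fun k : Fin I.card => u (I.orderEmbOfFin rfl k)

theorem subList_eq_map_sort {α : Type*} {n : ℕ} (u : Fin n → α) (I : Finset (Fin n)) :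
    subList u I = (I.sort (· ≤ ·)).map u := by
  rw [← Finset.listMap_orderEmbOfFin_finRange I rfl, List.map_map, subList, List.ofFn_eq_map]
  rfl

theorem subList_shiftSet {α : Type*} {n : ℕ} (u : Fin (n + 1) → α) (J : Finset (Fin n)) :
    subList u (shiftSet J) = subList (u ∘ Fin.succ) J := by
  rw [subList_eq_map_sort, subList_eq_map_sort, ← List.map_map]
  congr 1
  exact (Finset.map_sort (f := Fin.succEmb n) (s := J) (· ≤ ·) (· ≤ ·)
    fun a _ b _ => by simp).symm

theorem subList_insert_shiftSet {α : Type*} {n : ℕ} (u : Fin (n + 1) → α) (J : Finset (Fin n)) :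
    subList u (insert 0 (shiftSet J)) = u 0 :: subList (u ∘ Fin.succ) J := by
  rw [← subList_shiftSet, subList_eq_map_sort, subList_eq_map_sort,
    Finset.sort_insert (· ≤ ·) (fun b _ => Fin.zero_le b) zero_notMem_shiftSet, List.map_cons]

theorem length_subList {α : Type*} {n : ℕ} (u : Fin n → α) (I : Finset (Fin n)) :
    (subList u I).length = I.card := by
  simp [subList]

/-- Sums over the pairs `j < i` with `i ∈ I` and `j ∉ I`. -/
def inversionSum {n : ℕ} (I : Finset (Fin n)) (w : Fin n → Fin n → ZMod 2) : ZMod 2 :=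
  ∑ i ∈ I, ∑ j ∈ Iᶜ, if j < i then w i j else 0

theorem inversionSum_shiftSet {n : ℕ} (J : Finset (Fin n))
    (w : Fin (n + 1) → Fin (n + 1) → ZMod 2) :
    inversionSum (shiftSet J) w = ∑ i ∈ J, w i.succ 0 +
      inversionSum J fun i j => w i.succ j.succ := by
  simp only [inversionSum, sum_shiftSet, compl_shiftSet, sum_insert_shiftSet, Fin.succ_pos,
    if_true, Finset.sum_add_distrib, Fin.succ_lt_succ_iff]

theorem inversionSum_insert_shiftSet {n : ℕ} (J : Finset (Fin n))
    (w : Fin (n + 1) → Fin (n + 1) → ZMod 2) :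
    inversionSum (insert 0 (shiftSet J)) w = inversionSum J fun i j => w i.succ j.succ := by
  simp only [inversionSum, sum_insert_shiftSet, compl_insert_shiftSet, sum_shiftSet,
    Fin.succ_lt_succ_iff, Fin.not_lt_zero, if_false, Finset.sum_const_zero, zero_add]

theorem inversionSum_add {n : ℕ} (I : Finset (Fin n)) (w w' : Fin n → Fin n → ZMod 2) :
    inversionSum I (fun i j => w i j + w' i j) = inversionSum I w + inversionSum I w' := by
  simp only [inversionSum, ← Finset.sum_add_distrib]
  refine Finset.sum_congr rfl fun i _ => Finset.sum_congr rfl fun j _ => ?_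
  split_ifs <;> simp

/-- Each pair with one index in I and the other outside is an inversion for exactly one of I and its
complement. -/
theorem inversionSum_compl {n : ℕ} (I : Finset (Fin n)) (c : Fin n → ZMod 2) :
    inversionSum I (fun i j => c i * c j) + inversionSum Iᶜ (fun i j => c i * c j) =
      (∑ i ∈ I, c i) * ∑ j ∈ Iᶜ, c j := by
  have h : inversionSum Iᶜ (fun i j => c i * c j) =
      ∑ i ∈ I, ∑ j ∈ Iᶜ, if i < j then c i * c j else 0 := by
    rw [inversionSum, compl_compl, Finset.sum_comm]
    refine Finset.sum_congr rfl fun i _ => Finset.sum_congr rfl fun j _ => ?_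
    rw [mul_comm]
  rw [h, inversionSum, ← Finset.sum_add_distrib, Finset.sum_mul_sum]
  refine Finset.sum_congr rfl fun i hi => ?_
  rw [← Finset.sum_add_distrib]
  refine Finset.sum_congr rfl fun j hj => ?_
  have hij : i ≠ j := by
    rintro rfl
    exact Finset.mem_compl.mp hj hi
  rcases lt_or_gt_of_ne hij with h | h
  · rw [if_neg h.not_gt, if_pos h, zero_add]
  · rw [if_pos h, if_neg h.not_gt, add_zero]

end Subsets

/-! ### Signs of the Jacobi identity and commutators of a composition -/

section Jacobi

open FormalFun

variable {A L : Type*} [Ring A] [Algebra ℝ A] {𝒜 : ZMod 2 → Submodule ℝ A} [GradedAlgebra 𝒜]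
  [AddCommGroup L] [Module A L] [Module ℝ L] {ℒ : ZMod 2 → Submodule ℝ L}

/-! ### Signs -/

/-- The Koszul sign exponent of unshuffling the vector fields of `u` into those of `I` and of the
complement of `I`, the former being moved past an operator of parity `b`. -/
def koszulExp {n : ℕ} (b : ZMod 2) (I : Finset (Fin n)) (u : Fin n → HSec ℒ) : ZMod 2 :=
  (∑ i ∈ I, ((u i).par + 1)) * b + inversionSum I fun i j => ((u i).par + 1) * ((u j).par + 1)

/-- If 0 lies outside the subset, every selected field also passes ι(u 0), as if the parity of the
operator to be passed were larger by that of ι(u 0). -/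
theorem koszulExp_shiftSet {n : ℕ} (b : ZMod 2) (J : Finset (Fin n)) (u : Fin (n + 1) → HSec ℒ) :
    koszulExp b (shiftSet J) u = koszulExp (b + ((u 0).par + 1)) J (u ∘ Fin.succ) := by
  simp only [koszulExp, sum_shiftSet, inversionSum_shiftSet, ← Finset.sum_mul,
    Function.comp_apply]
  ring

theorem koszulExp_insert_shiftSet {n : ℕ} (b : ZMod 2) (J : Finset (Fin n))
    (u : Fin (n + 1) → HSec ℒ) :
    koszulExp b (insert 0 (shiftSet J)) u =
      ((u 0).par + 1) * b + koszulExp b J (u ∘ Fin.succ) := by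
  simp only [koszulExp, sum_insert_shiftSet, inversionSum_insert_shiftSet, Function.comp_apply]
  ring

theorem shiftedPar_subList {n : ℕ} (u : Fin n → HSec ℒ) (I : Finset (Fin n)) :
    shiftedPar (subList u I) = ∑ i ∈ I, ((u i).par + 1) := by
  rw [subList_eq_map_sort, shiftedPar, List.map_map, Finset.sum, ← I.sort_eq (· ≤ ·),
    Multiset.map_coe, Multiset.sum_coe]
  rfl

theorem shiftedPar_ofFn {n : ℕ} (u : Fin n → HSec ℒ) :
    shiftedPar (List.ofFn u) = n + ∑ i, (u i).par := by
  rw [shiftedPar, List.map_ofFn, List.sum_ofFn]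
  simp [Finset.sum_add_distrib, add_comm]

/-- The exponent `derivedExp`, for lists. -/
def listExp : List (HSec ℒ) → ZMod 2
  | [] => 0
  | u :: l => u.par * (l.length : ZMod 2) + listExp l

theorem derivedExp_eq_listExp {n : ℕ} (u : Fin n → HSec ℒ) :
    derivedExp u = listExp (List.ofFn u) := by
  induction n with
  | zero => simp [derivedExp, listExp]
  | succ n ih =>
    rw [List.ofFn_succ, listExp, ← ih, derivedExp, Fin.sum_univ_succ, List.length_ofFn, derivedExp]
    congr 1
    refine Finset.sum_congr rfl fun k _ => ?_
    congr 2
    simp only [Fin.val_succ]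
    omega

/-- Compares the prefactor ε of all sections with those of the inner and the outer bracket, by
deciding to which block the first section belongs. -/
theorem listExp_split {n : ℕ} : ∀ (u : Fin n → HSec ℒ) (I : Finset (Fin n)),
    listExp (List.ofFn u) + listExp (subList u I) + listExp (subList u Iᶜ) =
      (∑ i ∈ I, (u i).par) * (Iᶜ.card : ZMod 2) +
        inversionSum I fun i j => (u i).par + (u j).par := by
  induction n with
  | zero =>
    intro u I
    have h : ∀ J : Finset (Fin 0), subList u J = [] := fun J => by
      rw [← List.length_eq_zero_iff, length_subList, Finset.card_eq_zero]
      exact Subsingleton.elim _ _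
    have hI : I = ∅ := Subsingleton.elim _ _
    rw [h, h, hI]
    simp [listExp, inversionSum]
  | succ n ih =>
    intro u I
    have hcard : ∀ J : Finset (Fin n), (n : ZMod 2) = J.card + Jᶜ.card := by
      intro J
      have := J.card_add_card_compl
      rw [Fintype.card_fin] at this
      rw [← Nat.cast_add, this]
    -- Characteristic two is supplied to `linear_combination` by hand; ring normalization does not
    -- know it.
    have h2 : ∀ x : ZMod 2, x + x = 0 := by decide
    obtain ⟨J, rfl | rfl⟩ := subset_succ_cases I
    · have h := ih (u ∘ Fin.succ) J
      rw [List.ofFn_succ, subList_shiftSet, compl_shiftSet, subList_insert_shiftSet,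
        inversionSum_shiftSet, sum_shiftSet, card_insert_shiftSet, listExp, listExp,
        List.length_ofFn, length_subList, Finset.sum_add_distrib, Finset.sum_const, nsmul_eq_mul,
        hcard J]
      simp only [Function.comp_def] at h ⊢
      push_cast
      linear_combination h + h2 ((u 0).par * (Jᶜ.card : ZMod 2)) - h2 (∑ i ∈ J, (u i.succ).par)
    · have h := ih (u ∘ Fin.succ) J
      rw [List.ofFn_succ, subList_insert_shiftSet, compl_insert_shiftSet, subList_shiftSet,
        inversionSum_insert_shiftSet, sum_insert_shiftSet, card_shiftSet, listExp, listExp,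
        List.length_ofFn, length_subList, hcard J]
      simp only [Function.comp_def] at h ⊢
      linear_combination h + h2 ((u 0).par * (J.card : ZMod 2))

/-- The Koszul signs of a subset and its complement differ by exactly the sign of a supercommutator,
which lets their terms merge into one. -/
theorem koszulExp_add_compl {n : ℕ} (I : Finset (Fin n)) (u : Fin n → HSec ℒ) :
    koszulExp 1 I u + koszulExp 1 Iᶜ u = 1 +
      (1 + shiftedPar (subList u I)) * (1 + shiftedPar (subList u Iᶜ)) := by
  have h := inversionSum_compl I fun i => (u i).par + 1
  simp only [koszulExp, shiftedPar_subList]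
  have h2 : (1 : ZMod 2) + 1 = 0 := by decide
  linear_combination h - h2

/-- After the total prefactor, the terms on the right are: the Koszul sign of the unshuffle, the
prefactors within both blocks, the inner bracket's contribution to the outer prefactor, and the
transport of the inner bracket from last to first argument. -/
theorem shuffleExp_eq {n : ℕ} (I : Finset (Fin n)) (u : Fin n → HSec ℒ) :
    shuffleExp I u = listExp (List.ofFn u) + (koszulExp 1 Iᶜ u + listExp (subList u I) +
      listExp (subList u Iᶜ) + shiftedPar (subList u I) * (Iᶜ.card : ZMod 2) +
      (shiftedPar (subList u I) + 1) * shiftedPar (subList u Iᶜ)) := by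
  have h1 := inversionSum_compl I fun i => (u i).par + 1
  have h2 := listExp_split u I
  have h3 := inversionSum_add I (fun i j => ((u i).par + 1) * ((u j).par + 1))
    (fun i j => (u i).par + (u j).par)
  -- The passage between shifted and unshifted parities: the Koszul sign for x + 1, y + 1 and the
  -- Koszul sign times the permutation sign for x, y differ by the sign of x + y.
  have h4 : ∀ x y : ZMod 2, (x + 1) * (y + 1) + (x + y) = 1 + x * y := by decide
  have h5 : ∀ x : ZMod 2, x + x = 0 := by decide
  simp only [h4] at h3
  have h6 : shuffleExp I u = (I.card : ZMod 2) * (Iᶜ.card : ZMod 2) +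
      inversionSum I fun i j => 1 + (u i).par * (u j).par := rfl
  rw [h6, h3]
  simp only [koszulExp, shiftedPar_subList, mul_one]
  have h7 : ∑ i ∈ I, ((u i).par + 1) = ∑ i ∈ I, (u i).par + I.card := by
    rw [Finset.sum_add_distrib]; simp
  linear_combination h1 - h2 - (Iᶜ.card : ZMod 2) * h7 - h5 (∑ i ∈ Iᶜ, ((u i).par + 1)) -
    h5 (inversionSum Iᶜ fun i j => ((u i).par + 1) * ((u j).par + 1)) -
    h5 ((∑ i ∈ I, (u i).par) * (Iᶜ.card : ZMod 2))

variable [DirectSum.Decomposition ℒ]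

theorem superComm_comp (a b c : ZMod 2) (X Y Z : FormalFun 𝒜 ℒ →ₗ[ℝ] FormalFun 𝒜 ℒ) :
    superComm (a + b) c (X ∘ₗ Y) Z =
      X ∘ₗ superComm b c Y Z + psgn (c * b) • (superComm a c X Z ∘ₗ Y) := by
  refine LinearMap.ext fun F => ?_
  simp only [superComm_apply, LinearMap.add_apply, LinearMap.smul_apply, LinearMap.comp_apply,
    map_sub, map_zsmul, smul_sub]
  match_scalars <;> (revert a b c; decide)

/-- The iterated commutators of a composition. -/
theorem nestedComm_comp {n : ℕ} : ∀ (u : Fin n → HSec ℒ) (a b : ZMod 2)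
    (X Y : FormalFun 𝒜 ℒ →ₗ[ℝ] FormalFun 𝒜 ℒ) (F : FormalFun 𝒜 ℒ),
    nestedComm (a + b) (X ∘ₗ Y) (List.ofFn u) F =
      ∑ I : Finset (Fin n), psgn (koszulExp b I u) •
        nestedComm a X (subList u I) (nestedComm b Y (subList u Iᶜ) F) := by
  induction n with
  | zero =>
    intro u a b X Y F
    have h : ∀ J : Finset (Fin 0), subList u J = [] := fun J => by
      rw [← List.length_eq_zero_iff, length_subList, Finset.card_eq_zero]
      exact Subsingleton.elim _ _
    rw [Fintype.sum_unique, h, h, show (default : Finset (Fin 0)) = ∅ from Subsingleton.elim _ _]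
    simp [nestedComm, koszulExp, inversionSum, psgn_zero]
  | succ n ih =>
    intro u a b X Y F
    rw [List.ofFn_succ, nestedComm, superComm_comp, nestedComm_add, nestedComm_zsmul,
      LinearMap.add_apply, LinearMap.smul_apply, sum_subsets_succ]
    have e1 : a + b + ((u 0).par + 1) = a + (b + ((u 0).par + 1)) := by ring
    have e2 : a + b + ((u 0).par + 1) = a + ((u 0).par + 1) + b := by ring
    congr 1
    -- Here ι(u 0) is absorbed by Y, so 0 lies in the complement of the subset.
    · rw [e1]
      refine (ih (u ∘ Fin.succ) _ _ _ _ _).trans (Finset.sum_congr rfl fun J _ => ?_)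
      rw [koszulExp_shiftSet, subList_shiftSet, compl_shiftSet, subList_insert_shiftSet, nestedComm]
    -- Here ι(u 0) is absorbed by X, after passing Y.
    · rw [e2]
      refine (congrArg _ (ih (u ∘ Fin.succ) _ _ _ _ _)).trans ?_
      rw [Finset.smul_sum]
      refine Finset.sum_congr rfl fun J _ => ?_
      rw [koszulExp_insert_shiftSet, compl_insert_shiftSet, subList_shiftSet,
        subList_insert_shiftSet, nestedComm, psgn_add, mul_smul]

end Jacobi

/-! ### Derived sections of a derivation and of its square -/

section DerivedBrackets

open FormalFun

variable {A L : Type*} [Ring A] [Algebra ℝ A] {𝒜 : ZMod 2 → Submodule ℝ A} [GradedAlgebra 𝒜]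
  [IsSupercommutative 𝒜] [AddCommGroup L] [Module A L] [Module ℝ L] {ℒ : ZMod 2 → Submodule ℝ L}

/-- The mixed terms Q(F)Q(G) occur with opposite signs because Q is odd. -/
theorem IsSuperDer.comp_self {Q : FormalFun 𝒜 ℒ →ₗ[ℝ] FormalFun 𝒜 ℒ} (hQ : IsSuperDer 1 Q) :
    IsSuperDer 0 (Q ∘ₗ Q) where
  parity d F hF := by
    have h := hQ.parity _ _ (hQ.parity d F hF)
    rwa [← add_assoc] at h
  leibniz d F G hF := by
    simp only [LinearMap.comp_apply, hQ.leibniz d F G hF, map_add, map_zsmul,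
      hQ.leibniz _ _ G (hQ.parity d F hF), hQ.leibniz d F _ hF, smul_add]
    clear hQ hF
    match_scalars <;> (revert d; decide)

theorem weightPart_zero_ofBase (X : FormalFun 𝒜 ℒ →ₗ[ℝ] FormalFun 𝒜 ℒ) (f : A) :
    weightPart 0 X (ofBase f) = ofBase ((X (ofBase f)).1 []) := by
  refine ext_apply fun l => ?_
  change (X (weightComp ((l.length : ℤ) - 0) (ofBase f))).1 l = _
  cases l with
  | nil =>
    have h : weightComp (((([] : List (HSec ℒ)).length : ℕ) : ℤ) - 0) (ofBase f : FormalFun 𝒜 ℒ) =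
        ofBase f := by
      refine ext_apply fun l => ?_
      cases l <;> simp [weightComp]
    rw [h]; rfl
  | cons u l =>
    have h : weightComp ((((u :: l).length : ℕ) : ℤ) - 0) (ofBase f : FormalFun 𝒜 ℒ) = 0 := by
      refine ext_apply fun k => ?_
      cases k with
      | nil =>
        change (if (([] : List (HSec ℒ)).length : ℤ) = ((u :: l).length : ℤ) - 0 then f else 0) = 0
        refine if_neg ?_
        simp only [List.length_nil, List.length_cons]
        omega
      | cons v k => simp [weightComp]
    rw [h, map_zero]; rfl

namespace LocalBases

variable [DirectSum.Decomposition ℒ] {X ι : Type*} [Fintype ι] (B : LocalBases 𝒜 ℒ X ι)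
  {a : ZMod 2} {Y Q : FormalFun 𝒜 ℒ →ₗ[ℝ] FormalFun 𝒜 ℒ}

/-- The section given by the weight `-1` component of an iterated commutator. -/
noncomputable def derivedSec (hY : IsSuperDer a Y) (l : List (HSec ℒ)) : HSec ℒ :=
  B.symb (hY.nestedComm l)

theorem derivedSec_par (hY : IsSuperDer a Y) (l : List (HSec ℒ)) :
    (B.derivedSec hY l).par = a + shiftedPar l + 1 :=
  B.symb_par _

theorem iota_derivedSec_nil (hY : IsSuperDer a Y) (l : List (HSec ℒ)) {F : FormalFun 𝒜 ℒ}
    (hF : F.1 [] = 0) :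
    (iota (B.derivedSec hY l).val F).1 [] = (nestedComm a Y l F).1 [] :=
  (B.apply_nil_eq_symb _ hF).symm

theorem eq_derivedSec (hY : IsSuperDer a Y) (l : List (HSec ℒ)) {σ : L}
    (h : ∀ x i, (iota σ (B.coord x i)).1 [] = (nestedComm a Y l (B.coord x i)).1 []) :
    σ = (B.derivedSec hY l).val :=
  B.eq_symb_of_coord _ h

theorem coord_nil (x : X) (i : ι) : (B.coord x i).1 [] = 0 := rfl

/-- Transfers sign rules from commutators to sections, since a section is detected by its values on
coordinates. -/
theorem zsmul_derivedSec (hY : IsSuperDer a Y) {l l' : List (HSec ℒ)} {z : ℤ}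
    (h : nestedComm a Y l' = z • nestedComm a Y l) :
    (B.derivedSec hY l').val = z • (B.derivedSec hY l).val := by
  refine (B.eq_derivedSec hY l' fun x i => ?_).symm
  rw [iota_zsmul, h, LinearMap.smul_apply, LinearMap.smul_apply, val_zsmul, val_zsmul,
    B.iota_derivedSec_nil hY l (B.coord_nil x i)]

theorem derivedSec_swap (hY : IsSuperDer a Y) (l₁ l₂ : List (HSec ℒ)) (u v : HSec ℒ) :
    (B.derivedSec hY (l₁ ++ u :: v :: l₂)).val =
      psgn ((u.par + 1) * (v.par + 1)) • (B.derivedSec hY (l₁ ++ v :: u :: l₂)).val :=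
  B.zsmul_derivedSec hY (nestedComm_swap l₁ l₂ u v a Y)

theorem derivedSec_cons (hY : IsSuperDer a Y) (w : HSec ℒ) (l : List (HSec ℒ)) :
    (B.derivedSec hY (w :: l)).val =
      psgn ((w.par + 1) * shiftedPar l) • (B.derivedSec hY (l ++ [w])).val :=
  B.zsmul_derivedSec hY (nestedComm_cons_eq_concat w l a Y)

theorem derivedSec_concat_zsmul (hY : IsSuperDer a Y) (l : List (HSec ℒ)) {v w : HSec ℒ} {z : ℤ}
    (h1 : w.par = v.par) (h2 : w.val = z • v.val) :
    (B.derivedSec hY (l ++ [w])).val = z • (B.derivedSec hY (l ++ [v])).val :=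
  B.zsmul_derivedSec hY (by
    rw [nestedComm_concat, nestedComm_concat, h1, h2, iota_zsmul, superComm_zsmul_right])

theorem derivedSec_slot_add (hY : IsSuperDer a Y) (l₁ l₂ : List (HSec ℒ)) {u v w : HSec ℒ}
    (h1 : u.par = w.par) (h2 : v.par = w.par) (h3 : w.val = u.val + v.val) :
    (B.derivedSec hY (l₁ ++ w :: l₂)).val =
      (B.derivedSec hY (l₁ ++ u :: l₂)).val + (B.derivedSec hY (l₁ ++ v :: l₂)).val := by
  refine (B.eq_derivedSec hY _ fun x i => ?_).symm
  rw [iota_add, nestedComm_slot_add l₁ l₂ h1 h2 h3, LinearMap.add_apply, LinearMap.add_apply,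
    val_add, val_add, B.iota_derivedSec_nil hY _ (B.coord_nil x i),
    B.iota_derivedSec_nil hY _ (B.coord_nil x i)]

theorem iota_fsmul_nil (B : LocalBases 𝒜 ℒ X ι) {d : ZMod 2} {f : A} (hf : f ∈ 𝒜 d) (u : HSec ℒ) (F : FormalFun 𝒜 ℒ) :
    (iota (f • u.val) F).1 [] = psgn d • (f * (iota u.val F).1 []) := by
  rw [iota_fsmul B.smul_mem hf, val_zsmul, mul_nil, ofBase_nil]

/-- The Leibniz rule for derived brackets in the last argument. -/
theorem derivedSec_concat_fsmul (hY : IsSuperDer a Y) (l : List (HSec ℒ)) {d : ZMod 2} {f : A}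
    (hf : f ∈ 𝒜 d) {v w : HSec ℒ} (h1 : w.par = d + v.par) (h2 : w.val = f • v.val) :
    (B.derivedSec hY (l ++ [w])).val =
      psgn (a + shiftedPar l) • ((nestedComm a Y l (ofBase f)).1 [] • v.val) +
        psgn ((a + shiftedPar l) * d) • (f • (B.derivedSec hY (l ++ [v])).val) := by
  refine (B.eq_derivedSec hY _ fun x i => ?_).symm
  have hN := hY.nestedComm l
  have hg : (nestedComm a Y l (ofBase f)).1 [] ∈ 𝒜 (a + shiftedPar l + d) := by
    simpa using hN.parity d _ (hasParity_ofBase hf) []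
  -- With N the iterated commutator, this is [N, fι(v)] = N(f)ι(v) ± f[N, ι(v)], evaluated on a
  -- coordinate at the zero section.
  rw [iota_add, iota_zsmul, iota_zsmul, LinearMap.add_apply, LinearMap.smul_apply,
    LinearMap.smul_apply, val_add, val_zsmul, val_zsmul, B.iota_fsmul_nil hg, B.iota_fsmul_nil hf,
    B.iota_derivedSec_nil hY _ (B.coord_nil x i), nestedComm_concat, nestedComm_concat, h1, h2,
    superComm_apply, superComm_apply, val_sub, val_sub, val_zsmul, val_zsmul, B.iota_fsmul_nil hf,
    iota_fsmul B.smul_mem hf, map_zsmul, hN.leibniz d _ _ (hasParity_ofBase hf), val_zsmul,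
    val_add, val_zsmul, mul_nil, mul_nil, ofBase_nil, mul_sub, mul_smul_comm]
  generalize a + shiftedPar l = y
  generalize v.par = e
  clear h1 hg hf hN
  match_scalars <;> (revert y e d; decide)

/-- The derived brackets of `Q²` are the Jacobiators of the derived brackets of `Q`. -/
theorem derivedSec_comp_self (hQ : IsSuperDer 1 Q) {n : ℕ} (u : Fin n → HSec ℒ) :
    (B.derivedSec hQ.comp_self (List.ofFn u)).val = ∑ I : Finset (Fin n),
      psgn (koszulExp 1 Iᶜ u) •
        (B.derivedSec hQ (subList u Iᶜ ++ [B.derivedSec hQ (subList u I)])).val := by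
  refine (B.eq_derivedSec hQ.comp_self _ fun x i => ?_).symm
  -- A coordinate is linear along the fibres, so its derivative along ι(s) is a function on the
  -- base.
  have hF : ∀ s : HSec ℒ, iota s.val (B.coord x i) = ofBase ((iota s.val (B.coord x i)).1 []) := by
    intro s
    rw [coord, iota_linear, ofBase_nil]
  generalize hFdef : B.coord x i = F at hF
  have hF0 : F.1 [] = 0 := by rw [← hFdef]; rfl
  -- splitting of a composition along the zero section
  have hsplit : ∀ I J : List (HSec ℒ), (nestedComm 1 Q I (nestedComm 1 Q J F)).1 [] =
      (iota (B.derivedSec hQ I).val (nestedComm 1 Q J F)).1 [] +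
        (nestedComm 1 Q I (iota (B.derivedSec hQ J).val F)).1 [] := by
    intro I J
    -- Q_I and ι(s_I) agree on the zero section for functions vanishing there; this is applied to
    -- Q_J F minus its restriction, which is ι(s_J) F.
    have h1 := B.iota_derivedSec_nil hQ I
      (F := nestedComm 1 Q J F - ofBase ((nestedComm 1 Q J F).1 [])) (by simp)
    rw [map_sub, map_sub, iota_ofBase, sub_zero, val_sub] at h1
    rw [h1, hF, B.iota_derivedSec_nil hQ J hF0, sub_add_cancel]
  have hL : (iota (∑ I : Finset (Fin n), psgn (koszulExp 1 Iᶜ u) •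
      (B.derivedSec hQ (subList u Iᶜ ++ [B.derivedSec hQ (subList u I)])).val) F).1 [] =
      ∑ I : Finset (Fin n), psgn (koszulExp 1 Iᶜ u) •
        (nestedComm 1 Q (subList u Iᶜ ++ [B.derivedSec hQ (subList u I)]) F).1 [] := by
    refine (map_sum (iotaCoeff F []) _ _).trans (Finset.sum_congr rfl fun I _ => ?_)
    rw [map_zsmul, ← B.iota_derivedSec_nil hQ _ hF0]
    rfl
  have hR := nestedComm_comp u 1 1 Q Q F
  rw [hL, show (0 : ZMod 2) = 1 + 1 by decide, hR, val_sum]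
  simp only [val_zsmul, hsplit, smul_add, Finset.sum_add_distrib]
  -- Reindexing the second half by complements puts ι(s_I) Q_J F and Q_J ι(s_I) F, with J the
  -- complement of I, into the same summand: together they form [Q_J, ι(s_I)] F.
  rw [← Equiv.sum_comp (Equiv.ofBijective _ (compl_bijective (α := Finset (Fin n))))
    (fun I => psgn (koszulExp 1 I u) •
      (nestedComm 1 Q (subList u I) (iota (B.derivedSec hQ (subList u Iᶜ)).val F)).1 []),
    ← Finset.sum_add_distrib]
  refine Finset.sum_congr rfl fun I _ => ?_
  simp only [Equiv.ofBijective_apply, compl_compl]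
  rw [nestedComm_concat, superComm_apply, val_sub, val_zsmul, B.derivedSec_par]
  have hk := koszulExp_add_compl I u
  generalize koszulExp 1 I u = k at *
  generalize koszulExp 1 Iᶜ u = k' at *
  generalize shiftedPar (subList u I) = p at *
  generalize shiftedPar (subList u Iᶜ) = p' at *
  have hk2 : psgn k = -(psgn k' * psgn ((1 + p') * (1 + p + 1 + 1))) := by
    revert k k' p p'; decide
  rw [hk2, smul_sub, smul_smul, neg_smul]
  abel

/-- A superderivation is determined by its derived brackets if functions on the base act
faithfully on sections. -/
theorem eq_zero_of_derivedSec (hfaith : ∀ g : A, (∀ v : L, g • v = 0) → g = 0)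
    (hY : IsSuperDer a Y) (h : ∀ l, (B.derivedSec hY l).val = 0) : Y = 0 := by
  have hbase : ∀ f, Y (ofBase f) = 0 := by
    intro f
    induction f using DirectSum.Decomposition.inductionOn 𝒜 with
    | zero => rw [ofBase_zero, map_zero]
    | add f g hf hg => rw [ofBase_add, map_add, hf, hg, add_zero]
    | homogeneous f =>
      rename_i d
      refine ext_apply fun l => ?_
      have h1 : (nestedComm a Y l (ofBase (f : A))).1 [] = 0 := by
        refine hfaith _ fun σ => ?_
        rw [← HSec.sum_proj (ℒ := ℒ) σ, Finset.smul_sum]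
        refine Finset.sum_eq_zero fun p _ => ?_
        -- In the Leibniz rule both derived sections vanish, leaving the anchor of f times v equal
        -- to zero.
        have h2 := B.derivedSec_concat_fsmul hY l f.2 (v := HSec.proj ℒ p σ)
          (w := HSec.fsmul B.smul_mem f.2 (HSec.proj ℒ p σ)) rfl rfl
        rw [h, h, smul_zero, smul_zero, add_zero] at h2
        exact psgn_smul_eq_zero.mp h2.symm
      rw [nestedComm_ofBase_nil, psgn_smul_eq_zero] at h1
      exact h1
  refine B.eq_zero_of_coord hY hbase fun x i => ext_apply fun l => ?_
  -- The base being killed, the Taylor coefficients of Y on a coordinate are, up to sign, given by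
  -- the derived sections.
  refine apply_eq_zero_of_nestedComm (F := B.coord x i) (fun u => ⟨_, iota_linear u _⟩) l a Y hbase
    fun k => ?_
  rw [← B.iota_derivedSec_nil hY k (B.coord_nil x i), h, iota_zero]
  rfl

end LocalBases

end DerivedBrackets

/-! ### Families on `Fin n` as lists: changing one entry and exchanging neighbours -/

section Families

/-- Turns a slot of a family into the form `l₁ ++ a :: l₂` used for lists. The last clause recovers
the sum over the preceding arguments in the sign of `anchor_smul`. -/
theorem ofFn_update {α : Type*} {n : ℕ} [inst : DecidableEq (Fin n)] : ∀ (u : Fin n → α) (k : Fin n),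
    ∃ l₁ l₂ : List α, (∀ a, List.ofFn (Function.update u k a) = l₁ ++ a :: l₂) ∧
      l₁.length + l₂.length + 1 = n ∧
      ∀ {V : Type} [AddCommMonoid V] (g : α → V),
        (l₁.map g).sum = ∑ i ∈ Finset.Iio k, g (u i) := by
  -- The axioms of `MultilinearMap` quantify over the decidability instance; it is replaced by the
  -- canonical one before the induction.
  rw [Subsingleton.elim inst (instDecidableEqFin n)]
  clear inst
  induction n with
  | zero => intro u k; exact k.elim0
  | succ n ih =>
    intro u k
    cases k using Fin.cases with
    | zero =>
      refine ⟨[], List.ofFn fun i => u i.succ, fun a => ?_, by simp, fun g => ?_⟩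
      · rw [List.ofFn_succ]; simp
      · have : Finset.Iio (0 : Fin (n + 1)) = ∅ := by ext i; simp
        simp [this]
    | succ k =>
      obtain ⟨l₁, l₂, h1, h2, h3⟩ := ih (fun i => u i.succ) k
      refine ⟨u 0 :: l₁, l₂, fun a => ?_, by simp only [List.length_cons]; omega, fun g => ?_⟩
      · have e : (fun i : Fin n => Function.update u k.succ a i.succ) =
            Function.update (fun i => u i.succ) k a := by
          funext i
          by_cases h : i = k
          · subst h; simp
          · rw [Function.update_of_ne h, Function.update_of_ne (by simpa using h)]
        rw [List.ofFn_succ, e, h1 a, Function.update_of_ne (Fin.succ_ne_zero _).symm]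
        rfl
      · have : Finset.Iio k.succ = insert 0 (shiftSet (Finset.Iio k)) := by
          ext i; cases i using Fin.cases <;> simp
        rw [this, sum_insert_shiftSet, List.map_cons, List.sum_cons, h3]

theorem ofFn_swap {α : Type*} {n : ℕ} : ∀ (u : Fin n → α) (i j : Fin n), (i : ℕ) + 1 = j →
    ∃ l₁ l₂ : List α, List.ofFn u = l₁ ++ u i :: u j :: l₂ ∧
      List.ofFn (fun k => u (Equiv.swap i j k)) = l₁ ++ u j :: u i :: l₂ := by
  induction n with
  | zero => intro u i; exact i.elim0
  | succ n ih =>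
    intro u i j hij
    cases j using Fin.cases with
    | zero => simp at hij
    | succ j =>
      cases i using Fin.cases with
      | zero =>
        cases n with
        | zero => exact j.elim0
        | succ n =>
          have hj : j = 0 := by
            ext; simpa using hij.symm
          subst hj
          refine ⟨[], List.ofFn fun i => u i.succ.succ, by simp [List.ofFn_succ], ?_⟩
          have e : ∀ k : Fin n, Equiv.swap (0 : Fin (n + 2)) (Fin.succ 0) k.succ.succ =
              k.succ.succ := fun k =>
            Equiv.swap_apply_of_ne_of_ne (Fin.succ_ne_zero _)
              fun h => absurd (Fin.succ_inj.mp h) (Fin.succ_ne_zero _)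
          simp only [List.ofFn_succ, List.nil_append, Equiv.swap_apply_left,
            Equiv.swap_apply_right, e]
      | succ i =>
        obtain ⟨l₁, l₂, h1, h2⟩ := ih (fun k => u k.succ) i j (by simpa using hij)
        refine ⟨u 0 :: l₁, l₂, ?_, ?_⟩
        · rw [List.ofFn_succ, h1]; rfl
        · have e : ∀ k : Fin n, Equiv.swap i.succ j.succ k.succ = (Equiv.swap i j k).succ := by
            intro k
            simp only [Equiv.swap_apply_def, Fin.succ_inj]
            split_ifs <;> rfl
          simp only [List.ofFn_succ, List.cons_append, ← h2, e, Equiv.swap_apply_of_ne_of_ne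
            (Fin.succ_ne_zero _).symm (Fin.succ_ne_zero _).symm]

end Families

/-! ### Multilinear maps from their values on homogeneous sections -/

section Multilinear

variable {L : Type*} [AddCommGroup L] [Module ℝ L] {ℒ : ZMod 2 → Submodule ℝ L}
  [DirectSum.Decomposition ℒ]

/-- Real multilinearity of a function of lists of homogeneous sections. -/
structure IsSlotLinear {V : Type*} [AddCommGroup V] [Module ℝ V] (T : List (HSec ℒ) → V) :
    Prop where
  add : ∀ (l₁ l₂ : List (HSec ℒ)) (a b c : HSec ℒ), a.par = c.par → b.par = c.par →
    c.val = a.val + b.val → T (l₁ ++ c :: l₂) = T (l₁ ++ a :: l₂) + T (l₁ ++ b :: l₂)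
  smul : ∀ (l₁ l₂ : List (HSec ℒ)) (t : ℝ) (a b : HSec ℒ), b.par = a.par →
    b.val = t • a.val → T (l₁ ++ b :: l₂) = t • T (l₁ ++ a :: l₂)

theorem proj_update {n : ℕ} [DecidableEq (Fin n)] (p : Fin n → ZMod 2) (m : Fin n → L) (k : Fin n)
    (x : L) : (fun i => HSec.proj ℒ (p i) (Function.update m k x i)) =
      Function.update (fun i => HSec.proj ℒ (p i) (m i)) k (HSec.proj ℒ (p k) x) := by
  funext j
  exact Function.apply_update (fun i => HSec.proj ℒ (p i)) m k x j

/-- The multilinear extension of a function of lists of homogeneous sections. -/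
def IsSlotLinear.toMultilinearMap {V : Type*} [AddCommGroup V] [Module ℝ V]
    {T : List (HSec ℒ) → V} (hT : IsSlotLinear T) (n : ℕ) :
    MultilinearMap ℝ (fun _ : Fin n => L) V where
  toFun m := ∑ p : Fin n → ZMod 2, T (List.ofFn fun i => HSec.proj ℒ (p i) (m i))
  map_update_add' m k x y := by
    rw [← Finset.sum_add_distrib]
    refine Finset.sum_congr rfl fun p _ => ?_
    obtain ⟨l₁, l₂, h, -⟩ := ofFn_update (fun i => HSec.proj ℒ (p i) (m i)) k
    rw [proj_update, proj_update, proj_update, h, h, h]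
    refine hT.add _ _ _ _ _ rfl rfl ?_
    simp [HSec.proj]
  map_update_smul' m k t x := by
    rw [Finset.smul_sum]
    refine Finset.sum_congr rfl fun p _ => ?_
    obtain ⟨l₁, l₂, h, -⟩ := ofFn_update (fun i => HSec.proj ℒ (p i) (m i)) k
    rw [proj_update, proj_update, h, h]
    refine hT.smul _ _ _ _ _ rfl ?_
    simp only [HSec.proj, DirectSum.decompose_smul]
    rfl

theorem IsSlotLinear.toMultilinearMap_apply {V : Type*} [AddCommGroup V] [Module ℝ V]
    {T : List (HSec ℒ) → V} (hT : IsSlotLinear T) {n : ℕ} (u : Fin n → HSec ℒ) :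
    hT.toMultilinearMap n (fun i => (u i).val) = T (List.ofFn u) := by
  change ∑ p : Fin n → ZMod 2, T (List.ofFn fun i => HSec.proj ℒ (p i) (u i).val) = _
  rw [Finset.sum_eq_single fun i => (u i).par]
  · simp only [HSec.proj_par_val]
  · intro p _ hp
    obtain ⟨k, hk⟩ := Function.ne_iff.mp hp
    obtain ⟨l₁, l₂, h, -⟩ := ofFn_update (fun i => HSec.proj ℒ (p i) (u i).val) k
    have h2 := h (HSec.proj ℒ (p k) (u k).val)
    rw [Function.update_eq_self] at h2
    -- A wrong choice of parities puts a zero component into slot `k`; zero is 0 times itself, so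
    -- homogeneity with t = 0 kills the summand.
    rw [h2, hT.smul l₁ l₂ 0 (HSec.proj ℒ (p k) (u k).val) _ rfl, zero_smul]
    rw [HSec.proj_val_of_ne hk, smul_zero]
  · simp

/-- Multilinear maps are determined by their values on homogeneous sections. -/
theorem multilinearMap_ext_hSec {V : Type*} [AddCommGroup V] [Module ℝ V] {n : ℕ}
    {f g : MultilinearMap ℝ (fun _ : Fin n => L) V}
    (h : ∀ u : Fin n → HSec ℒ, f (fun i => (u i).val) = g fun i => (u i).val) : f = g := by
  refine MultilinearMap.ext fun m => ?_
  have hm : m = fun i => ∑ p, (HSec.proj ℒ p (m i)).val := by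
    funext i; rw [HSec.sum_proj]
  rw [hm, MultilinearMap.map_sum, MultilinearMap.map_sum]
  exact Finset.sum_congr rfl fun p _ => h fun i => HSec.proj ℒ (p i) (m i)

end Multilinear

/-! ### The derived operations and the L_∞-algebroid axioms -/

section Main

open FormalFun

variable {A L : Type*} [Ring A] [Algebra ℝ A] {𝒜 : ZMod 2 → Submodule ℝ A} [GradedAlgebra 𝒜]
  [IsSupercommutative 𝒜] [AddCommGroup L] [Module A L] [Module ℝ L] {ℒ : ZMod 2 → Submodule ℝ L}

/-! ### Dependence of the signs on the arguments -/

theorem listExp_slot (l₁ l₂ : List (HSec ℒ)) {d : ZMod 2} {u v : HSec ℒ} (h : v.par = d + u.par) :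
    listExp (l₁ ++ v :: l₂) = d * l₂.length + listExp (l₁ ++ u :: l₂) := by
  induction l₁ with
  | nil => simp only [List.nil_append, listExp, h]; ring
  | cons w l ih =>
    simp only [List.cons_append, listExp, ih, List.length_append, List.length_cons]
    ring

theorem listExp_swap (l₁ l₂ : List (HSec ℒ)) (u v : HSec ℒ) :
    listExp (l₁ ++ u :: v :: l₂) = u.par + v.par + listExp (l₁ ++ v :: u :: l₂) := by
  induction l₁ with
  | nil =>
    have h : ∀ x : ZMod 2, x + x = 0 := by decide
    simp only [List.nil_append, listExp, List.length_cons]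
    push_cast
    linear_combination -h v.par
  | cons w l ih =>
    simp only [List.cons_append, listExp, ih, List.length_append, List.length_cons]
    ring

theorem baseExp_add (l : List (HSec ℒ)) : ∀ d x : ZMod 2,
    baseExp (d + x) l = d * shiftedPar l + baseExp x l := by
  induction l with
  | nil => intro d x; simp [baseExp]
  | cons w l ih =>
    intro d x
    rw [baseExp, baseExp, add_assoc d, ih, shiftedPar_cons]
    ring

theorem baseExp_slot (l₁ l₂ : List (HSec ℒ)) {d : ZMod 2} {u v : HSec ℒ} (h : v.par = d + u.par) :
    ∀ x : ZMod 2, baseExp x (l₁ ++ v :: l₂) =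
      d * (x + shiftedPar l₁ + shiftedPar l₂) + baseExp x (l₁ ++ u :: l₂) := by
  induction l₁ with
  | nil =>
    intro x
    have e : x + (d + u.par + 1) = d + (x + (u.par + 1)) := by ring
    simp only [List.nil_append, baseExp, h, e, baseExp_add, shiftedPar_nil]
    ring
  | cons w l ih =>
    intro x
    simp only [List.cons_append, baseExp, ih, shiftedPar_cons]
    ring

variable [DirectSum.Decomposition ℒ]

/-! ### Real homogeneity -/

theorem nestedComm_smul (l : List (HSec ℒ)) :
    ∀ (a : ZMod 2) (t : ℝ) (Y : FormalFun 𝒜 ℒ →ₗ[ℝ] FormalFun 𝒜 ℒ),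
    nestedComm a (t • Y) l = t • nestedComm a Y l := by
  induction l with
  | nil => intros; rfl
  | cons u l ih =>
    intro a t Y
    have h : superComm a (u.par + 1) (t • Y) (iota u.val) =
        t • superComm a (u.par + 1) Y (iota u.val) := by
      refine LinearMap.ext fun F => ?_
      simp only [superComm_apply, LinearMap.smul_apply, map_smul, smul_sub]
      rw [smul_comm t]
    simp only [nestedComm, h, ih]

theorem iota_real_smul [IsScalarTower ℝ A L]
    (h𝒜 : ∀ {i j : ZMod 2} {f : A} {σ : L}, f ∈ 𝒜 i → σ ∈ ℒ j → f • σ ∈ ℒ (i + j))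
    (t : ℝ) (u : HSec ℒ) :
    iota (𝒜 := 𝒜) (ℒ := ℒ) (t • u.val) = t • iota u.val := by
  have ht : algebraMap ℝ A t ∈ 𝒜 0 := SetLike.algebraMap_mem_graded 𝒜 t
  refine LinearMap.ext fun F => ext_apply fun l => ?_
  rw [← algebraMap_smul A t u.val, iota_fsmul h𝒜 ht, psgn_zero, one_smul,
    ofBase_even_mul_apply ht, LinearMap.smul_apply, val_smul, Algebra.smul_def]

theorem nestedComm_slot_smul [IsScalarTower ℝ A L]
    (h𝒜 : ∀ {i j : ZMod 2} {f : A} {σ : L}, f ∈ 𝒜 i → σ ∈ ℒ j → f • σ ∈ ℒ (i + j))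
    (l₁ l₂ : List (HSec ℒ)) {t : ℝ} {u v : HSec ℒ} (h1 : v.par = u.par) (h2 : v.val = t • u.val)
    (a : ZMod 2) (Y : FormalFun 𝒜 ℒ →ₗ[ℝ] FormalFun 𝒜 ℒ) :
    nestedComm a Y (l₁ ++ v :: l₂) = t • nestedComm a Y (l₁ ++ u :: l₂) := by
  have h : ∀ (b : ZMod 2) (Z : FormalFun 𝒜 ℒ →ₗ[ℝ] FormalFun 𝒜 ℒ),
      superComm b (u.par + 1) Z (iota v.val) = t • superComm b (u.par + 1) Z (iota u.val) := by
    intro b Z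
    have hi := iota_real_smul (𝒜 := 𝒜) (ℒ := ℒ) h𝒜 t u
    refine LinearMap.ext fun F => ?_
    simp only [h2, hi, superComm_apply, LinearMap.smul_apply, map_smul, smul_sub]
    rw [smul_comm t]
  rw [nestedComm_append, nestedComm_append, nestedComm, nestedComm, h1, h, nestedComm_smul]

/-- Iterated commutators, applied to functions on the base, are tensorial. -/
theorem nestedComm_ofBase_slot_fsmul (l₁ l₂ : List (HSec ℒ)) {d : ZMod 2} {f : A} (hf : f ∈ 𝒜 d)
    {u v : HSec ℒ} (h1 : v.par = d + u.par) (h2 : v.val = f • u.val) (a : ZMod 2)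
    (Y : FormalFun 𝒜 ℒ →ₗ[ℝ] FormalFun 𝒜 ℒ) (g : A) :
    (nestedComm a Y (l₁ ++ v :: l₂) (ofBase g)).1 [] = psgn (d * (a + shiftedPar l₁ + 1)) •
      (f * (nestedComm a Y (l₁ ++ u :: l₂) (ofBase g)).1 []) := by
  -- Up to sign both sides are Taylor coefficients of the formal function Y g, which are tensorial
  -- by definition.
  rw [nestedComm_ofBase_nil, nestedComm_ofBase_nil, (Y (ofBase g)).2.smul l₁ l₂ d f u v hf h1 h2,
    baseExp_slot l₁ l₂ h1, mul_smul_comm, smul_smul, smul_smul, ← psgn_add, ← psgn_add]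
  congr 2
  generalize shiftedPar l₁ = x
  generalize shiftedPar l₂ = y
  generalize baseExp a (l₁ ++ u :: l₂) = z
  clear hf h1
  revert a d x y z; decide

/-- Functions on the base as formal functions, linearly. -/
def ofBaseLin : A →ₗ[ℝ] FormalFun 𝒜 ℒ where
  toFun := ofBase
  map_add' := ofBase_add
  map_smul' := ofBase_smul

/-- The derived anchor of a list of sections. -/
def derivedAnchor (Q : FormalFun 𝒜 ℒ →ₗ[ℝ] FormalFun 𝒜 ℒ) (l : List (HSec ℒ)) : A →ₗ[ℝ] A :=
  psgn (listExp l + l.length + 1) • (coeff [] ∘ₗ nestedComm 1 Q l ∘ₗ ofBaseLin)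

theorem derivedAnchor_apply (Q : FormalFun 𝒜 ℒ →ₗ[ℝ] FormalFun 𝒜 ℒ) (l : List (HSec ℒ)) (f : A) :
    derivedAnchor Q l f =
      psgn (listExp l + l.length + 1) • (nestedComm 1 Q l (ofBase f)).1 [] := rfl

namespace LocalBases

variable {X ι : Type*} [Fintype ι] (B : LocalBases 𝒜 ℒ X ι)
  {Q : FormalFun 𝒜 ℒ →ₗ[ℝ] FormalFun 𝒜 ℒ}

/-- The derived bracket of a list of sections. -/
noncomputable def derivedBracket (hQ : IsSuperDer 1 Q) (l : List (HSec ℒ)) : L :=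
  psgn (listExp l) • (B.derivedSec hQ l).val

theorem derivedSec_slot_smul [IsScalarTower ℝ A L] {a : ZMod 2} (hQ : IsSuperDer a Q)
    (l₁ l₂ : List (HSec ℒ)) {t : ℝ} {u v : HSec ℒ} (h1 : v.par = u.par) (h2 : v.val = t • u.val) :
    (B.derivedSec hQ (l₁ ++ v :: l₂)).val = t • (B.derivedSec hQ (l₁ ++ u :: l₂)).val := by
  refine (B.eq_derivedSec hQ _ fun x i => ?_).symm
  rw [iota_real_smul B.smul_mem, nestedComm_slot_smul B.smul_mem l₁ l₂ h1 h2,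
    LinearMap.smul_apply, LinearMap.smul_apply, val_smul, val_smul,
    B.iota_derivedSec_nil hQ _ (B.coord_nil x i)]

theorem isSlotLinear_derivedBracket [IsScalarTower ℝ A L] (hQ : IsSuperDer 1 Q) :
    IsSlotLinear (B.derivedBracket hQ) where
  add l₁ l₂ u v w h1 h2 h3 := by
    have e1 := listExp_slot l₁ l₂ (u := w) (v := u) (d := 0) (by rw [h1, zero_add])
    have e2 := listExp_slot l₁ l₂ (u := w) (v := v) (d := 0) (by rw [h2, zero_add])
    rw [zero_mul, zero_add] at e1 e2
    rw [derivedBracket, derivedBracket, derivedBracket, B.derivedSec_slot_add hQ l₁ l₂ h1 h2 h3,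
      e1, e2, smul_add]
  smul l₁ l₂ t u v h1 h2 := by
    have e1 := listExp_slot l₁ l₂ (u := u) (v := v) (d := 0) (by rw [h1, zero_add])
    rw [zero_mul, zero_add] at e1
    rw [derivedBracket, derivedBracket, B.derivedSec_slot_smul hQ l₁ l₂ h1 h2, e1, smul_comm]

theorem isSlotLinear_derivedAnchor [IsScalarTower ℝ A L] (B : LocalBases 𝒜 ℒ X ι)
    (Q : FormalFun 𝒜 ℒ →ₗ[ℝ] FormalFun 𝒜 ℒ) :
    IsSlotLinear (ℒ := ℒ) (derivedAnchor Q) where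
  add l₁ l₂ u v w h1 h2 h3 := by
    have e1 := listExp_slot l₁ l₂ (u := w) (v := u) (d := 0) (by rw [h1, zero_add])
    have e2 := listExp_slot l₁ l₂ (u := w) (v := v) (d := 0) (by rw [h2, zero_add])
    rw [zero_mul, zero_add] at e1 e2
    refine LinearMap.ext fun f => ?_
    simp only [LinearMap.add_apply, derivedAnchor_apply, nestedComm_slot_add l₁ l₂ h1 h2 h3,
      e1, e2, val_add, smul_add, List.length_append, List.length_cons]
  smul l₁ l₂ t u v h1 h2 := by
    have e1 := listExp_slot l₁ l₂ (u := u) (v := v) (d := 0) (by rw [h1, zero_add])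
    rw [zero_mul, zero_add] at e1
    refine LinearMap.ext fun f => ?_
    simp only [LinearMap.smul_apply, derivedAnchor_apply,
      nestedComm_slot_smul B.smul_mem l₁ l₂ h1 h2, e1, val_smul, List.length_append,
      List.length_cons]
    rw [smul_comm]

/-- Makes the implicit definition explicit: ι is injective and hits the weight -1 part by
`iota_symb`, while on base functions the weight 0 part is restriction to the zero section. -/
theorem isDerivedFrom_iff (hQ : IsSuperDer 1 Q) (ops : HigherOps A L) :
    IsDerivedFrom Q ops ↔
      (∀ (n : ℕ) (u : Fin n → HSec ℒ),
        ops.bracket n (fun i => (u i).val) = B.derivedBracket hQ (List.ofFn u)) ∧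
      ∀ (n : ℕ) (u : Fin n → HSec ℒ),
        ops.anchor n (fun i => (u i).val) = derivedAnchor Q (List.ofFn u) := by
  have h1 : ∀ (n : ℕ) (u : Fin n → HSec ℒ) (σ : L),
      iota (𝒜 := 𝒜) σ = psgn (derivedExp u) • weightPart (-1) (nestedComm 1 Q (List.ofFn u)) ↔
        σ = B.derivedBracket hQ (List.ofFn u) := by
    intro n u σ
    rw [← B.iota_symb (hQ.nestedComm (List.ofFn u)), ← iota_zsmul, B.iota_injective.eq_iff,
      derivedExp_eq_listExp]
    rfl
  have h2 : ∀ (n : ℕ) (u : Fin n → HSec ℒ) (f g : A),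
      ofBase g = psgn (derivedExp u + (n : ZMod 2) + 1) •
        weightPart 0 (nestedComm 1 Q (List.ofFn u)) (ofBase f) ↔
      g = derivedAnchor Q (List.ofFn u) f := by
    intro n u f g
    rw [weightPart_zero_ofBase, ← ofBase_zsmul, ofBase_injective.eq_iff, derivedExp_eq_listExp,
      derivedAnchor_apply, List.length_ofFn]
  constructor
  · rintro ⟨hb, ha⟩
    exact ⟨fun n u => (h1 n u _).mp (hb n u), fun n u => LinearMap.ext fun f =>
      (h2 n u f _).mp (ha n u f)⟩
  · rintro ⟨hb, ha⟩
    exact ⟨fun n u => (h1 n u _).mpr (hb n u), fun n u f => (h2 n u f _).mpr (by rw [ha])⟩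

theorem existsUnique_isDerivedFrom [IsScalarTower ℝ A L] (B : LocalBases 𝒜 ℒ X ι)
    (hQ : IsSuperDer 1 Q) : ∃! ops : HigherOps A L, IsDerivedFrom Q ops := by
  refine ⟨⟨(B.isSlotLinear_derivedBracket hQ).toMultilinearMap,
    (B.isSlotLinear_derivedAnchor Q).toMultilinearMap⟩, ?_, fun ops hops => ?_⟩
  · exact (B.isDerivedFrom_iff hQ _).mpr
      ⟨fun n u => (B.isSlotLinear_derivedBracket hQ).toMultilinearMap_apply u,
        fun n u => (B.isSlotLinear_derivedAnchor Q).toMultilinearMap_apply u⟩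
  · obtain ⟨hb, ha⟩ := (B.isDerivedFrom_iff hQ ops).mp hops
    refine HigherOps.ext (funext fun n => multilinearMap_ext_hSec (ℒ := ℒ) fun u => ?_)
      (funext fun n => multilinearMap_ext_hSec (ℒ := ℒ) fun u => ?_)
    · rw [hb]; exact ((B.isSlotLinear_derivedBracket hQ).toMultilinearMap_apply u).symm
    · rw [ha]; exact ((B.isSlotLinear_derivedAnchor Q).toMultilinearMap_apply u).symm

/-! ### Properties of the derived operations -/

theorem derivedBracket_mem (hQ : IsSuperDer 1 Q) (l : List (HSec ℒ)) :
    B.derivedBracket hQ l ∈ ℒ (shiftedPar l) := by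
  have h := (B.derivedSec hQ l).mem
  have e : (B.derivedSec hQ l).par = shiftedPar l := by
    rw [B.derivedSec_par]
    generalize shiftedPar l = x
    revert x; decide
  rw [e] at h
  exact zsmul_mem h _

/-- The exchange changes ε by x + y, and (x+1)(y+1) + x + y = 1 + xy modulo 2 turns graded symmetry
in shifted parities into graded antisymmetry. -/
theorem derivedBracket_swap (hQ : IsSuperDer 1 Q) (l₁ l₂ : List (HSec ℒ)) (u v : HSec ℒ) :
    B.derivedBracket hQ (l₁ ++ v :: u :: l₂) =
      -(psgn (u.par * v.par) • B.derivedBracket hQ (l₁ ++ u :: v :: l₂)) := by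
  rw [derivedBracket, derivedBracket, B.derivedSec_swap, listExp_swap, smul_smul, smul_smul,
    ← neg_smul, ← psgn_add, ← psgn_add, ← psgn_one_add]
  congr 2
  generalize u.par = x
  generalize v.par = y
  generalize listExp (l₁ ++ u :: v :: l₂) = z
  revert x y z; decide

theorem derivedAnchor_swap (Q : FormalFun 𝒜 ℒ →ₗ[ℝ] FormalFun 𝒜 ℒ) (l₁ l₂ : List (HSec ℒ))
    (u v : HSec ℒ) :
    derivedAnchor Q (l₁ ++ v :: u :: l₂) =
      -(psgn (u.par * v.par) • derivedAnchor Q (l₁ ++ u :: v :: l₂)) := by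
  refine LinearMap.ext fun f => ?_
  rw [LinearMap.neg_apply, LinearMap.smul_apply, derivedAnchor_apply, derivedAnchor_apply,
    nestedComm_swap, listExp_swap, LinearMap.smul_apply, val_zsmul, smul_smul, smul_smul,
    ← neg_smul, ← psgn_add, ← psgn_add, ← psgn_one_add]
  simp only [List.length_append, List.length_cons]
  congr 2
  generalize u.par = x
  generalize v.par = y
  generalize listExp (l₁ ++ u :: v :: l₂) = z
  generalize ((l₁.length + (l₂.length + 1 + 1) : ℕ) : ZMod 2) = n
  revert x y z n; decide

theorem derivedAnchor_mem (hQ : IsSuperDer 1 Q) (l : List (HSec ℒ)) {d : ZMod 2} {f : A}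
    (hf : f ∈ 𝒜 d) : derivedAnchor Q l f ∈ 𝒜 (1 + shiftedPar l + d) := by
  have h := (hQ.nestedComm l).parity d _ (hasParity_ofBase hf) []
  rw [shiftedPar_nil, add_zero] at h
  exact zsmul_mem h _

theorem derivedAnchor_mul (hQ : IsSuperDer 1 Q) (l : List (HSec ℒ)) {d : ZMod 2} {f : A}
    (hf : f ∈ 𝒜 d) (g : A) :
    derivedAnchor Q l (f * g) = derivedAnchor Q l f * g +
      psgn ((1 + shiftedPar l) * d) • (f * derivedAnchor Q l g) := by
  rw [derivedAnchor_apply, derivedAnchor_apply, derivedAnchor_apply, ← ofBase_mul,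
    (hQ.nestedComm l).leibniz d _ _ (hasParity_ofBase hf), val_add, val_zsmul, mul_nil, mul_nil,
    ofBase_nil, ofBase_nil, smul_add, smul_mul_assoc, mul_smul_comm]
  congr 1
  rw [smul_comm]

/-- The Jacobiators of the derived brackets of `Q` are the derived brackets of `Q²`. -/
theorem jacobiator_eq (hQ : IsSuperDer 1 Q) {br : ∀ n : ℕ, MultilinearMap ℝ (fun _ : Fin n => L) L}
    (hbr : ∀ (n : ℕ) (u : Fin n → HSec ℒ),
      br n (fun i => (u i).val) = B.derivedBracket hQ (List.ofFn u))
    {n : ℕ} (u : Fin n → HSec ℒ) :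
    jacobiator br u =
      psgn (listExp (List.ofFn u)) • (B.derivedSec hQ.comp_self (List.ofFn u)).val := by
  rw [B.derivedSec_comp_self hQ, Finset.smul_sum, jacobiator]
  refine Finset.sum_congr rfl fun I _ => ?_
  -- The inner bracket as a homogeneous section, so that it can serve as an argument of the outer
  -- one; it differs from the derived section by its prefactor.
  let w : HSec ℒ := ⟨shiftedPar (subList u I), B.derivedBracket hQ (subList u I),
    B.derivedBracket_mem hQ _⟩
  have hw : br I.card (fun k => (u (I.orderEmbOfFin rfl k)).val) = w.val := hbr _ _
  have hcons : (Fin.cons (α := fun _ => L) w.val fun k => (u (Iᶜ.orderEmbOfFin rfl k)).val) =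
      fun i => ((Fin.cons (α := fun _ => HSec ℒ) w fun k => u (Iᶜ.orderEmbOfFin rfl k)) i).val := by
    funext i
    cases i using Fin.cases <;> rfl
  have hlist : List.ofFn (Fin.cons (α := fun _ => HSec ℒ) w fun k => u (Iᶜ.orderEmbOfFin rfl k)) =
      w :: subList u Iᶜ := by
    rw [List.ofFn_succ]; rfl
  have hpar : w.par = (B.derivedSec hQ (subList u I)).par := by
    rw [B.derivedSec_par]
    change shiftedPar _ = _
    generalize shiftedPar (subList u I) = x
    revert x; decide
  rw [hw, hcons, hbr, hlist, derivedBracket, B.derivedSec_cons,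
    B.derivedSec_concat_zsmul hQ (subList u Iᶜ) hpar rfl, listExp, length_subList, shuffleExp_eq,
    smul_smul, smul_smul, smul_smul, smul_smul, ← psgn_add, ← psgn_add, ← psgn_add, ← psgn_add]
  congr 2
  have hw' : w.par = shiftedPar (subList u I) := rfl
  rw [hw']
  have h2 : ∀ x : ZMod 2, x + x = 0 := by decide
  linear_combination h2 (listExp (subList u I)) + h2 (listExp (subList u Iᶜ)) +
    h2 (shiftedPar (subList u I) * (Iᶜ.card : ZMod 2)) +
    h2 ((shiftedPar (subList u I) + 1) * shiftedPar (subList u Iᶜ))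

theorem derivedBracket_concat_fsmul (hQ : IsSuperDer 1 Q) (l : List (HSec ℒ)) {d : ZMod 2} {f : A}
    (hf : f ∈ 𝒜 d) (v : HSec ℒ) :
    B.derivedBracket hQ (l ++ [HSec.fsmul B.smul_mem hf v]) = derivedAnchor Q l f • v.val +
      psgn (d * (1 + shiftedPar l)) • (f • B.derivedBracket hQ (l ++ [v])) := by
  -- Appending an argument adds each parity in `l` once to ε, and these sum to the shifted parity of
  -- `l` plus its length; the parity of the new argument does not enter.
  have e : ∀ w : HSec ℒ, listExp (l ++ [w]) = listExp l + shiftedPar l + l.length := by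
    intro w
    induction l with
    | nil => simp [listExp]
    | cons u l ih =>
      have h2 : (1 : ZMod 2) + 1 = 0 := by decide
      simp only [List.cons_append, listExp, ih, List.length_append, shiftedPar_cons,
        List.length_cons, List.length_nil]
      push_cast
      linear_combination -h2
  rw [derivedBracket, derivedBracket, derivedAnchor_apply,
    B.derivedSec_concat_fsmul hQ l hf (v := v) rfl rfl, e, e, smul_add, smul_assoc, smul_comm f]
  congr 1
  · rw [smul_smul, ← psgn_add]
    congr 2
    have h2 : ∀ x : ZMod 2, x + x = 0 := by decide
    linear_combination h2 (shiftedPar l)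
  · rw [smul_comm, mul_comm d]

/-- The derived operations of `Q` form an `L_∞`-algebroid if and only if `Q² = 0`. -/
theorem isLInfAlgebroid_iff (B : LocalBases 𝒜 ℒ X ι)
    (hfaith : ∀ g : A, (∀ v : L, g • v = 0) → g = 0)
    (hQ : IsSuperDer 1 Q) {ops : HigherOps A L} (hops : IsDerivedFrom Q ops) :
    IsLInfAlgebroid 𝒜 ℒ ops ↔ Q ∘ₗ Q = 0 := by
  obtain ⟨hb, ha⟩ := (B.isDerivedFrom_iff hQ ops).mp hops
  have hsp : ∀ (n : ℕ) (u : Fin n → HSec ℒ),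
      1 + shiftedPar (List.ofFn u) = (n : ZMod 2) - 1 + ∑ i, (u i).par := by
    intro n u
    have h2 : (1 : ZMod 2) + 1 = 0 := by decide
    rw [shiftedPar_ofFn]
    linear_combination h2
  constructor
  · intro h
    -- Vanishing Jacobiators are vanishing derived sections of Q².
    refine B.eq_zero_of_derivedSec hfaith hQ.comp_self fun l => ?_
    have hj := h.brackets.jacobi l.length l.get
    rw [B.jacobiator_eq hQ hb, psgn_smul_eq_zero, List.ofFn_get] at hj
    exact hj
  · intro hQQ
    refine ⟨⟨?_, ?_, ?_⟩, ?_, ?_, ?_, ?_, ?_⟩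
    · intro n u
      rw [hb, ← shiftedPar_ofFn]
      exact B.derivedBracket_mem hQ _
    · intro n u i j hij
      obtain ⟨l₁, l₂, h1, h2⟩ := ofFn_swap u i j hij
      rw [hb n fun k => u (Equiv.swap i j k), hb, h1, h2, B.derivedBracket_swap hQ]
    · intro n u
      rw [B.jacobiator_eq hQ hb, psgn_smul_eq_zero]
      refine (B.eq_derivedSec hQ.comp_self _ fun x i => ?_).symm
      rw [iota_zero, hQQ, nestedComm_zero]
    · intro n u d f hf
      rw [ha, ← hsp]
      exact derivedAnchor_mem hQ _ hf
    · intro n u d f g hf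
      rw [ha, ← hsp]
      exact derivedAnchor_mul hQ _ hf g
    · intro n u k d f g hf
      obtain ⟨l₁, l₂, h1, h2, h3⟩ := ofFn_update u k
      have hupd : Function.update (fun i => (u i).val) k (f • (u k).val) =
          fun i => (Function.update u k (HSec.fsmul B.smul_mem hf (u k)) i).val := by
        funext i
        by_cases h : i = k
        · subst h; simp [HSec.fsmul]
        · rw [Function.update_of_ne h, Function.update_of_ne h]
      have hu : List.ofFn u = l₁ ++ u k :: l₂ := by
        rw [← h1, Function.update_eq_self]
      rw [hupd, ha, ha, h1, hu, derivedAnchor_apply, derivedAnchor_apply,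
        nestedComm_ofBase_slot_fsmul l₁ l₂ hf (u := u k) rfl rfl,
        listExp_slot l₁ l₂ (u := u k) (d := d) rfl, mul_smul_comm, smul_smul, smul_smul,
        ← psgn_add, ← psgn_add]
      simp only [List.length_append, List.length_cons]
      congr 2
      have hl₁ : shiftedPar l₁ = l₁.length + ∑ i ∈ Finset.Iio k, (u i).par := by
        rw [← h3 HSec.par, shiftedPar]
        clear h1 h2 h3 hu
        induction l₁ with
        | nil => simp
        | cons v l ih =>
          simp only [List.map_cons, List.sum_cons, ih, List.length_cons]
          push_cast
          ring
      have hn : (n : ZMod 2) = l₁.length + l₂.length + 1 := by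
        exact_mod_cast congrArg (Nat.cast : ℕ → ZMod 2) h2.symm
      rw [hl₁, hn]
      have e2 : (1 : ZMod 2) + 1 = 0 := by decide
      linear_combination d * e2
    · intro n u i j hij
      obtain ⟨l₁, l₂, h1, h2⟩ := ofFn_swap u i j hij
      rw [ha n fun k => u (Equiv.swap i j k), ha, h1, h2, derivedAnchor_swap]
    · intro n u d f v hf
      have hsnoc : ∀ w : HSec ℒ, ops.bracket (n + 1)
          (Fin.snoc (α := fun _ => L) (fun i => (u i).val) w.val) =
          B.derivedBracket hQ (List.ofFn u ++ [w]) := by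
        intro w
        have e1 : (Fin.snoc (α := fun _ => L) (fun i => (u i).val) w.val : Fin (n + 1) → L) =
            fun i => ((Fin.snoc (α := fun _ => HSec ℒ) u w : Fin (n + 1) → HSec ℒ) i).val := by
          funext i
          cases i using Fin.lastCases <;> simp
        have e2 : List.ofFn (Fin.snoc (α := fun _ => HSec ℒ) u w : Fin (n + 1) → HSec ℒ) =
            List.ofFn u ++ [w] := by
          rw [List.ofFn_succ', List.concat_eq_append]
          simp
        rw [e1, hb, e2]
      have hadd : ∀ σ τ : L, ops.bracket (n + 1)
          (Fin.snoc (α := fun _ => L) (fun i => (u i).val) (σ + τ)) =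
          ops.bracket (n + 1) (Fin.snoc (α := fun _ => L) (fun i => (u i).val) σ) +
          ops.bracket (n + 1) (Fin.snoc (α := fun _ => L) (fun i => (u i).val) τ) :=
        fun σ τ => MultilinearMap.snoc_add _ _ _ _
      have e : (n : ZMod 2) + 1 + ∑ i, (u i).par = 1 + shiftedPar (List.ofFn u) := by
        rw [shiftedPar_ofFn]; ring
      rw [ha, e]
      -- The axiom allows inhomogeneous v; both sides are additive in v, so homogeneous v suffice.
      induction v using DirectSum.Decomposition.inductionOn ℒ with
      | zero =>
        have h0 := hadd 0 0
        rw [add_zero] at h0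
        rw [smul_zero, smul_zero, left_eq_add.mp h0, smul_zero, smul_zero, add_zero]
      | homogeneous v =>
        rename_i p
        have h1 := B.derivedBracket_concat_fsmul hQ (List.ofFn u) hf ⟨p, v, v.2⟩
        rw [← hsnoc, ← hsnoc] at h1
        exact h1
      | add σ τ hσ hτ =>
        rw [smul_add, hadd, hadd, hσ, hτ, smul_add, smul_add, smul_add]
        abel

end LocalBases

end Main

/-! ### Gluing and locality of parity for graded sheaves -/

section Sheaves

/-- A graded sheaf of real vector spaces. -/
structure IsGradedSheaf {X : Type u} [TopologicalSpace X] (F : Opens X → Type w)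
    [∀ U, AddCommGroup (F U)] [∀ U, Module ℝ (F U)]
    (res : ∀ {V U : Opens X}, V ≤ U → F U →ₗ[ℝ] F V) (par : ∀ U, ZMod 2 → Submodule ℝ (F U)) :
    Prop where
  res_id : ∀ (U : Opens X) (s : F U), res (le_refl U) s = s
  res_res : ∀ {W V U : Opens X} (hWV : W ≤ V) (hVU : V ≤ U) (s : F U),
    res hWV (res hVU s) = res (hWV.trans hVU) s
  res_par : ∀ {V U : Opens X} (h : V ≤ U) (i : ZMod 2) (s : F U), s ∈ par U i → res h s ∈ par V i
  glue : ∀ {ι : Type u} (U : ι → Opens X) (s : ∀ i, F (U i)),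
    (∀ i j, res (inf_le_left : U i ⊓ U j ≤ U i) (s i) =
      res (inf_le_right : U i ⊓ U j ≤ U j) (s j)) →
    ∃! t : F (iSup U), ∀ i, res (le_iSup U i) t = s i

theorem sub_proj_mem {V : Type*} [AddCommGroup V] [Module ℝ V]
    (𝒱 : ZMod 2 → Submodule ℝ V) [DirectSum.Decomposition 𝒱] (k : ZMod 2) (s : V) :
    s - (HSec.proj 𝒱 k s).val ∈ 𝒱 (k + 1) := by
  have h : s - (HSec.proj 𝒱 k s).val = (HSec.proj 𝒱 (k + 1) s).val := by
    rw [sub_eq_iff_eq_add']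
    conv_lhs => rw [← HSec.sum_proj (ℒ := 𝒱) s]
    rw [show (Finset.univ : Finset (ZMod 2)) = {k, k + 1} by revert k; decide,
      Finset.sum_pair (by revert k; decide)]
  rw [h]
  exact (HSec.proj 𝒱 (k + 1) s).mem

namespace IsGradedSheaf

variable {X : Type u} [TopologicalSpace X] {F : Opens X → Type w}
    [∀ U, AddCommGroup (F U)] [∀ U, Module ℝ (F U)]
    {res : ∀ {V U : Opens X}, V ≤ U → F U →ₗ[ℝ] F V} {par : ∀ U, ZMod 2 → Submodule ℝ (F U)}
    (hF : IsGradedSheaf F res par)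

include hF

theorem ext {ι : Type u} (U : ι → Opens X) (hU : ⊤ ≤ iSup U) {s t : F ⊤}
    (h : ∀ i, res (le_top : U i ≤ ⊤) s = res (le_top : U i ≤ ⊤) t) : s = t := by
  have hu := (hF.glue U (fun i => res (le_top : U i ≤ ⊤) s) fun i j => by
    rw [hF.res_res, hF.res_res]).unique (y₁ := res (le_top : iSup U ≤ ⊤) s)
      (y₂ := res (le_top : iSup U ≤ ⊤) t) (fun i => by rw [hF.res_res]) fun i => by
        rw [hF.res_res, h]
  have h2 := congrArg (fun r => res hU r) hu
  simp only [hF.res_res, hF.res_id] at h2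
  exact h2

theorem exists_glue {ι : Type u} (U : ι → Opens X) (hU : ⊤ ≤ iSup U) (s : ∀ i, F (U i))
    (h : ∀ i j, res (inf_le_left : U i ⊓ U j ≤ U i) (s i) =
      res (inf_le_right : U i ⊓ U j ≤ U j) (s j)) :
    ∃ t : F ⊤, ∀ i, res (le_top : U i ≤ ⊤) t = s i := by
  obtain ⟨t, ht, -⟩ := hF.glue U s h
  refine ⟨res hU t, fun i => ?_⟩
  rw [hF.res_res, ← ht i]

theorem ext_two {U W : Opens X} (hUW : ⊤ ≤ U ⊔ W) {s t : F ⊤}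
    (hU : res (le_top : U ≤ ⊤) s = res (le_top : U ≤ ⊤) t)
    (hW : res (le_top : W ≤ ⊤) s = res (le_top : W ≤ ⊤) t) : s = t := by
  -- Covers are indexed in the universe of the space, hence the lifted two-element type.
  refine hF.ext (fun b : ULift.{u} Bool => if b.down then U else W) ?_ ?_
  · refine hUW.trans (sup_le ?_ ?_)
    · exact le_iSup (fun b : ULift.{u} Bool => if b.down then U else W) ⟨true⟩
    · exact le_iSup (fun b : ULift.{u} Bool => if b.down then U else W) ⟨false⟩
  · rintro ⟨_ | _⟩
    · exact hW
    · exact hU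

theorem exists_glue_two {U W : Opens X} (hUW : ⊤ ≤ U ⊔ W) (s : F U) (t : F W)
    (h : res (inf_le_left : U ⊓ W ≤ U) s = res (inf_le_right : U ⊓ W ≤ W) t) :
    ∃ r : F ⊤, res (le_top : U ≤ ⊤) r = s ∧ res (le_top : W ≤ ⊤) r = t := by
  let O : ULift.{u} Bool → Opens X := fun b => match b with
    | ⟨true⟩ => U
    | ⟨false⟩ => W
  let f : ∀ b, F (O b) := fun b => match b with
    | ⟨true⟩ => s
    | ⟨false⟩ => t
  have hO : ⊤ ≤ iSup O := hUW.trans (sup_le (le_iSup O ⟨true⟩) (le_iSup O ⟨false⟩))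
  obtain ⟨r, hr⟩ := hF.exists_glue O hO f (by
    rintro ⟨_ | _⟩ ⟨_ | _⟩
    · rfl
    · have h2 := congrArg (fun r => res (inf_comm W U).le r) h
      simp only [hF.res_res] at h2
      exact h2.symm
    · exact h
    · rfl)
  exact ⟨r, hr ⟨true⟩, hr ⟨false⟩⟩

/-- On each of the two sets, s minus its component of parity i restricts to an element of both
parities, hence to zero; so s equals that component. -/
theorem mem_of_two [∀ U, DirectSum.Decomposition (par U)] {U W : Opens X} (hUW : ⊤ ≤ U ⊔ W)
    {i : ZMod 2} {s : F ⊤} (hU : res (le_top : U ≤ ⊤) s ∈ par U i)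
    (hW : res (le_top : W ≤ ⊤) s ∈ par W i) : s ∈ par ⊤ i := by
  have hne : ∀ i : ZMod 2, i ≠ i + 1 := by decide
  have key : ∀ V : Opens X, res (le_top : V ≤ ⊤) s ∈ par V i →
      res (le_top : V ≤ ⊤) s = res (le_top : V ≤ ⊤) (HSec.proj (par ⊤) i s).val := by
    intro V hV
    rw [← sub_eq_zero, ← map_sub]
    refine eq_zero_of_mem_of_mem (par V) (i := i) (j := i + 1) (hne i) ?_ ?_
    · rw [map_sub]
      exact sub_mem hV (hF.res_par _ _ _ (HSec.proj (par ⊤) i s).mem)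
    · exact hF.res_par _ _ _ (sub_proj_mem (par ⊤) i s)
  rw [hF.ext_two hUW (key U hU) (key W hW)]
  exact (HSec.proj (par ⊤) i s).mem

end IsGradedSheaf

end Sheaves

/-! ### Bump functions -/

section Geometry

variable {p q r s : ℕ} (M : Supermanifold.{u, v} p q)

theorem Supermanifold.isGradedSheaf :
    IsGradedSheaf M.O (fun h => (M.res h).toLinearMap) M.par where
  res_id := M.res_id
  res_res := M.res_res
  res_par := M.res_par
  glue := M.glue

theorem SuperVectorBundle.isGradedSheaf {M : Supermanifold.{u, v} p q}
    (E : SuperVectorBundle.{u, v, w} M r s) :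
    IsGradedSheaf E.sec (fun h => E.res h) E.par where
  res_id := E.res_id
  res_res := E.res_res
  res_par := E.res_par
  glue := E.glue

/-- Bump functions on a supermanifold. -/
theorem Supermanifold.exists_bump (x : M.carrier) (U : Opens M.carrier) (hx : x ∈ U) :
    ∃ (V W : Opens M.carrier) (ρ : M.O ⊤), x ∈ V ∧ V ≤ U ∧ ⊤ ≤ U ⊔ W ∧ ρ ∈ M.par ⊤ 0 ∧
      M.res (le_top : V ≤ ⊤) ρ = 1 ∧ M.res (le_top : W ≤ ⊤) ρ = 0 := by
  obtain ⟨ψ, h, Φ, ⟨y, rfl⟩, -, hres⟩ := M.chart x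
  have hN : ψ ⁻¹' (U : Set M.carrier) ∈ nhds y :=
    h.continuous.continuousAt.preimage_mem_nhds (U.isOpen.mem_nhds hx)
  obtain ⟨ε, hε, hball⟩ := Metric.nhds_basis_closedBall.mem_iff.mp hN
  let b : ContDiffBump y := ⟨ε / 2, ε, by positivity, by linarith⟩
  let K := Metric.closedBall y ε
  -- Compactness of the ball and the Hausdorff property make the image closed in all of M, so that
  -- the function can be extended by zero.
  have hK : IsClosed (ψ '' K) := ((isCompact_closedBall y ε).image h.continuous).isClosed
  let V₀ : Opens (EuclideanSpace ℝ (Fin p)) := ⟨Metric.ball y (ε / 2), Metric.isOpen_ball⟩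
  let K' : Opens (EuclideanSpace ℝ (Fin p)) := ⟨Kᶜ, Metric.isClosed_closedBall.isOpen_compl⟩
  let W : Opens M.carrier := ⟨(ψ '' K)ᶜ, hK.isOpen_compl⟩
  let f : SmoothFun p ⊤ := ⟨fun z => b z.1, b.contDiff.contMDiff.comp contMDiff_subtype_val⟩
  let g : M.O (imageOpen h ⊤) := Φ ⊤ (f ⊗ₜ 1)
  have hgV : M.res (imageOpen_mono h (le_top : V₀ ≤ ⊤)) g = 1 := by
    rw [hres V₀ ⊤ le_top]
    have : ContMDiffMap.restrictRingHom 𝓘(ℝ, EuclideanSpace ℝ (Fin p)) 𝓘(ℝ, ℝ) ℝ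
        (le_top : V₀ ≤ ⊤) f = 1 := by
      ext z
      exact b.one_of_mem_closedBall (Metric.ball_subset_closedBall z.2)
    rw [this]
    exact map_one (Φ V₀)
  have hgK : M.res (imageOpen_mono h (le_top : K' ≤ ⊤)) g = 0 := by
    rw [hres K' ⊤ le_top]
    have : ContMDiffMap.restrictRingHom 𝓘(ℝ, EuclideanSpace ℝ (Fin p)) 𝓘(ℝ, ℝ) ℝ
        (le_top : K' ≤ ⊤) f = 0 := by
      ext z
      refine b.zero_of_le_dist ?_
      have : z.1 ∉ Metric.closedBall y ε := z.2
      rw [Metric.mem_closedBall, not_le] at this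
      exact this.le
    rw [this, TensorProduct.zero_tmul, map_zero]
  have hcover : ⊤ ≤ imageOpen h ⊤ ⊔ W := by
    intro z _
    by_cases hz : z ∈ ψ '' K
    · obtain ⟨k, -, rfl⟩ := hz
      exact Or.inl ⟨k, trivial, rfl⟩
    · exact Or.inr hz
  have hle : imageOpen h ⊤ ⊓ W ≤ imageOpen h K' := by
    rintro z ⟨⟨k, -, rfl⟩, hk⟩
    exact ⟨k, fun hk' => hk ⟨k, hk', rfl⟩, rfl⟩
  -- The chart function and 0 agree on the overlap, which lies in the image of the complement of K.
  obtain ⟨ρ, hρ1, hρ2⟩ := M.isGradedSheaf.exists_glue_two hcover g 0 (by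
    have h1 := congrArg (fun r => M.res hle r) hgK
    simp only [M.res_res, map_zero] at h1
    exact h1.trans (map_zero _).symm)
  have hρV : M.res (le_top : imageOpen h V₀ ≤ ⊤) ρ = 1 := by
    rw [← hgV]
    have h1 := congrArg (fun r => M.res (imageOpen_mono h (le_top : V₀ ≤ ⊤)) r) hρ1
    exact (M.res_res _ _ _).symm.trans h1
  have hρW : M.res (le_top : W ≤ ⊤) ρ = 0 := hρ2
  -- the even part of `ρ`
  have hproj : ∀ (Z : Opens M.carrier), M.res (le_top : Z ≤ ⊤) ρ ∈ M.par Z 0 →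
      M.res (le_top : Z ≤ ⊤) (HSec.proj (M.par ⊤) 0 ρ).val = M.res (le_top : Z ≤ ⊤) ρ := by
    intro Z hZ
    rw [eq_comm, ← sub_eq_zero, ← map_sub]
    refine eq_zero_of_mem_of_mem (M.par Z) (i := 0) (j := 0 + 1) (by decide) ?_
      (M.res_par _ _ _ (sub_proj_mem (M.par ⊤) 0 ρ))
    rw [map_sub]
    exact sub_mem hZ (M.res_par _ _ _ (HSec.proj (M.par ⊤) 0 ρ).mem)
  refine ⟨imageOpen h V₀, W, (HSec.proj (M.par ⊤) 0 ρ).val, ?_, ?_, ?_,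
    (HSec.proj (M.par ⊤) 0 ρ).mem, ?_, ?_⟩
  · exact ⟨y, Metric.mem_ball_self (by positivity), rfl⟩
  · rintro z ⟨k, hk, rfl⟩
    refine hball (Metric.ball_subset_closedBall (Metric.ball_subset_ball ?_ hk))
    linarith
  · intro z _
    by_cases hz : z ∈ ψ '' K
    · obtain ⟨k, hk, rfl⟩ := hz
      exact Or.inl (hball hk)
    · exact Or.inr hz
  · rw [hproj _ (by rw [hρV]; exact SetLike.GradedOne.one_mem), hρV]
  · rw [hproj _ (by rw [hρW]; exact zero_mem _), hρW]

end Geometry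

/-! ### From local frames to global local bases -/

section LocalTriviality

variable {p q r s : ℕ} {M : Supermanifold.{u, v} p q} (E : SuperVectorBundle.{u, v, w} M r s)

/-- Parities of the elements of a frame. -/
def framePar (r s : ℕ) : Fin r ⊕ Fin s → ZMod 2 := Sum.elim (fun _ => 0) fun _ => 1

/-- Extension by zero of a function, after multiplication with a bump function. -/
theorem Supermanifold.exists_extend {U W : Opens M.carrier} (hUW : ⊤ ≤ U ⊔ W) {ρ : M.O ⊤}
    (hρ : M.res (le_top : W ≤ ⊤) ρ = 0) (f : M.O U) :
    ∃ g : M.O ⊤, M.res (le_top : U ≤ ⊤) g = M.res (le_top : U ≤ ⊤) ρ * f ∧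
      M.res (le_top : W ≤ ⊤) g = 0 := by
  refine M.isGradedSheaf.exists_glue_two hUW _ _ ?_
  have h1 := congrArg (fun g => M.res (inf_le_right : U ⊓ W ≤ W) g) hρ
  simp only [M.res_res, map_zero] at h1
  simp only [AlgHom.toLinearMap_apply, map_mul, M.res_res, h1, zero_mul, map_zero]

/-- Extension by zero of a section, after multiplication with a bump function. -/
theorem SuperVectorBundle.exists_extend {U W : Opens M.carrier} (hUW : ⊤ ≤ U ⊔ W) {ρ : M.O ⊤}
    (hρ : M.res (le_top : W ≤ ⊤) ρ = 0) (σ : E.sec U) :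
    ∃ τ : E.sec ⊤, E.res (le_top : U ≤ ⊤) τ = M.res (le_top : U ≤ ⊤) ρ • σ ∧
      E.res (le_top : W ≤ ⊤) τ = 0 := by
  refine E.isGradedSheaf.exists_glue_two hUW _ _ ?_
  have h1 := congrArg (fun g => M.res (inf_le_right : U ⊓ W ≤ W) g) hρ
  simp only [M.res_res, map_zero] at h1
  rw [E.res_smul, M.res_res, h1, zero_smul, map_zero]

/-- Keeping only the coefficient components of the expected parity changes σ by an element of the
opposite parity, hence not at all; uniqueness of coefficients concludes. -/
theorem SuperVectorBundle.frame_coeff_mem {U : Opens M.carrier} {e : Fin r ⊕ Fin s → E.sec U}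
    (he : ∀ i, e i ∈ E.par U (framePar r s i))
    (hu : ∀ σ : E.sec U, ∃! c : Fin r ⊕ Fin s → M.O U, σ = ∑ i, c i • e i)
    {j : ZMod 2} {σ : E.sec U} (hσ : σ ∈ E.par U j) {c : Fin r ⊕ Fin s → M.O U}
    (hc : σ = ∑ i, c i • e i) (i : Fin r ⊕ Fin s) : c i ∈ M.par U (j + framePar r s i) := by
  let g : Fin r ⊕ Fin s → M.O U := fun i => (HSec.proj (M.par U) (j + framePar r s i) (c i)).val
  have hpar : ∀ a b : ZMod 2, a + b + b = a := by decide
  have hpar' : ∀ a b : ZMod 2, a + b + 1 + b = a + 1 := by decide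
  have hne : ∀ a : ZMod 2, a ≠ a + 1 := by decide
  have h1 : ∑ i, g i • e i ∈ E.par U j := sum_mem fun i _ => by
    have := E.smul_par U _ _ _ _ (HSec.proj (M.par U) (j + framePar r s i) (c i)).mem (he i)
    rwa [show (HSec.proj (M.par U) (j + framePar r s i) (c i)).par = j + framePar r s i from rfl,
      hpar] at this
  have h2 : σ - ∑ i, g i • e i ∈ E.par U (j + 1) := by
    rw [hc, ← Finset.sum_sub_distrib]
    refine sum_mem fun i _ => ?_
    have := E.smul_par U _ _ _ _ (sub_proj_mem (M.par U) (j + framePar r s i) (c i)) (he i)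
    rwa [hpar', sub_smul] at this
  have h3 : σ = ∑ i, g i • e i := by
    rw [← sub_eq_zero]
    exact eq_zero_of_mem_of_mem (E.par U) (hne j) (sub_mem hσ h1) h2
  have h4 : c = g := (hu σ).unique hc h3
  rw [h4]
  exact (HSec.proj (M.par U) (j + framePar r s i) (c i)).mem

/-- Local triviality, in terms of global sections and global linear forms. -/
theorem SuperVectorBundle.exists_local_basis (x : M.carrier) :
    ∃ (V : Opens M.carrier) (ρ : M.O ⊤) (e : Fin r ⊕ Fin s → HSec (E.par ⊤))
      (eps : Fin r ⊕ Fin s → E.sec ⊤ →ₗ[M.O ⊤] M.O ⊤),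
      x ∈ V ∧ ρ ∈ M.par ⊤ 0 ∧ M.res (le_top : V ≤ ⊤) ρ = 1 ∧
      (∀ i (u : HSec (E.par ⊤)), eps i u.val ∈ M.par ⊤ (u.par + (e i).par)) ∧
      (∀ σ, ρ • σ = ∑ i, eps i σ • (e i).val) ∧
      ∀ (a : M.O ⊤) (i : Fin r ⊕ Fin s), a • (e i).val = 0 → M.res (le_top : V ≤ ⊤) a = 0 := by
  obtain ⟨U, e, hxU, he0, he1, hframe⟩ := E.frame x
  obtain ⟨V, W, ρ, hxV, hVU, hUW, hρ0, hρV, hρW⟩ := M.exists_bump x U hxU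
  have he : ∀ i, e i ∈ E.par U (framePar r s i) := by
    rintro (i | i)
    · exact he0 i
    · exact he1 i
  have hu : ∀ σ : E.sec U, ∃! c : Fin r ⊕ Fin s → M.O U, σ = ∑ i, c i • e i := by
    intro σ
    have := hframe U (le_refl U) σ
    simpa only [E.res_id] using this
  have hext : ∀ {f g : M.O ⊤}, M.res (le_top : U ≤ ⊤) f = M.res (le_top : U ≤ ⊤) g →
      M.res (le_top : W ≤ ⊤) f = M.res (le_top : W ≤ ⊤) g → f = g :=
    fun h1 h2 => M.isGradedSheaf.ext_two hUW h1 h2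
  choose c hc hcu using hu
  choose extend hextU hextW using M.exists_extend hUW hρW
  choose ê hêU hêW using fun i => E.exists_extend hUW hρW (e i)
  have hcadd : ∀ σ τ, c (σ + τ) = c σ + c τ := by
    intro σ τ
    refine (hcu (σ + τ) _ ?_).symm
    simp only [Pi.add_apply, add_smul, Finset.sum_add_distrib]
    rw [← hc, ← hc]
  have hcsmul : ∀ (f : M.O U) σ, c (f • σ) = fun i => f * c σ i := by
    intro f σ
    refine (hcu (f • σ) _ ?_).symm
    simp only [mul_smul, ← Finset.smul_sum]
    rw [← hc]
  have hρpar : ∀ {Z : Opens M.carrier}, M.res (le_top : Z ≤ ⊤) ρ ∈ M.par Z 0 :=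
    M.res_par _ _ _ hρ0
  -- Even functions are central; this makes the forms `eps` linear over left multiplication.
  have hcomm : ∀ f : M.O U, M.res (le_top : U ≤ ⊤) ρ * f = f * M.res (le_top : U ≤ ⊤) ρ := by
    intro f
    rw [mul_eq_twist (M.par U) hρpar f]
    congr 1
    induction f using DirectSum.Decomposition.inductionOn (M.par U) with
    | zero => rw [map_zero]
    | homogeneous m => rw [twist_of_mem _ m.2, zero_mul, psgn_zero, one_smul]
    | add f g hf hg => rw [map_add, ← hf, ← hg]
  have hêmem : ∀ i, ê i ∈ E.par ⊤ (framePar r s i) := by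
    intro i
    refine E.isGradedSheaf.mem_of_two hUW ?_ ?_
    · rw [hêU]
      have := E.smul_par U _ _ _ _ hρpar (he i)
      rwa [zero_add] at this
    · rw [hêW]; exact zero_mem _
  let eps : Fin r ⊕ Fin s → E.sec ⊤ →ₗ[M.O ⊤] M.O ⊤ := fun i =>
    { toFun := fun σ => extend (c (E.res (le_top : U ≤ ⊤) σ) i)
      map_add' := fun σ τ => hext
        (by
          rw [map_add (M.res (le_top : U ≤ ⊤)), hextU, hextU, hextU,
            map_add (E.res (le_top : U ≤ ⊤)), hcadd, Pi.add_apply, mul_add])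
        (by rw [map_add (M.res (le_top : W ≤ ⊤)), hextW, hextW, hextW, add_zero])
      map_smul' := fun f σ => hext
        (by
          rw [RingHom.id_apply, smul_eq_mul, map_mul, hextU, hextU, E.res_smul, hcsmul,
            ← mul_assoc, ← mul_assoc, hcomm])
        (by rw [RingHom.id_apply, smul_eq_mul, map_mul, hextW, hextW, mul_zero]) }
  have heps : ∀ i σ, eps i σ = extend (c (E.res (le_top : U ≤ ⊤) σ) i) := fun _ _ => rfl
  -- The square appears because the extended frame and the extended coefficient forms carry one
  -- factor ρ each.
  refine ⟨V, ρ * ρ, fun i => ⟨framePar r s i, ê i, hêmem i⟩, eps, hxV, ?_, ?_, ?_, ?_, ?_⟩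
  · have := SetLike.mul_mem_graded hρ0 hρ0
    rwa [add_zero] at this
  · rw [map_mul, hρV, one_mul]
  · intro i u
    refine M.isGradedSheaf.mem_of_two hUW ?_ ?_
    · rw [AlgHom.toLinearMap_apply, heps, hextU]
      have := SetLike.mul_mem_graded hρpar
        (E.frame_coeff_mem he (fun σ => ⟨c σ, hc σ, hcu σ⟩)
          (E.res_par (le_top : U ≤ ⊤) _ _ u.mem) (hc _) i)
      rwa [zero_add] at this
    · rw [AlgHom.toLinearMap_apply, heps, hextW]; exact zero_mem _
  · intro σ
    refine E.isGradedSheaf.ext_two hUW ?_ ?_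
    · rw [map_sum, E.res_smul, map_mul]
      conv_lhs => rw [hc (E.res (le_top : U ≤ ⊤) σ)]
      rw [Finset.smul_sum]
      refine Finset.sum_congr rfl fun i _ => ?_
      rw [E.res_smul, heps, hextU, hêU, smul_smul, smul_smul, mul_assoc, hcomm (_ * _), hcomm]
    · rw [map_sum, E.res_smul, map_mul, hρW, mul_zero, zero_smul]
      refine (Finset.sum_eq_zero fun i _ => ?_).symm
      rw [E.res_smul, hêW, smul_zero]
  · intro a i hai
    have h1 : M.res (le_top : V ≤ ⊤) a • E.res hVU (e i) = 0 := by
      have h2 := congrArg (fun τ => E.res hVU (E.res (le_top : U ≤ ⊤) τ)) hai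
      simp only [E.res_smul, hêU, M.res_res, map_zero] at h2
      rwa [hρV, one_smul] at h2
    -- On V, where ρ = 1, the extended sections restrict to the frame, and the zero section has only
    -- zero coefficients.
    have h2 := (hframe V hVU 0).unique (y₁ := Pi.single i (M.res (le_top : V ≤ ⊤) a)) (y₂ := 0)
      (by
        rw [Finset.sum_eq_single i]
        · rw [Pi.single_eq_same, h1]
        · intro j _ hj
          rw [Pi.single_eq_of_ne hj, zero_smul]
        · simp) (by simp)
    have h3 := congrFun h2 i
    rwa [Pi.single_eq_same] at h3

/-- The local bases of a super vector bundle. -/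
theorem SuperVectorBundle.exists_localBases :
    ∃ (_ : LocalBases (M.par ⊤) (E.par ⊤) M.carrier (Fin r ⊕ Fin s)),
      0 < r + s → ∀ a : M.O ⊤, (∀ σ : E.sec ⊤, a • σ = 0) → a = 0 := by
  choose V ρ e eps hxV hρ0 hρV heps hexp hfaith using E.exists_local_basis
  have hV : (⊤ : Opens M.carrier) ≤ iSup V := fun x _ => (le_iSup V x) (hxV x)
  have hO : ∀ a : M.O ⊤, (∀ x, M.res (le_top : V x ≤ ⊤) a = 0) → a = 0 := fun a h =>
    M.isGradedSheaf.ext V hV fun x => (h x).trans (map_zero (M.res (le_top : V x ≤ ⊤))).symm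
  refine ⟨⟨ρ, hρ0, e, eps, heps, hexp, ?_, ?_, ?_, fun hf hσ => E.smul_par _ _ _ _ _ hf hσ⟩, ?_⟩
  · intro a h
    refine hO a fun x => ?_
    have h1 := congrArg (fun g => M.res (le_top : V x ≤ ⊤) g) (h x)
    simpa only [map_mul, hρV, one_mul, map_zero] using h1
  · intro σ h
    refine E.isGradedSheaf.ext V hV fun x => ?_
    have h1 := congrArg (fun g => E.res (le_top : V x ≤ ⊤) g) (h x)
    rw [map_zero]
    simpa only [E.res_smul, hρV, one_smul, map_zero] using h1
  · intro t ht
    -- Where both bump functions equal 1, the compatibility condition says that the two sections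
    -- coincide.
    have hloc : ∀ x y {Z : Opens M.carrier} (_ : Z ≤ V x) (_ : Z ≤ V y),
        E.res (le_top : Z ≤ ⊤) (t x) = E.res (le_top : Z ≤ ⊤) (t y) := by
      intro x y Z hx hy
      have hone : ∀ z, Z ≤ V z → M.res (le_top : Z ≤ ⊤) (ρ z) = 1 := by
        intro z hz
        have h1 := congrArg (fun g => M.res hz g) (hρV z)
        simpa only [M.res_res, map_one] using h1
      have h1 := congrArg (fun τ => E.res (le_top : Z ≤ ⊤) τ) (ht x y)
      simpa only [E.res_smul, hone x hx, hone y hy, one_smul] using h1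
    obtain ⟨σ, hσ⟩ := E.isGradedSheaf.exists_glue V hV
      (fun x => E.res (le_top : V x ≤ ⊤) (t x)) fun x y => by
        rw [E.res_res, E.res_res]
        exact hloc x y inf_le_left inf_le_right
    refine ⟨σ, fun x => E.isGradedSheaf.ext V hV fun y => ?_⟩
    have h1 := congrArg (fun τ => E.res (le_top : V y ≤ ⊤) τ) (ht x y)
    simp only [E.res_smul, hρV, one_smul] at h1
    rw [E.res_smul, hσ, h1]
  · intro hrs a ha
    -- Positive rank provides a frame element, and a function annihilating it vanishes near each
    -- point.
    have i : Fin r ⊕ Fin s := by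
      by_cases hr : 0 < r
      · exact Sum.inl ⟨0, hr⟩
      · exact Sum.inr ⟨0, by omega⟩
    exact hO a fun x => hfaith x a i (ha _)

end LocalTriviality

end SuperGeom

theorem mainTheorem4 {p q r s : ℕ} (hrs : 0 < r + s) (M : Supermanifold p q)
    (E : SuperVectorBundle M r s) (Q : E.PiFun →ₗ[ℝ] E.PiFun) (hQ : IsFormalVectorField 1 Q) :
    (∃! ops : E.Ops, IsDerivedFrom Q ops) ∧
      ∀ ops : E.Ops, IsDerivedFrom Q ops →
        (IsLInfAlgebroid (M.par ⊤) (E.par ⊤) ops ↔ Q ∘ₗ Q = 0) := by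
  obtain ⟨B, hB⟩ := E.exists_localBases
  -- The rank condition enters only as faithfulness of the action of functions on sections, needed
  -- to recover Q² from its brackets.
  exact ⟨B.existsUnique_isDerivedFrom hQ.isSuperDer,
    fun ops hops => B.isLInfAlgebroid_iff (hB hrs) hQ.isSuperDer hops⟩
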